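/- Let $C=\mathbb R/\mathbb Z$ be the circle of circumference $1$ with its arc-length metric. Let $\ell_1\ge \ell_2\ge\cdots>0$ satisfy $\ell_n=\Theta(1/n)$, i.e. there are $0<M_0\le M_1<\infty$ with $M_0/n\le \ell_n\le M_1/n$ for all $n\ge1$, and let $\alpha>0$. Let $C_{i,j}$, $Y_{i,j}$ $(i,j\ge1)$ be mutually independent random variables on a probability space, with $C_{i,j}$ uniformly distributed on $C$ and $Y_{i,j}$ exponentially distributed with parameter $\ell_i^{-\alpha}$. Put $T_{i,0}=0$, $T_{i,j}=\sum_{k=1}^{j}Y_{i,k}$, and $U_{i,t}=\sum_{j\ge1}C_{i,j}\mathbf 1_{[T_{i,j-1},T_{i,j})}(t)$ for $t\ge0$ (so the center of the $i$th arc is resampled uniformly at the points of a Poisson process of rate $\ell_i^{-\alpha}$). Let $I_{n,t}=\{y\in C: |y-U_{n,t}|<\ell_n/2\}$ be the open arc with center $U_{n,t}$ and length $\ell_n$, let $E_t=\limsup_n I_{n,t}$ be the set of points covered by infinitely many of the arcs $I_{n,t}$, and let $F_t=C\setminus E_t$. Put $$\beta_0=\inf\Big\{\beta\in\mathbb R:\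 \sum_{n=1}^\infty \frac{e^{\ell_1+\cdots+\ell_n}}{n^{1+\beta}}<\infty\Big\}.$$ Fix $x\in C$. (i) The set $\{\exists\, t\in[0,1]: x\in F_t\}$ is measurable with respect to the completion of $P$, and $P(\exists\, t\in[0,1]: x\in F_t)=1$ if and only if $$\sum_{n=1}^\infty \frac{e^{\ell_1+\cdots+\ell_n}}{n^{1+\alpha}}<\infty .$$ In particular, if $\ell_n=c/n$ for all $n$, this holds if and only if $c<\alpha$. (ii) Almost surely, the Hausdorff dimension of $\{t\in[0,1]: x\in F_t\}$ equals $\max\{1-\beta_0/\alpha,\,0\}$ (the empty set having dimension $0$). In particular, if $\ell_n=c/n$ for all $n$ with $c\le\alpha$, this dimension is a.s. $1-c/\alpha$. -/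

import Mathlib

open MeasureTheory ProbabilityTheory

/-! Dynamical circle covering with Poisson updating.

The circle of circumference `1` is `UnitAddCircle`, whose distance is arc length and whose `volume`
is the uniform probability measure. All sequences that are indexed by `n = 1, 2, …` on paper are
indexed by `n = 0, 1, …` here: `ℓ n` is the length of arc number `n + 1`. -/

namespace CircleCovering

/-- `ℓ_n = Θ(1/n)`: there are `0 < M₀ ≤ M₁ < ∞` such that `M₀ / n ≤ ℓ_n ≤ M₁ / n` for all `n ≥ 1`. -/
def IsThetaInv (ℓ : ℕ → ℝ) : Prop :=
  ∃ M₀ M₁ : ℝ, 0 < M₀ ∧ M₀ ≤ M₁ ∧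
    ∀ n : ℕ, M₀ / ((n : ℝ) + 1) ≤ ℓ n ∧ ℓ n ≤ M₁ / ((n : ℝ) + 1)

/-- The term `e^{ℓ_1 + ⋯ + ℓ_n} / n^{1 + β}` (at the shifted index). -/
noncomputable def sheppTerm (ℓ : ℕ → ℝ) (β : ℝ) (n : ℕ) : ℝ :=
  Real.exp (∑ k ∈ Finset.range (n + 1), ℓ k) / ((n : ℝ) + 1) ^ (1 + β)

/-- `β₀ = inf {β : ∑_n e^{ℓ_1 + ⋯ + ℓ_n} / n^{1 + β} < ∞}`. (When `ℓ_n = Θ(1/n)` this set is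
nonempty and bounded below; the terms are positive, so summability means a finite sum.) -/
noncomputable def betaZero (ℓ : ℕ → ℝ) : ℝ :=
  sInf {β : ℝ | Summable (sheppTerm ℓ β)}

/-- The random data of the Poisson model with parameter `α`: the positions `C i j` are uniform on
the circle, the waiting times `Y i j` are exponential with parameter `ℓ_i^{-α}`, and all of these
random variables (for all `i`, `j`, both kinds together) are mutually independent. The last point
is expressed as independence of the pairs `(C i j, Y i j)` for different `(i, j)`, together with
independence of the two entries of each pair. -/
structure IsPoissonModel {Ω : Type*} [MeasurableSpace Ω] (P : Measure Ω) (ℓ : ℕ → ℝ) (α : ℝ)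
    (C : ℕ → ℕ → Ω → UnitAddCircle) (Y : ℕ → ℕ → Ω → ℝ) : Prop where
  measurable_C : ∀ i j, Measurable (C i j)
  measurable_Y : ∀ i j, Measurable (Y i j)
  law_C : ∀ i j, P.map (C i j) = (volume : Measure UnitAddCircle)
  law_Y : ∀ i j, P.map (Y i j) = expMeasure (ℓ i ^ (-α))
  indep_pair : ∀ i j, IndepFun (C i j) (Y i j) P
  iIndep_pairs : iIndepFun (fun (p : ℕ × ℕ) (ω : Ω) => (C p.1 p.2 ω, Y p.1 p.2 ω)) P

section Arcs

variable {Ω : Type*}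

/-- The `j`-th update time of arc `i`: `T_{i,0} = 0`, and `T_{i,j}` is the sum of the first `j`
waiting times. -/
def updateTime (Y : ℕ → ℕ → Ω → ℝ) (i j : ℕ) (ω : Ω) : ℝ :=
  ∑ k ∈ Finset.range j, Y i k ω

/-- The center of arc `i` at time `t`, i.e. the sum over `j` of
`C_{i,j} 1_{[T_{i,j-1}, T_{i,j})}(t)`; almost surely exactly one term is selected. -/
noncomputable def center (C : ℕ → ℕ → Ω → UnitAddCircle) (Y : ℕ → ℕ → Ω → ℝ)
    (i : ℕ) (t : ℝ) (ω : Ω) : UnitAddCircle :=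
  ∑' j : ℕ, (Set.Ico (updateTime Y i j ω) (updateTime Y i (j + 1) ω)).indicator
    (fun _ => C i j ω) t

/-- The open arc with center `c` and length `r` (the whole circle if `r > 1`). -/
def openArc (c : UnitAddCircle) (r : ℝ) : Set UnitAddCircle := Metric.ball c (r / 2)

/-- `E_t = limsup_n I_{n,t}`: the points covered by infinitely many arcs at time `t`. -/
noncomputable def coveredIO (ℓ : ℕ → ℝ) (C : ℕ → ℕ → Ω → UnitAddCircle) (Y : ℕ → ℕ → Ω → ℝ)
    (t : ℝ) (ω : Ω) : Set UnitAddCircle :=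
  Filter.limsup (fun n => openArc (center C Y n t ω) (ℓ n)) Filter.atTop

/-- `{t ∈ [0, 1] : x ∈ F_t}`, where `F_t` is the complement of `E_t`. -/
def exceptionalTimes (ℓ : ℕ → ℝ) (C : ℕ → ℕ → Ω → UnitAddCircle) (Y : ℕ → ℕ → Ω → ℝ)
    (x : UnitAddCircle) (ω : Ω) : Set ℝ :=
  {t : ℝ | t ∈ Set.Icc (0 : ℝ) 1 ∧ x ∈ (coveredIO ℓ C Y t ω)ᶜ}

end Arcs

end CircleCovering

namespace CircleCovering

open Set Filter Topology
open scoped ENNReal NNReal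

/-! ### Tails of the exponential law and independence lemmas -/

/-! Once ℓ_i ≤ 1, arc i misses x exactly when its center lies outside a ball of measure ℓ_i about x.
Centers are refreshed by a memoryless clock. So if arc i misses x at time t, then it misses x at
time t + s with conditional probability 1 - ℓ_i + ℓ_i e^{-s ℓ_i^{-α}}, even given that it missed x
at some earlier times (`rowLaw_markov`). By independence, the times at which all arcs of a finite
set are free have two-point function π² K(|s - t|). Here π = ∏ (1 - ℓ_i), and K(u) = ∏ (1 + ℓ_i/(1 -
ℓ_i) e^{-u ℓ_i^{-α}}) is `corrKernel`.

Since ℓ_i = Θ(1/i), at lag u ≈ m^{-α} the arcs up to m have hardly been updated and contribute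
e^{ℓ_1+⋯+ℓ_m} up to a constant, while later arcs contribute a bounded factor (`corrKernel_ge`,
`corrKernel_le`). Slicing (0, 1] at the points m^{-α} compares ∫ K(u) u^{-γ} du with the series ∑
e^{ℓ_1+⋯+ℓ_n} / n^{1+α(1-γ)}. The case γ = 0 decides existence; γ > 0 controls γ-energies and hence
dimension.

Lower bounds come from second moments. Lebesgue measure on the free times of arcs N, …, n - 1,
normalized to mean mass one, has second moment and γ-energy bounded uniformly in n. As N → ∞ the
second moment bound tends to 1, so Chebyshev's inequality gives probability close to one and no
zero-one law is needed (`ae_frequently_goodEvent`). Compactness passes to the intersection of the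
closures, with positive Hausdorff measure (`hausdorffMeasure_iInter_closure_ne_zero`). Taking
closures is harmless: almost surely at most one arc is updated at a given positive time, and
finitely many covering arcs are allowed (`iInter_closure_free_subset`).

Upper bounds come from a first-hit decomposition: after a first free time many more are expected, so
P(some free time in [a, a + ε)) · ∫₀^ε K ≤ 2ε (`dataLaw_dyadicHit_le`). If the integrals are
unbounded there are no exceptional times. With ε = m^{-α} the bound limits the expected number of
intervals needed to cover the exceptional times (`ae_hausdorffMeasure_tailFree`).

All this is proved for the product law `dataLaw` and then transferred to the given model. -/

theorem expMeasure_lt_abs {r a : ℝ} (hr : 0 < r) (ha : 0 ≤ a) :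
    expMeasure r {y : ℝ | a < |y|} = ENNReal.ofReal (Real.exp (-(r * a))) := by
  have := isProbabilityMeasure_expMeasure hr
  have h1 : expMeasure r (Iic a) = ENNReal.ofReal (1 - Real.exp (-(r * a))) := by
    rw [← ofReal_cdf, cdf_expMeasure_eq hr, if_pos ha]
  have h0 : expMeasure r (Iic 0) = 0 := by
    rw [← ofReal_cdf, cdf_expMeasure_eq hr, if_pos le_rfl]; simp
  have h2 : expMeasure r (Ioi a) = ENNReal.ofReal (Real.exp (-(r * a))) := by
    rw [← compl_Iic, prob_compl_eq_one_sub measurableSet_Iic, h1, ← ENNReal.ofReal_one,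
      ← ENNReal.ofReal_sub _ (by simp; positivity)]
    simp
  rw [← h2]
  apply measure_congr
  have : ∀ᵐ y ∂expMeasure r, y ∉ Iic (0 : ℝ) := measure_eq_zero_iff_ae_notMem.1 h0
  filter_upwards [this] with y hy
  have hy' : 0 < y := not_le.1 hy
  change (a < |y|) = (a < y)
  rw [abs_of_pos hy']

theorem tsum_eq_add_tsum_ite_nat {f : ℕ → ℝ≥0∞} (j : ℕ) :
    ∑' k, f k = f j + ∑' k, if k = j then 0 else f k := by
  rw [ENNReal.tsum_eq_add_tsum_ite j]
  congr! 4

/-- The two hypotheses factor the law of the triple completely, so it may be regrouped. This lets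
the past of a row absorb either the position or the waiting time of the next entry. -/
theorem IndepFun.prodMk_of_prod {Ω A B D : Type*} [MeasurableSpace Ω] {P : Measure Ω}
    [IsProbabilityMeasure P] [MeasurableSpace A] [MeasurableSpace B] [MeasurableSpace D]
    {X : Ω → A} {U : Ω → B} {V : Ω → D} (hX : Measurable X) (hU : Measurable U)
    (hV : Measurable V) (h : IndepFun X (fun ω => (U ω, V ω)) P) (h' : IndepFun U V P) :
    IndepFun (fun ω => (X ω, U ω)) V P := by
  rw [indepFun_iff_map_prod_eq_prod_map_map hX.aemeasurable (hU.prodMk hV).aemeasurable] at h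
  have h3 : IndepFun X U P := by
    have := (indepFun_iff_map_prod_eq_prod_map_map hX.aemeasurable
      (hU.prodMk hV).aemeasurable).2 h
    exact this.comp (φ := id) (ψ := Prod.fst) measurable_id measurable_fst
  rw [indepFun_iff_map_prod_eq_prod_map_map hU.aemeasurable hV.aemeasurable] at h'
  rw [indepFun_iff_map_prod_eq_prod_map_map (hX.prodMk hU).aemeasurable hV.aemeasurable]
  rw [indepFun_iff_map_prod_eq_prod_map_map hX.aemeasurable hU.aemeasurable] at h3
  have := Measure.isProbabilityMeasure_map (μ := P) hX.aemeasurable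
  have := Measure.isProbabilityMeasure_map (μ := P) hU.aemeasurable
  have := Measure.isProbabilityMeasure_map (μ := P) hV.aemeasurable
  rw [h3, 
    ← (MeasurableEquiv.prodAssoc (α := A) (β := B) (γ := D)).map_measurableEquiv_injective.eq_iff,
    Measure.prodAssoc_prod, ← h', ← h,
    Measure.map_map (MeasurableEquiv.measurable _) (by fun_prop)]
  rfl

/-- Lack of memory with a random threshold: by Fubini, with X fixed, raising the threshold g(X) by s
costs exactly the factor e^{-rs}. Nonnegativity of g on D is what makes the exponential tail formula
applicable. -/
theorem measure_lt_abs_of_indepFun {Ω A : Type*} [MeasurableSpace Ω] {P : Measure Ω}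
    [IsProbabilityMeasure P] [MeasurableSpace A] {X : Ω → A} {V : Ω → ℝ} {r s : ℝ} (hr : 0 < r)
    (hs : 0 ≤ s) (hX : Measurable X) (hV : Measurable V) (hlaw : P.map V = expMeasure r)
    (h : IndepFun X V P) {D : Set A} (hD : MeasurableSet D) {g : A → ℝ} (hg : Measurable g)
    (hg0 : ∀ a ∈ D, 0 ≤ g a) :
    P {ω | X ω ∈ D ∧ g (X ω) + s < |V ω|} =
      ENNReal.ofReal (Real.exp (-(r * s))) * P {ω | X ω ∈ D ∧ g (X ω) < |V ω|} := by
  have := isProbabilityMeasure_expMeasure hr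
  have := Measure.isProbabilityMeasure_map (μ := P) hX.aemeasurable
  rw [indepFun_iff_map_prod_eq_prod_map_map hX.aemeasurable hV.aemeasurable, hlaw] at h
  have key : ∀ s, 0 ≤ s → P {ω | X ω ∈ D ∧ g (X ω) + s < |V ω|} =
      ∫⁻ a in D, ENNReal.ofReal (Real.exp (-(r * (g a + s)))) ∂(P.map X) := by
    intro s hs
    have hm : MeasurableSet {p : A × ℝ | p.1 ∈ D ∧ g p.1 + s < |p.2|} :=
      (measurable_fst hD).inter (measurableSet_lt (f := fun p : A × ℝ => g p.1 + s)
        (g := fun p => |p.2|) (by fun_prop) (by fun_prop))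
    have : P {ω | X ω ∈ D ∧ g (X ω) + s < |V ω|} =
        P.map (fun ω => (X ω, V ω)) {p : A × ℝ | p.1 ∈ D ∧ g p.1 + s < |p.2|} := by
      rw [Measure.map_apply (hX.prodMk hV) hm]; rfl
    rw [this, h, Measure.prod_apply hm, ← lintegral_indicator hD]
    refine lintegral_congr fun a => ?_
    by_cases ha : a ∈ D
    · rw [indicator_of_mem ha, ← expMeasure_lt_abs hr (add_nonneg (hg0 a ha) hs)]
      congr 1; ext y; simp [ha]
    · rw [indicator_of_notMem ha]
      convert measure_empty (μ := expMeasure r)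
      ext y; simp [ha]
  rw [key s hs]
  have k0 := key 0 le_rfl
  simp only [add_zero] at k0
  rw [k0, ← lintegral_const_mul _ (by fun_prop)]
  refine lintegral_congr fun a => ?_
  rw [← ENNReal.ofReal_mul (by positivity), ← Real.exp_add]
  ring_nf

/-- By Fubini, each slice at fixed X is a single point, which is null for the law of V. This rules
out simultaneous updates later on. -/
theorem measure_eq_of_indepFun_noAtoms {Ω A : Type*} [MeasurableSpace Ω] {P : Measure Ω}
    [IsProbabilityMeasure P] [MeasurableSpace A] {X : Ω → A} {V : Ω → ℝ}
    (hX : Measurable X) (hV : Measurable V) [NullSingletonClass (P.map V)]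
    (h : IndepFun X V P) {g : A → ℝ} (hg : Measurable g) :
    P {ω | V ω = g (X ω)} = 0 := by
  have := Measure.isProbabilityMeasure_map (μ := P) hX.aemeasurable
  have := Measure.isProbabilityMeasure_map (μ := P) hV.aemeasurable
  rw [indepFun_iff_map_prod_eq_prod_map_map hX.aemeasurable hV.aemeasurable] at h
  have hm : MeasurableSet {p : A × ℝ | p.2 = g p.1} :=
    measurableSet_eq_fun (by fun_prop) (by fun_prop)
  have : P {ω | V ω = g (X ω)} = P.map (fun ω => (X ω, V ω)) {p : A × ℝ | p.2 = g p.1} := by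
    rw [Measure.map_apply (hX.prodMk hV) hm]; rfl
  rw [this, h, Measure.prod_apply hm, lintegral_eq_zero_iff (measurable_measure_prodMk_left hm)]
  refine ae_of_all _ fun a => ?_
  have : Prod.mk a ⁻¹' {p : A × ℝ | p.2 = g p.1} = {g a} := by ext y; simp
  simp only [this, measure_singleton, Pi.zero_apply]

instance isProbabilityMeasure_volume_unitAddCircle :
    IsProbabilityMeasure (volume : Measure UnitAddCircle) :=
  ⟨UnitAddCircle.measure_univ⟩

/-! ### A single arc: the canonical row space -/

/-- The positions and the waiting times of one arc. -/
abbrev Row := ℕ → UnitAddCircle × ℝ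

/-- The law of a row whose waiting times have parameter `r`. -/
noncomputable def rowLaw (r : ℝ) : Measure Row :=
  Measure.infinitePi fun _ : ℕ => (volume : Measure UnitAddCircle).prod (expMeasure r)

/-- The update times of a row; the absolute values make them monotone everywhere. -/
noncomputable def renewal (z : Row) (j : ℕ) : ℝ := ∑ k ∈ Finset.range j, |(z k).2|

/-- The rows whose current position at time `u` is outside `B`. -/
def uncovered (B : Set UnitAddCircle) (u : ℝ) : Set Row :=
  {z | ∀ j, renewal z j ≤ u → u < renewal z (j + 1) → (z j).1 ∉ B}

/-- The rows with exactly `j` updates before time `t`. -/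
def renewalCount (t : ℝ) (j : ℕ) : Set Row := {z | renewal z j ≤ t ∧ t < renewal z (j + 1)}

theorem renewal_zero (z : Row) : renewal z 0 = 0 := by simp [renewal]

theorem renewal_succ (z : Row) (j : ℕ) : renewal z (j + 1) = renewal z j + |(z j).2| := by
  simp [renewal, Finset.sum_range_succ]

theorem renewal_mono (z : Row) : Monotone (renewal z) :=
  monotone_nat_of_le_succ fun j => by rw [renewal_succ]; linarith [abs_nonneg (z j).2]

theorem renewal_nonneg (z : Row) (j : ℕ) : 0 ≤ renewal z j := by
  rw [← renewal_zero z]; exact renewal_mono z (Nat.zero_le j)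

@[fun_prop]
theorem measurable_renewal (j : ℕ) : Measurable fun z : Row => renewal z j := by
  unfold renewal; fun_prop

theorem renewal_congr {z w : Row} {j : ℕ} (h : ∀ i < j, z i = w i) : renewal z j = renewal w j :=
  Finset.sum_congr rfl fun i hi => by rw [h i (Finset.mem_range.1 hi)]

theorem measurableSet_uncovered {B : Set UnitAddCircle} (hB : MeasurableSet B) (u : ℝ) :
    MeasurableSet (uncovered B u) := by
  have : uncovered B u = ⋂ j, ({z | renewal z j ≤ u}ᶜ ∪
      ({z | u < renewal z (j + 1)}ᶜ ∪ (fun z : Row => (z j).1) ⁻¹' Bᶜ)) := by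
    ext z; simp [uncovered, imp_iff_not_or]
  rw [this]
  refine MeasurableSet.iInter fun j => ?_
  refine (measurableSet_le (by fun_prop) (by fun_prop)).compl.union
    ((measurableSet_lt (by fun_prop) (by fun_prop)).compl.union ?_)
  exact (measurable_fst.comp (measurable_pi_apply j)) hB.compl

theorem measurableSet_uncovered_prod {B : Set UnitAddCircle} (hB : MeasurableSet B) :
    MeasurableSet {p : ℝ × Row | p.2 ∈ uncovered B p.1} := by
  have : {p : ℝ × Row | p.2 ∈ uncovered B p.1} = ⋂ j, ({p | renewal p.2 j ≤ p.1}ᶜ ∪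
      ({p | p.1 < renewal p.2 (j + 1)}ᶜ ∪ (fun p : ℝ × Row => (p.2 j).1) ⁻¹' Bᶜ)) := by
    ext z; simp [uncovered, imp_iff_not_or]
  rw [this]
  refine MeasurableSet.iInter fun j => ?_
  refine (measurableSet_le (by fun_prop) (by fun_prop)).compl.union
    ((measurableSet_lt (by fun_prop) (by fun_prop)).compl.union ?_)
  exact (show Measurable fun p : ℝ × Row => (p.2 j).1 by fun_prop) hB.compl

theorem measurableSet_renewalCount (t : ℝ) (j : ℕ) : MeasurableSet (renewalCount t j) :=
  MeasurableSet.inter (s₁ := {z : Row | renewal z j ≤ t}) (s₂ := {z | t < renewal z (j + 1)})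
    (measurableSet_le (by fun_prop) (by fun_prop)) (measurableSet_lt (by fun_prop) (by fun_prop))

theorem renewalCount_lt_unique {z : Row} {s t : ℝ} (hst : s ≤ t) {i j : ℕ}
    (hi : z ∈ renewalCount s i) (hj : z ∈ renewalCount t j) : i ≤ j := by
  by_contra! h
  have := renewal_mono z (show j + 1 ≤ i from h)
  exact absurd (hj.2.trans_le (this.trans hi.1)) (not_lt.2 hst)

theorem renewalCount_unique {z : Row} {t : ℝ} {i j : ℕ}
    (hi : z ∈ renewalCount t i) (hj : z ∈ renewalCount t j) : i = j :=
  (renewalCount_lt_unique le_rfl hi hj).antisymm (renewalCount_lt_unique le_rfl hj hi)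

theorem mem_uncovered_iff {B : Set UnitAddCircle} {z : Row} {t : ℝ} {j : ℕ}
    (hj : z ∈ renewalCount t j) : z ∈ uncovered B t ↔ (z j).1 ∉ B := by
  refine ⟨fun h => h j hj.1 hj.2, fun h i h1 h2 => ?_⟩
  rwa [renewalCount_unique ⟨h1, h2⟩ hj]

/-- Being uncovered at time `u` only depends on the row up to time `u`. -/
theorem mem_uncovered_congr {B : Set UnitAddCircle} {z w : Row} {u : ℝ} {j : ℕ}
    (h : ∀ i < j, z i = w i) (hj : (z j).1 = (w j).1) (hz : u < renewal z (j + 1))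
    (hw : u < renewal w (j + 1)) : z ∈ uncovered B u → w ∈ uncovered B u := by
  intro H i h1 h2
  rcases lt_trichotomy i j with hij | rfl | hij
  · have e1 : renewal z i = renewal w i := renewal_congr fun k hk => h k (hk.trans hij)
    have e2 : renewal z (i + 1) = renewal w (i + 1) :=
      renewal_congr fun k hk => h k (by omega)
    rw [← h i hij]
    exact H i (e1 ▸ h1) (e2 ▸ h2)
  · have e1 : renewal z i = renewal w i := renewal_congr h
    rw [← hj]
    exact H i (e1 ▸ h1) hz
  · exact absurd (hw.trans_le (renewal_mono w (show j + 1 ≤ i from hij))) (not_lt.2 h1)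

/-! ### The law of one row: independence of past and future, non-explosion, Markov property -/

section RowLaw

variable {r : ℝ}

theorem isProbabilityMeasure_rowLaw (hr : 0 < r) : IsProbabilityMeasure (rowLaw r) := by
  have := isProbabilityMeasure_expMeasure hr
  unfold rowLaw; infer_instance

theorem iIndepFun_rowLaw (hr : 0 < r) : iIndepFun (fun (j : ℕ) (z : Row) => z j) (rowLaw r) := by
  have := isProbabilityMeasure_expMeasure hr
  exact iIndepFun_infinitePi (X := fun _ x => x) (fun _ => measurable_id)

theorem rowLaw_map_apply (hr : 0 < r) (j : ℕ) :
    (rowLaw r).map (fun z => z j) = (volume : Measure UnitAddCircle).prod (expMeasure r) := by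
  have := isProbabilityMeasure_expMeasure hr
  exact Measure.infinitePi_map_eval _ j

theorem rowLaw_map_fst (hr : 0 < r) (j : ℕ) :
    (rowLaw r).map (fun z => (z j).1) = (volume : Measure UnitAddCircle) := by
  have := isProbabilityMeasure_expMeasure hr
  have : (fun z : Row => (z j).1) = Prod.fst ∘ fun z : Row => z j := rfl
  rw [this, ← Measure.map_map measurable_fst (measurable_pi_apply j), rowLaw_map_apply hr]
  simp

theorem rowLaw_map_snd (hr : 0 < r) (j : ℕ) :
    (rowLaw r).map (fun z => (z j).2) = expMeasure r := by
  have := isProbabilityMeasure_expMeasure hr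
  have : (fun z : Row => (z j).2) = Prod.snd ∘ fun z : Row => z j := rfl
  rw [this, ← Measure.map_map measurable_snd (measurable_pi_apply j), rowLaw_map_apply hr]
  simp

theorem indepFun_fst_snd (hr : 0 < r) (j : ℕ) :
    IndepFun (fun z : Row => (z j).1) (fun z => (z j).2) (rowLaw r) := by
  have := isProbabilityMeasure_expMeasure hr
  have := isProbabilityMeasure_rowLaw hr
  rw [indepFun_iff_map_prod_eq_prod_map_map (Measurable.aemeasurable (by fun_prop))
    (Measurable.aemeasurable (by fun_prop)), rowLaw_map_fst hr,
    rowLaw_map_snd hr, ← rowLaw_map_apply hr j]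

/-- The row with all entries from index `j` on erased. -/
noncomputable def truncate (j : ℕ) (z : Row) : Row := fun i => if i < j then z i else 0

theorem measurable_truncate (j : ℕ) : Measurable (truncate j) := by
  refine measurable_pi_lambda _ fun i => ?_
  unfold truncate
  split_ifs
  · exact measurable_pi_apply i
  · exact measurable_const

theorem indepFun_truncate (hr : 0 < r) (j : ℕ) :
    IndepFun (truncate j) (fun z : Row => ((z j).1, (z j).2)) (rowLaw r) := by
  have h := (iIndepFun_rowLaw hr).indepFun_finset (Finset.range j) {j} (by simp)
    (fun i => measurable_pi_apply i)
  let φ : (Finset.range j → UnitAddCircle × ℝ) → Row := fun v i =>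
    if hi : i ∈ Finset.range j then v ⟨i, hi⟩ else 0
  have hφ : Measurable φ := by
    refine measurable_pi_lambda _ fun i => ?_
    by_cases hi : i ∈ Finset.range j
    · simp only [φ, hi, dite_true]; exact measurable_pi_apply _
    · simp only [φ, hi, dite_false]; exact measurable_const
  have h2 := h.comp (φ := φ)
    (ψ := fun v : (({j} : Finset ℕ) → UnitAddCircle × ℝ) =>
      ((v ⟨j, by simp⟩).1, (v ⟨j, by simp⟩).2)) hφ (by fun_prop)
  convert! h2 using 1
  ext z i <;> simp only [truncate, φ, Function.comp, Finset.mem_range] <;> split_ifs <;> rfl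

theorem indepFun_truncate_fst_snd (hr : 0 < r) (j : ℕ) :
    IndepFun (fun z : Row => (truncate j z, (z j).1)) (fun z => (z j).2) (rowLaw r) := by
  have := isProbabilityMeasure_rowLaw hr
  exact IndepFun.prodMk_of_prod (measurable_truncate j) (by fun_prop) (by fun_prop)
    (indepFun_truncate hr j) (indepFun_fst_snd hr j)

theorem indepFun_truncate_snd_fst (hr : 0 < r) (j : ℕ) :
    IndepFun (fun z : Row => (truncate j z, (z j).2)) (fun z => (z j).1) (rowLaw r) := by
  have := isProbabilityMeasure_rowLaw hr
  exact IndepFun.prodMk_of_prod (measurable_truncate j) (by fun_prop) (by fun_prop)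
    ((indepFun_truncate hr j).comp measurable_id measurable_swap) (indepFun_fst_snd hr j).symm

/-- The number of updates before any time is almost surely finite. -/
theorem ae_exists_renewal_gt (hr : 0 < r) : ∀ᵐ z ∂rowLaw r, ∀ t : ℝ, ∃ j, t < renewal z j := by
  have := isProbabilityMeasure_expMeasure hr
  have := isProbabilityMeasure_rowLaw hr
  have key : ∀ n : ℕ, ∀ᵐ z ∂rowLaw r, ∃ j, (n : ℝ) < renewal z j := by
    intro n
    have hq : expMeasure r {y : ℝ | |y| ≤ n} < 1 := by
      have h := expMeasure_lt_abs hr (Nat.cast_nonneg n)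
      have : {y : ℝ | |y| ≤ n} = {y : ℝ | (n : ℝ) < |y|}ᶜ := by ext; simp
      rw [this, prob_compl_eq_one_sub (measurableSet_lt (by fun_prop) (by fun_prop)), h]
      exact ENNReal.sub_lt_self ENNReal.one_ne_top one_ne_zero (by simp; positivity)
    have hb : ∀ m : ℕ, rowLaw r {z | ∀ j, renewal z j ≤ n} ≤
        (expMeasure r {y : ℝ | |y| ≤ n}) ^ m := by
      intro m
      calc rowLaw r {z | ∀ j, renewal z j ≤ n}
          ≤ rowLaw r (⋂ j ∈ Finset.range m, (fun z : Row => z j) ⁻¹' {p | |p.2| ≤ n}) := by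
            refine measure_mono fun z hz => ?_
            simp only [mem_iInter]
            intro j _
            have := hz (j + 1)
            rw [renewal_succ] at this
            change |(z j).2| ≤ n
            linarith [renewal_nonneg z j]
        _ = ∏ j ∈ Finset.range m, rowLaw r ((fun z : Row => z j) ⁻¹' {p | |p.2| ≤ n}) := by
            refine (iIndepFun_rowLaw hr).measure_inter_preimage_eq_mul _ fun j _ =>
              measurableSet_le (by fun_prop) (by fun_prop)
        _ = ∏ j ∈ Finset.range m, expMeasure r {y : ℝ | |y| ≤ n} := by
            refine Finset.prod_congr rfl fun j _ => ?_
            rw [← rowLaw_map_snd hr j, Measure.map_apply (by fun_prop)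
              (measurableSet_le (by fun_prop) (by fun_prop))]
            rfl
        _ = _ := by simp
    have h0 : rowLaw r {z | ∀ j, renewal z j ≤ n} = 0 :=
      le_antisymm (ge_of_tendsto' (ENNReal.tendsto_pow_atTop_nhds_zero_of_lt_one hq) hb) (zero_le)
    filter_upwards [measure_eq_zero_iff_ae_notMem.1 h0] with z hz
    simpa using hz
  filter_upwards [ae_all_iff.2 key] with z hz t
  obtain ⟨n, hn⟩ := exists_nat_ge t
  obtain ⟨j, hj⟩ := hz n
  exact ⟨j, hn.trans_lt hj⟩

theorem exists_mem_renewalCount {z : Row} (hz : ∀ t : ℝ, ∃ j, t < renewal z j) {t : ℝ}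
    (ht : 0 ≤ t) : ∃ j, z ∈ renewalCount t j := by
  classical
  have h := hz t
  have hpos : Nat.find h ≠ 0 := by
    intro h0
    have := Nat.find_spec h
    rw [h0, renewal_zero] at this
    linarith
  obtain ⟨j, hj⟩ := Nat.exists_eq_succ_of_ne_zero hpos
  refine ⟨j, not_lt.1 (Nat.find_min h (by omega)), ?_⟩
  have := Nat.find_spec h
  rwa [hj] at this

/-- Decomposition according to the number of updates before time `t`. -/
theorem rowLaw_eq_tsum (hr : 0 < r) {t : ℝ} (ht : 0 ≤ t) {A : Set Row} (hA : MeasurableSet A) :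
    rowLaw r A = ∑' j, rowLaw r (A ∩ renewalCount t j) := by
  rw [← measure_iUnion]
  · refine measure_congr ?_
    filter_upwards [ae_exists_renewal_gt hr] with z hz
    obtain ⟨j, hj⟩ := exists_mem_renewalCount hz ht
    refine propext ⟨fun h => mem_iUnion.2 ⟨j, h, hj⟩, fun h => ?_⟩
    obtain ⟨k, hk⟩ := mem_iUnion.1 h
    exact hk.1
  · intro i j hij
    refine disjoint_left.2 fun z h1 h2 => hij (renewalCount_unique h1.2 h2.2)
  · exact fun j => hA.inter (measurableSet_renewalCount t j)

/-- Uncovered at all the times of `S`. -/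
def uncoveredOn (B : Set UnitAddCircle) (S : Finset ℝ) : Set Row := ⋂ u ∈ S, uncovered B u

theorem measurableSet_uncoveredOn {B : Set UnitAddCircle} (hB : MeasurableSet B) (S : Finset ℝ) :
    MeasurableSet (uncoveredOn B S) :=
  S.measurableSet_biInter fun u _ => measurableSet_uncovered hB u

/-- What happens up to time t does not depend on how long the interval straddling t lasts. The last
waiting time may therefore be replaced by a dummy value, which turns an event about the past into a
function of the truncated row and the current position. -/
theorem mem_uncoveredOn_congr {B : Set UnitAddCircle} {S : Finset ℝ} {t : ℝ} (hS : ∀ u ∈ S, u ≤ t)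
    {z w : Row} {j : ℕ} (h : ∀ i < j, z i = w i) (hj : (z j).1 = (w j).1)
    (hz : t < renewal z (j + 1)) (hw : t < renewal w (j + 1)) :
    z ∈ uncoveredOn B S ↔ w ∈ uncoveredOn B S := by
  simp only [uncoveredOn, mem_iInter]
  refine forall₂_congr fun u hu => ⟨?_, ?_⟩
  · exact mem_uncovered_congr h hj ((hS u hu).trans_lt hz) ((hS u hu).trans_lt hw)
  · exact mem_uncovered_congr (fun i hi => (h i hi).symm) hj.symm ((hS u hu).trans_lt hw)
      ((hS u hu).trans_lt hz)

theorem renewal_truncate_update (z : Row) (j : ℕ) (p : UnitAddCircle × ℝ) :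
    renewal (Function.update (truncate j z) j p) j = renewal z j :=
  renewal_congr fun i hi => by
    rw [Function.update_of_ne hi.ne]; simp [truncate, hi]

theorem truncate_update_of_lt (z : Row) {j i : ℕ} (hi : i < j) (p : UnitAddCircle × ℝ) :
    Function.update (truncate j z) j p i = z i := by
  rw [Function.update_of_ne hi.ne]; simp [truncate, hi]

/-- Memorylessness: no update in `(t, t + s]` is independent of the past. -/
theorem rowLaw_no_update (hr : 0 < r) {B : Set UnitAddCircle} (hB : MeasurableSet B)
    {S : Finset ℝ} {t s : ℝ} (ht : 0 ≤ t) (hs : 0 ≤ s) (hS : ∀ u ∈ S, u ≤ t) (j : ℕ) :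
    rowLaw r (uncoveredOn B S ∩ renewalCount t j ∩ renewalCount (t + s) j) =
      ENNReal.ofReal (Real.exp (-(r * s))) * rowLaw r (uncoveredOn B S ∩ renewalCount t j) := by
  have := isProbabilityMeasure_rowLaw hr
  -- The dummy waiting time t + 1 guarantees that the modified row is past time t at update j + 1,
  -- so events up to t are unchanged.
  let Φ : Row × UnitAddCircle → Row := fun q => Function.update q.1 j (q.2, t + 1)
  have hΦ : Measurable Φ := by
    refine measurable_pi_lambda _ fun i => ?_
    by_cases hi : i = j
    · subst hi; simp only [Φ, Function.update_self]; fun_prop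
    · simp only [Φ, Function.update_of_ne hi]; fun_prop
  let D : Set (Row × UnitAddCircle) := Φ ⁻¹' (uncoveredOn B S ∩ {w | renewal w j ≤ t})
  have hD : MeasurableSet D := hΦ ((measurableSet_uncoveredOn hB S).inter
    (measurableSet_le (by fun_prop) (by fun_prop)))
  -- Lack of memory is applied to the j-th waiting time, with threshold the time t - T_j already
  -- elapsed since the last update.
  have key := measure_lt_abs_of_indepFun hr hs
    (X := fun z : Row => (truncate j z, (z j).1)) (V := fun z : Row => (z j).2)
    ((measurable_truncate j).prodMk (by fun_prop)) (by fun_prop) (rowLaw_map_snd hr j)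
    (indepFun_truncate_fst_snd hr j) hD (g := fun q => t - renewal (Φ q) j)
    (measurable_const.sub ((measurable_renewal j).comp hΦ))
    (fun q hq => sub_nonneg.2 hq.2)
  have hΦr : ∀ z : Row, renewal (Φ (truncate j z, (z j).1)) j = renewal z j := fun z =>
    renewal_truncate_update z j _
  have hmem : ∀ z : Row, t < renewal z (j + 1) → renewal z j ≤ t →
      ((truncate j z, (z j).1) ∈ D ↔ z ∈ uncoveredOn B S) := by
    intro z hz hz'
    have : Φ (truncate j z, (z j).1) ∈ uncoveredOn B S ↔ z ∈ uncoveredOn B S := by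
      refine mem_uncoveredOn_congr hS (j := j) (fun i hi => truncate_update_of_lt z hi _) ?_ ?_ hz
      · simp [Φ]
      · rw [renewal_succ, hΦr]
        simp only [Φ, Function.update_self]
        rw [abs_of_nonneg (by linarith)]
        linarith [renewal_nonneg z j]
    simp only [D, mem_preimage, mem_inter_iff, mem_ofPred_eq, this, hΦr, hz', and_true]
  have hset : ∀ s, 0 ≤ s → {z : Row | (truncate j z, (z j).1) ∈ D ∧
      t - renewal (Φ (truncate j z, (z j).1)) j + s < |(z j).2|} =
      uncoveredOn B S ∩ renewalCount t j ∩ renewalCount (t + s) j := by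
    intro s hs
    ext z
    simp only [mem_ofPred_eq, hΦr, mem_inter_iff, renewalCount]
    constructor
    · rintro ⟨h1, h2⟩
      have h3 : renewal z j ≤ t := by have := h1.2; simpa [hΦr] using this
      have h4 : t + s < renewal z (j + 1) := by rw [renewal_succ]; linarith
      exact ⟨⟨(hmem z (by linarith) h3).1 h1, h3, by linarith⟩, by linarith, h4⟩
    · rintro ⟨⟨h1, h2, h3⟩, h4, h5⟩
      refine ⟨(hmem z h3 h2).2 h1, ?_⟩
      rw [renewal_succ] at h5
      linarith
  have h0 := hset 0 le_rfl
  simp only [add_zero] at h0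
  rw [hset s hs, h0] at key
  rw [key, inter_assoc, inter_self]

/-- A new position is independent of the past. -/
theorem rowLaw_update (hr : 0 < r) {B : Set UnitAddCircle} (hB : MeasurableSet B)
    {S : Finset ℝ} {t s : ℝ} (hS : ∀ u ∈ S, u ≤ t) {j k : ℕ} (hjk : j < k) :
    rowLaw r (uncoveredOn B S ∩ renewalCount t j ∩ renewalCount (t + s) k ∩ uncovered B (t + s)) =
      volume Bᶜ * rowLaw r (uncoveredOn B S ∩ renewalCount t j ∩ renewalCount (t + s) k) := by
  have := isProbabilityMeasure_rowLaw hr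
  -- The k-th position is erased while its waiting time is kept. Since j < k, the event F involves
  -- only update times and earlier positions, so it does not notice.
  let Ψ : Row × ℝ → Row := fun q => Function.update q.1 k (0, q.2)
  have hΨ : Measurable Ψ := by
    refine measurable_pi_lambda _ fun i => ?_
    by_cases hi : i = k
    · subst hi; simp only [Ψ, Function.update_self]; fun_prop
    · simp only [Ψ, Function.update_of_ne hi]; fun_prop
  set F : Set Row := uncoveredOn B S ∩ renewalCount t j ∩ renewalCount (t + s) k with hF
  have hFm : MeasurableSet F := ((measurableSet_uncoveredOn hB S).inter
    (measurableSet_renewalCount t j)).inter (measurableSet_renewalCount _ k)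
  have hr1 : ∀ (z : Row) (i : ℕ), i ≤ k + 1 →
      renewal (Ψ (truncate k z, (z k).2)) i = renewal z i := by
    intro z i hi
    refine Finset.sum_congr rfl fun l hl => ?_
    have hl' : l < k ∨ l = k := by have := Finset.mem_range.1 hl; omega
    rcases hl' with hl' | rfl
    · simp only [Ψ]; rw [truncate_update_of_lt z hl']
    · simp [Ψ]
  have hmem : ∀ z : Row, Ψ (truncate k z, (z k).2) ∈ F ↔ z ∈ F := by
    intro z
    have e1 : Ψ (truncate k z, (z k).2) ∈ renewalCount t j ↔ z ∈ renewalCount t j := by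
      simp only [renewalCount, mem_ofPred_eq, hr1 z j (by omega), hr1 z (j + 1) (by omega)]
    have e2 : Ψ (truncate k z, (z k).2) ∈ renewalCount (t + s) k ↔ z ∈ renewalCount (t + s) k := by
      simp only [renewalCount, mem_ofPred_eq, hr1 z k (by omega), hr1 z (k + 1) (by omega)]
    simp only [hF, mem_inter_iff, e1, e2, and_congr_left_iff]
    intro _ h
    refine mem_uncoveredOn_congr hS (j := j)
      (fun i hi => truncate_update_of_lt z (hi.trans hjk) _) ?_ ?_ h.2
    · simp only [Ψ]; rw [truncate_update_of_lt z hjk]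
    · rw [hr1 z _ (by omega)]; exact h.2
  have hind := (indepFun_truncate_snd_fst hr k).measure_inter_preimage_eq_mul
    (Ψ ⁻¹' F) Bᶜ (hΨ hFm) hB.compl
  have e1 : (fun z : Row => (truncate k z, (z k).2)) ⁻¹' (Ψ ⁻¹' F) = F := by
    ext z; exact hmem z
  have e2 : F ∩ uncovered B (t + s) = F ∩ (fun z : Row => (z k).1) ⁻¹' Bᶜ := by
    ext z
    simp only [mem_inter_iff, and_congr_right_iff]
    intro hz
    exact mem_uncovered_iff hz.2
  rw [e1] at hind
  rw [e2, hind, mul_comm, ← rowLaw_map_fst hr k, Measure.map_apply (by fun_prop) hB.compl]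

/-- The Markov property of a single arc. -/
theorem rowLaw_markov (hr : 0 < r) {B : Set UnitAddCircle} (hB : MeasurableSet B)
    {S : Finset ℝ} {t s : ℝ} (ht : 0 ≤ t) (hs : 0 ≤ s) (hS : ∀ u ∈ S, u ≤ t) (htS : t ∈ S) :
    rowLaw r (uncoveredOn B S ∩ uncovered B (t + s)) =
      ENNReal.ofReal (1 - volume.real B + volume.real B * Real.exp (-(r * s))) *
        rowLaw r (uncoveredOn B S) := by
  have := isProbabilityMeasure_rowLaw hr
  set A := uncoveredOn B S with hA
  have hAm : MeasurableSet A := measurableSet_uncoveredOn hB S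
  have hUm := measurableSet_uncovered hB (t + s)
  rw [rowLaw_eq_tsum hr ht (hAm.inter hUm), rowLaw_eq_tsum hr ht hAm, ← ENNReal.tsum_mul_left]
  refine tsum_congr fun j => ?_
  set Aj := A ∩ renewalCount t j with hAj
  have hAjm : MeasurableSet Aj := hAm.inter (measurableSet_renewalCount t j)
  have hts : 0 ≤ t + s := by linarith
  set e := Real.exp (-(r * s))
  have he1 : e ≤ 1 := Real.exp_le_one_iff.2 (by nlinarith)
  have he0 : 0 ≤ e := (Real.exp_pos _).le
  have hone : volume.real Bᶜ = 1 - volume.real B := by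
    rw [measureReal_compl hB]; simp
  have hb1 : volume.real B ≤ 1 := measureReal_le_one
  -- Split by the number k of updates before t + s, given j before t. The case k < j is impossible;
  -- for k = j the position is the one at time t ∈ S, already outside B; for k > j the position is
  -- fresh and avoids B with probability 1 - |B|.
  have h1 : ∀ k, rowLaw r (Aj ∩ uncovered B (t + s) ∩ renewalCount (t + s) k) =
      if k = j then ENNReal.ofReal e * rowLaw r Aj
      else volume Bᶜ * rowLaw r (Aj ∩ renewalCount (t + s) k) := by
    intro k
    rcases lt_trichotomy k j with h | rfl | h
    · rw [if_neg h.ne]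
      have h0 : Aj ∩ renewalCount (t + s) k = ∅ := by
        ext z
        simp only [hAj, mem_inter_iff, mem_empty_iff_false, iff_false, not_and, and_imp]
        intro _ h1 h2
        exact absurd (renewalCount_lt_unique (by linarith) h1 h2) (by omega)
      rw [h0, inter_right_comm, h0]; simp
    · rw [if_pos rfl, ← rowLaw_no_update hr hB ht hs hS k]
      congr 1
      ext z
      simp only [hAj, mem_inter_iff]
      constructor
      · rintro ⟨⟨h1, -⟩, h3⟩; exact ⟨h1, h3⟩
      · rintro ⟨h1, h3⟩
        refine ⟨⟨h1, (mem_uncovered_iff h3).2 ?_⟩, h3⟩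
        have : z ∈ uncovered B t := by
          have := h1.1; simp only [uncoveredOn, mem_iInter] at this; exact this t htS
        exact (mem_uncovered_iff h1.2).1 this
    · rw [if_neg h.ne', inter_right_comm, rowLaw_update hr hB hS h]
  have hsplit := rowLaw_eq_tsum hr hts hAjm
  rw [tsum_eq_add_tsum_ite_nat j, rowLaw_no_update hr hB ht hs hS j] at hsplit
  set X := ∑' k, if k = j then 0 else rowLaw r (Aj ∩ renewalCount (t + s) k) with hX
  have hL : A ∩ uncovered B (t + s) ∩ renewalCount t j = Aj ∩ uncovered B (t + s) := by
    rw [hAj, inter_right_comm]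
  rw [hL, rowLaw_eq_tsum hr hts (hAjm.inter hUm), tsum_congr h1, tsum_eq_add_tsum_ite_nat j,
    if_pos rfl]
  have h3 : (∑' k, if k = j then 0 else (if k = j then ENNReal.ofReal e * rowLaw r Aj
      else volume Bᶜ * rowLaw r (Aj ∩ renewalCount (t + s) k))) = volume Bᶜ * X := by
    rw [hX, ← ENNReal.tsum_mul_left]
    refine tsum_congr fun k => ?_
    by_cases hk : k = j <;> simp [hk]
  rw [h3]
  have hXfin : X ≠ ∞ := by
    have : X ≤ rowLaw r Aj := by rw [hsplit]; exact le_add_self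
    exact ne_top_of_le_ne_top (measure_ne_top _ _) this
  have hfin := measure_ne_top (rowLaw r) Aj
  have hreal : (rowLaw r Aj).toReal = e * (rowLaw r Aj).toReal + X.toReal := by
    conv_lhs => rw [hsplit]
    rw [ENNReal.toReal_add (by finiteness) hXfin, ENNReal.toReal_mul, ENNReal.toReal_ofReal he0]
  rw [← ENNReal.toReal_eq_toReal_iff' (by finiteness) (by finiteness),
    ENNReal.toReal_add (by finiteness) (by finiteness), ENNReal.toReal_mul, ENNReal.toReal_mul,
    ENNReal.toReal_mul, ENNReal.toReal_ofReal he0, ENNReal.toReal_ofReal (by nlinarith)]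
  change e * _ + volume.real Bᶜ * _ = _
  rw [hone]
  -- `hreal` says that X = (1 - e) P(Aj), so the total factor is e + (1 - |B|)(1 - e) = 1 - |B| +
  -- |B| e.
  linear_combination (-(1 - volume.real B)) * hreal

theorem rowLaw_uncovered (hr : 0 < r) {B : Set UnitAddCircle} (hB : MeasurableSet B) {t : ℝ}
    (ht : 0 ≤ t) : rowLaw r (uncovered B t) = ENNReal.ofReal (1 - volume.real B) := by
  have := isProbabilityMeasure_rowLaw hr
  have hone : volume.real Bᶜ = 1 - volume.real B := by
    rw [measureReal_compl hB]; simp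
  rw [← hone, ofReal_measureReal, rowLaw_eq_tsum hr ht (measurableSet_uncovered hB t)]
  have h1 : ∀ k, rowLaw r (uncovered B t ∩ renewalCount t k) =
      volume Bᶜ * rowLaw r (univ ∩ renewalCount t k) := by
    intro k
    let Ψ : Row × ℝ → Row := fun q => Function.update q.1 k (0, q.2)
    have hΨ : Measurable Ψ := by
      refine measurable_pi_lambda _ fun i => ?_
      by_cases hi : i = k
      · subst hi; simp only [Ψ, Function.update_self]; fun_prop
      · simp only [Ψ, Function.update_of_ne hi]; fun_prop
    have hind := (indepFun_truncate_snd_fst hr k).measure_inter_preimage_eq_mul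
      (Ψ ⁻¹' renewalCount t k) Bᶜ (hΨ (measurableSet_renewalCount t k)) hB.compl
    have e1 : (fun z : Row => (truncate k z, (z k).2)) ⁻¹' (Ψ ⁻¹' renewalCount t k) =
        renewalCount t k := by
      ext z
      have := renewal_truncate_update z k (0, (z k).2)
      simp [renewalCount, Ψ, renewal_succ, this]
    have e2 : uncovered B t ∩ renewalCount t k =
        renewalCount t k ∩ (fun z : Row => (z k).1) ⁻¹' Bᶜ := by
      ext z
      rw [inter_comm]
      simp only [mem_inter_iff, and_congr_right_iff]
      intro hz
      exact mem_uncovered_iff hz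
    rw [e1] at hind
    rw [e2, hind, mul_comm, univ_inter, ← rowLaw_map_fst hr k,
      Measure.map_apply (by fun_prop) hB.compl]
  rw [tsum_congr h1, ENNReal.tsum_mul_left, ← rowLaw_eq_tsum hr ht MeasurableSet.univ]
  simp

end RowLaw

/-! ### Finitely many independent arcs -/

/-- The law of the rows of all arcs, where `r i` is the update rate of arc `i`. -/
noncomputable def dataLaw (r : ℕ → ℝ) : Measure (ℕ → Row) := Measure.infinitePi fun i => rowLaw (r i)

/-- No arc of `I` covers at time `t`. -/
def free (B : ℕ → Set UnitAddCircle) (I : Finset ℕ) (t : ℝ) : Set (ℕ → Row) :=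
  {ζ | ∀ i ∈ I, ζ i ∈ uncovered (B i) t}

/-- The conditional probability that arc `i` does not cover, given that it did not cover a time
span `s` earlier. -/
noncomputable def stayProb (r p s : ℝ) : ℝ := 1 - p + p * Real.exp (-(r * s))

/-- The correlation kernel of the set of free times of the arcs in `I`. -/
noncomputable def corrKernel (r p : ℕ → ℝ) (I : Finset ℕ) (s : ℝ) : ℝ :=
  ∏ i ∈ I, (1 + p i / (1 - p i) * Real.exp (-(r i * s)))

section Finite

variable {r : ℕ → ℝ} {B : ℕ → Set UnitAddCircle} {I : Finset ℕ}

theorem isProbabilityMeasure_dataLaw (hr : ∀ i, 0 < r i) : IsProbabilityMeasure (dataLaw r) := by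
  have := fun i => isProbabilityMeasure_rowLaw (hr i)
  unfold dataLaw; infer_instance

theorem dataLaw_map_apply (hr : ∀ i, 0 < r i) (i : ℕ) :
    (dataLaw r).map (fun ζ => ζ i) = rowLaw (r i) := by
  have := fun i => isProbabilityMeasure_rowLaw (hr i)
  exact Measure.infinitePi_map_eval _ i

theorem iIndepFun_dataLaw (hr : ∀ i, 0 < r i) :
    iIndepFun (fun (i : ℕ) (ζ : ℕ → Row) => ζ i) (dataLaw r) := by
  have := fun i => isProbabilityMeasure_rowLaw (hr i)
  exact iIndepFun_infinitePi (X := fun _ x => x) (fun _ => measurable_id)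

theorem dataLaw_real_forall (hr : ∀ i, 0 < r i) {A : ℕ → Set Row} (hA : ∀ i, MeasurableSet (A i)) :
    (dataLaw r).real {ζ | ∀ i ∈ I, ζ i ∈ A i} = ∏ i ∈ I, (rowLaw (r i)).real (A i) := by
  have h := (iIndepFun_dataLaw hr).measure_inter_preimage_eq_mul I (sets := A) (fun i _ => hA i)
  have e : {ζ : ℕ → Row | ∀ i ∈ I, ζ i ∈ A i} = ⋂ i ∈ I, (fun ζ : ℕ → Row => ζ i) ⁻¹' A i := by
    ext; simp
  rw [e, Measure.real, h, ENNReal.toReal_prod]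
  refine Finset.prod_congr rfl fun i _ => ?_
  rw [← dataLaw_map_apply hr i, Measure.real, Measure.map_apply (measurable_pi_apply i) (hA i)]

theorem measurableSet_free (hB : ∀ i, MeasurableSet (B i)) (t : ℝ) :
    MeasurableSet (free B I t) := by
  have e : free B I t = ⋂ i ∈ I, (fun ζ : ℕ → Row => ζ i) ⁻¹' uncovered (B i) t := by
    ext; simp [free]
  rw [e]
  exact I.measurableSet_biInter fun i _ =>
    measurable_pi_apply i (measurableSet_uncovered (hB i) t)

theorem measurableSet_free_prod (hB : ∀ i, MeasurableSet (B i)) :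
    MeasurableSet {q : ℝ × (ℕ → Row) | q.2 ∈ free B I q.1} := by
  have e : {q : ℝ × (ℕ → Row) | q.2 ∈ free B I q.1} =
      ⋂ i ∈ I, (fun q : ℝ × (ℕ → Row) => (q.1, q.2 i)) ⁻¹' {q | q.2 ∈ uncovered (B i) q.1} := by
    ext; simp [free]
  rw [e]
  exact I.measurableSet_biInter fun i _ =>
    (show Measurable fun q : ℝ × (ℕ → Row) => (q.1, q.2 i) by fun_prop)
      (measurableSet_uncovered_prod (hB i))

theorem dataLaw_free (hr : ∀ i, 0 < r i) (hB : ∀ i, MeasurableSet (B i)) {t : ℝ} (ht : 0 ≤ t) :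
    (dataLaw r).real (free B I t) = ∏ i ∈ I, (1 - volume.real (B i)) := by
  rw [free, dataLaw_real_forall hr fun i => measurableSet_uncovered (hB i) t]
  refine Finset.prod_congr rfl fun i _ => ?_
  rw [Measure.real, rowLaw_uncovered (hr i) (hB i) ht, ENNReal.toReal_ofReal]
  linarith [measureReal_le_one (μ := (volume : Measure UnitAddCircle)) (s := B i)]

/-- Free at all the times of `S` and at no time of `T`. -/
def freePattern (B : ℕ → Set UnitAddCircle) (I : Finset ℕ) (S T : Finset ℝ) : Set (ℕ → Row) :=
  {ζ | (∀ u ∈ S, ζ ∈ free B I u) ∧ ∀ u ∈ T, ζ ∉ free B I u}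

theorem measurableSet_freePattern (hB : ∀ i, MeasurableSet (B i)) (S T : Finset ℝ) :
    MeasurableSet (freePattern B I S T) := by
  have e : freePattern B I S T = (⋂ u ∈ S, free B I u) ∩ ⋂ u ∈ T, (free B I u)ᶜ := by
    ext; simp [freePattern]
  rw [e]
  exact (S.measurableSet_biInter fun u _ => measurableSet_free hB u).inter
    (T.measurableSet_biInter fun u _ => (measurableSet_free hB u).compl)

/-- When no time is required to be non-free, the pattern is an intersection of events about single
arcs, and the one-arc Markov factors multiply. -/
theorem dataLaw_markov_aux (hr : ∀ i, 0 < r i) (hB : ∀ i, MeasurableSet (B i)) {S : Finset ℝ}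
    {t s : ℝ} (ht : 0 ≤ t) (hs : 0 ≤ s) (hS : ∀ u ∈ S, u ≤ t) (htS : t ∈ S) :
    (dataLaw r).real (freePattern B I S ∅ ∩ free B I (t + s)) =
      (∏ i ∈ I, stayProb (r i) (volume.real (B i)) s) *
        (dataLaw r).real (freePattern B I S ∅) := by
  have e1 : freePattern B I S ∅ = {ζ | ∀ i ∈ I, ζ i ∈ uncoveredOn (B i) S} := by
    ext ζ; simp only [freePattern, free, uncoveredOn, mem_iInter, mem_ofPred_eq]
    simp only [Finset.notMem_empty, false_imp_iff, implies_true, and_true]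
    exact ⟨fun h i hi u hu => h u hu i hi, fun h u hu i hi => h i hi u hu⟩
  have e2 : freePattern B I S ∅ ∩ free B I (t + s) =
      {ζ | ∀ i ∈ I, ζ i ∈ uncoveredOn (B i) S ∩ uncovered (B i) (t + s)} := by
    rw [e1]; ext ζ; simp only [free, mem_inter_iff, mem_ofPred_eq]
    exact ⟨fun h i hi => ⟨h.1 i hi, h.2 i hi⟩, fun h => ⟨fun i hi => (h i hi).1,
      fun i hi => (h i hi).2⟩⟩
  rw [e2, e1, dataLaw_real_forall hr fun i => measurableSet_uncoveredOn (hB i) S,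
    dataLaw_real_forall hr fun i => (measurableSet_uncoveredOn (hB i) S).inter
      (measurableSet_uncovered (hB i) _), ← Finset.prod_mul_distrib]
  refine Finset.prod_congr rfl fun i _ => ?_
  rw [Measure.real, rowLaw_markov (hr i) (hB i) ht hs hS htS, ENNReal.toReal_mul,
    ENNReal.toReal_ofReal]
  · rfl
  · have := measureReal_le_one (μ := (volume : Measure UnitAddCircle)) (s := B i)
    have : 0 ≤ volume.real (B i) * Real.exp (-(r i * s)) := by positivity
    linarith

/-- Being non-free is not a product event over the arcs. Inclusion-exclusion on one time of T
reduces it to patterns with fewer such times, both sides of the Markov identity being additive. -/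
theorem dataLaw_freePattern_insert (hr : ∀ i, 0 < r i) (hB : ∀ i, MeasurableSet (B i))
    (S T : Finset ℝ) (u : ℝ) (E : Set (ℕ → Row)) :
    (dataLaw r).real (freePattern B I S (insert u T) ∩ E) =
      (dataLaw r).real (freePattern B I S T ∩ E) -
        (dataLaw r).real (freePattern B I (insert u S) T ∩ E) := by
  have := isProbabilityMeasure_dataLaw hr
  have h := measureReal_inter_add_sdiff (μ := dataLaw r) (s := freePattern B I S T ∩ E)
    (measurableSet_free hB u (I := I))
  have e1 : freePattern B I S T ∩ E ∩ free B I u = freePattern B I (insert u S) T ∩ E := by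
    ext ζ; simp [freePattern]; tauto
  have e2 : (freePattern B I S T ∩ E) \ free B I u = freePattern B I S (insert u T) ∩ E := by
    ext ζ; simp [freePattern]; tauto
  rw [e1, e2] at h
  linarith

/-- The Markov property of the free times. -/
theorem dataLaw_markov (hr : ∀ i, 0 < r i) (hB : ∀ i, MeasurableSet (B i)) (T : Finset ℝ)
    {S : Finset ℝ} {t s : ℝ} (ht : 0 ≤ t) (hs : 0 ≤ s) (hS : ∀ u ∈ S, u ≤ t)
    (hT : ∀ u ∈ T, u ≤ t) (htS : t ∈ S) :
    (dataLaw r).real (freePattern B I S T ∩ free B I (t + s)) =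
      (∏ i ∈ I, stayProb (r i) (volume.real (B i)) s) *
        (dataLaw r).real (freePattern B I S T) := by
  induction T using Finset.induction_on generalizing S with
  | empty => exact dataLaw_markov_aux hr hB ht hs hS htS
  | insert u T _ ih =>
    have hu : u ≤ t := hT u (by simp)
    have hT' : ∀ v ∈ T, v ≤ t := fun v hv => hT v (by simp [hv])
    have h1 := dataLaw_freePattern_insert (I := I) hr hB S T u univ
    simp only [inter_univ] at h1
    rw [dataLaw_freePattern_insert hr hB, h1, ih hS hT' htS,
      ih (S := insert u S) (by simpa [hu] using hS) hT' (by simp [htS])]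
    ring

theorem prod_stayProb_eq {p : ℕ → ℝ} (hp : ∀ i ∈ I, p i < 1) (s : ℝ) :
    ∏ i ∈ I, stayProb (r i) (p i) s = (∏ i ∈ I, (1 - p i)) * corrKernel r p I s := by
  rw [corrKernel, ← Finset.prod_mul_distrib]
  refine Finset.prod_congr rfl fun i hi => ?_
  have : (1 - p i) ≠ 0 := by linarith [hp i hi]
  rw [stayProb]
  field_simp

theorem dataLaw_free_inter_free (hr : ∀ i, 0 < r i) (hB : ∀ i, MeasurableSet (B i))
    (hp : ∀ i ∈ I, volume.real (B i) < 1) {s t : ℝ} (hs : 0 ≤ s) (ht : 0 ≤ t) :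
    (dataLaw r).real (free B I s ∩ free B I t) =
      (∏ i ∈ I, (1 - volume.real (B i))) ^ 2 *
        corrKernel r (fun i => volume.real (B i)) I |s - t| := by
  wlog hst : s ≤ t generalizing s t
  · rw [inter_comm, this ht hs (le_of_not_ge hst), abs_sub_comm]
  have h := dataLaw_markov_aux (I := I) hr hB (S := {s}) hs (sub_nonneg.2 hst) (by simp) (by simp)
  have e : freePattern B I {s} ∅ = free B I s := by ext; simp [freePattern]
  rw [e, add_sub_cancel, dataLaw_free hr hB hs] at h
  rw [h, abs_sub_comm, abs_of_nonneg (sub_nonneg.2 hst),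
    prod_stayProb_eq (p := fun i => volume.real (B i)) hp]
  ring

theorem corrKernel_antitone (hr : ∀ i, 0 < r i) {p : ℕ → ℝ} (hp0 : ∀ i, 0 ≤ p i)
    (hp : ∀ i ∈ I, p i < 1) : Antitone (corrKernel r p I) := by
  intro s t hst
  refine Finset.prod_le_prod (fun i hi => ?_) fun i hi => ?_
  · have := div_nonneg (hp0 i) (sub_nonneg.2 (hp i hi).le)
    positivity
  · have := div_nonneg (hp0 i) (sub_nonneg.2 (hp i hi).le)
    have : r i * s ≤ r i * t := mul_le_mul_of_nonneg_left hst (hr i).le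
    gcongr

theorem continuous_corrKernel (p : ℕ → ℝ) : Continuous (corrKernel r p I) := by
  unfold corrKernel; fun_prop

/-- First hit decomposition on a grid. -/
theorem dataLaw_grid_hit (hr : ∀ i, 0 < r i) (hB : ∀ i, MeasurableSet (B i)) {a δ : ℝ}
    (ha : 0 ≤ a) (hδ : 0 < δ) (m : ℕ) :
    (dataLaw r).real {ζ | ∃ k : ℕ, k < m ∧ ζ ∈ free B I (a + k * δ)} *
      ∑ l ∈ Finset.range m, ∏ i ∈ I, stayProb (r i) (volume.real (B i)) (l * δ) ≤
      2 * m * ∏ i ∈ I, (1 - volume.real (B i)) := by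
  have := isProbabilityMeasure_dataLaw hr
  set τ : ℕ → ℝ := fun k => a + k * δ with hτ
  have hτ0 : ∀ k, 0 ≤ τ k := fun k => by positivity
  -- H k is the event that k is the first free index on the grid; this is where patterns with
  -- non-free times are needed.
  set H : ℕ → Set (ℕ → Row) := fun k =>
    freePattern B I {τ k} ((Finset.range k).image τ) with hH
  have hHmem : ∀ k ζ, ζ ∈ H k ↔ ζ ∈ free B I (τ k) ∧ ∀ k' < k, ζ ∉ free B I (τ k') := by
    intro k ζ; simp [hH, freePattern]
  have hHm : ∀ k, MeasurableSet (H k) := fun k => measurableSet_freePattern hB _ _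
  have hdisj : Pairwise (Function.onFun Disjoint H) := by
    refine (Std.Symm.pairwise_on H).2 fun k k' hk => ?_
    refine disjoint_left.2 fun ζ h1 h2 => ?_
    exact ((hHmem _ _).1 h2).2 k hk ((hHmem _ _).1 h1).1
  have hunion : {ζ | ∃ k : ℕ, k < m ∧ ζ ∈ free B I (τ k)} = ⋃ k ∈ Finset.range m, H k := by
    classical
    ext ζ
    simp only [mem_ofPred_eq, mem_iUnion, Finset.mem_range, exists_prop]
    constructor
    · rintro ⟨k, hk, h⟩
      have hex : ∃ k, ζ ∈ free B I (τ k) := ⟨k, h⟩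
      exact ⟨Nat.find hex, (Nat.find_min' hex h).trans_lt hk,
        (hHmem _ _).2 ⟨Nat.find_spec hex, fun k' hk' => Nat.find_min hex hk'⟩⟩
    · rintro ⟨k, hk, h⟩
      exact ⟨k, hk, ((hHmem _ _).1 h).1⟩
  have hmk : ∀ k l : ℕ, (dataLaw r).real (H k ∩ free B I (τ (k + l))) =
      (∏ i ∈ I, stayProb (r i) (volume.real (B i)) (l * δ)) * (dataLaw r).real (H k) := by
    intro k l
    have e : τ (k + l) = τ k + l * δ := by simp only [hτ]; push_cast; ring
    rw [e]
    refine dataLaw_markov hr hB _ (hτ0 k) (by positivity) (by simp) ?_ (by simp)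
    intro u hu
    obtain ⟨k', hk', rfl⟩ := Finset.mem_image.1 hu
    have : (k' : ℝ) ≤ k := by exact_mod_cast (Finset.mem_range.1 hk').le
    simp only [hτ]
    nlinarith
  calc _ = (∑ k ∈ Finset.range m, (dataLaw r).real (H k)) *
        ∑ l ∈ Finset.range m, ∏ i ∈ I, stayProb (r i) (volume.real (B i)) (l * δ) := by
        rw [hunion, measureReal_biUnion_finset (fun i _ j _ hij => hdisj hij) fun i _ => hHm i]
    _ = ∑ k ∈ Finset.range m, ∑ l ∈ Finset.range m,
        (dataLaw r).real (H k ∩ free B I (τ (k + l))) := by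
        rw [Finset.sum_mul_sum]
        refine Finset.sum_congr rfl fun k _ => Finset.sum_congr rfl fun l _ => ?_
        rw [hmk, mul_comm]
    -- The shifted window k, …, k + m - 1 lies in 0, …, 2m - 1, which is the origin of the factor 2.
    -- The H k being disjoint, summing over k then leaves at most P(free at τ n) for each n.
    _ ≤ ∑ k ∈ Finset.range m, ∑ n ∈ Finset.range (2 * m),
        (dataLaw r).real (H k ∩ free B I (τ n)) := by
        refine Finset.sum_le_sum fun k hk => ?_
        have hk := Finset.mem_range.1 hk
        rw [Finset.range_eq_Ico, Finset.sum_Ico_add (fun n => (dataLaw r).real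
          (H k ∩ free B I (τ n))) 0 m k]
        refine Finset.sum_le_sum_of_subset_of_nonneg ?_ fun _ _ _ => measureReal_nonneg
        intro n hn
        simp only [Finset.mem_Ico, Finset.mem_range] at *
        omega
    _ = ∑ n ∈ Finset.range (2 * m), ∑ k ∈ Finset.range m,
        (dataLaw r).real (H k ∩ free B I (τ n)) := Finset.sum_comm
    _ ≤ ∑ n ∈ Finset.range (2 * m), (dataLaw r).real (free B I (τ n)) := by
        refine Finset.sum_le_sum fun n _ => ?_
        rw [← measureReal_biUnion_finset]
        · exact measureReal_mono (iUnion₂_subset fun k _ => inter_subset_right)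
        · exact fun i _ j _ hij => (hdisj hij).mono inter_subset_left inter_subset_left
        · exact fun k _ => (hHm k).inter (measurableSet_free hB _)
    _ = _ := by
        rw [Finset.sum_congr rfl fun n _ => dataLaw_free hr hB (hτ0 n)]
        simp

/-- Dividing the grid estimate by π leaves a left Riemann sum of K, which dominates the integral
because K is decreasing. The resulting bound does not depend on the mesh. -/
theorem dataLaw_grid_hit_le (hr : ∀ i, 0 < r i) (hB : ∀ i, MeasurableSet (B i))
    (hp : ∀ i ∈ I, volume.real (B i) < 1) {a ε : ℝ} (ha : 0 ≤ a) (hε : 0 < ε) {m : ℕ}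
    (hm : 0 < m) :
    (dataLaw r).real {ζ | ∃ k : ℕ, k < m ∧ ζ ∈ free B I (a + k * (ε / m))} *
      (∫ s in (0 : ℝ)..ε, corrKernel r (fun i => volume.real (B i)) I s) ≤ 2 * ε := by
  have hm' : (0 : ℝ) < m := by exact_mod_cast hm
  have hδ : 0 < ε / m := by positivity
  set δ := ε / m with hδdef
  set p : ℕ → ℝ := fun i => volume.real (B i) with hpdef
  set X := (dataLaw r).real {ζ | ∃ k : ℕ, k < m ∧ ζ ∈ free B I (a + k * δ)} with hX
  have h : X * ∑ l ∈ Finset.range m, ∏ i ∈ I, stayProb (r i) (p i) (l * δ) ≤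
      2 * m * ∏ i ∈ I, (1 - p i) := dataLaw_grid_hit (I := I) hr hB ha hδ m
  have hX0 : 0 ≤ X := measureReal_nonneg
  have hπ : 0 < ∏ i ∈ I, (1 - p i) := Finset.prod_pos fun i hi => by
    have := hp i hi; simp only [hpdef]; linarith
  simp_rw [prod_stayProb_eq (p := p) hp, ← Finset.mul_sum] at h
  have h' : X * ∑ l ∈ Finset.range m, corrKernel r p I (l * δ) ≤ 2 * m := by
    have : (∏ i ∈ I, (1 - p i)) * (X * ∑ l ∈ Finset.range m, corrKernel r p I (l * δ)) ≤
      (∏ i ∈ I, (1 - p i)) * (2 * m) := by nlinarith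
    exact le_of_mul_le_mul_left this hπ
  have hanti : Antitone (corrKernel r p I) :=
    corrKernel_antitone hr (fun i => measureReal_nonneg) hp
  have hint : (∫ s in (0 : ℝ)..ε, corrKernel r p I s) ≤
      δ * ∑ l ∈ Finset.range m, corrKernel r p I (l * δ) := by
    have h1 : AntitoneOn (fun x => corrKernel r p I (x * δ)) (Icc (0 : ℝ) (0 + m)) :=
      fun x _ y _ hxy => hanti (mul_le_mul_of_nonneg_right hxy hδ.le)
    have h2 := h1.integral_le_sum
    simp only [zero_add] at h2
    rw [intervalIntegral.integral_comp_mul_right (fun s => corrKernel r p I s) hδ.ne', zero_mul,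
      show (m : ℝ) * δ = ε by rw [hδdef]; field_simp, smul_eq_mul, inv_mul_le_iff₀ hδ] at h2
    exact h2
  calc X * ∫ s in (0 : ℝ)..ε, corrKernel r p I s
      ≤ X * (δ * ∑ l ∈ Finset.range m, corrKernel r p I (l * δ)) := by gcongr
    _ = δ * (X * ∑ l ∈ Finset.range m, corrKernel r p I (l * δ)) := by ring
    _ ≤ δ * (2 * m) := by gcongr
    _ = 2 * ε := by rw [hδdef]; field_simp

/-- The arcs of `I` are simultaneously free at some dyadic point of `[a, a + ε)`. -/
def dyadicHit (B : ℕ → Set UnitAddCircle) (I : Finset ℕ) (a ε : ℝ) : Set (ℕ → Row) :=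
  ⋃ j : ℕ, {ζ | ∃ k : ℕ, k < 2 ^ j ∧ ζ ∈ free B I (a + k * (ε / (2 ^ j : ℕ)))}

theorem measurableSet_gridHit (hB : ∀ i, MeasurableSet (B i)) (a δ : ℝ) (m : ℕ) :
    MeasurableSet {ζ | ∃ k : ℕ, k < m ∧ ζ ∈ free B I (a + k * δ)} := by
  have e : {ζ | ∃ k : ℕ, k < m ∧ ζ ∈ free B I (a + k * δ)} =
    ⋃ k ∈ Finset.range m, free B I (a + k * δ) := by ext; simp
  rw [e]
  exact Finset.measurableSet_biUnion _ fun k _ => measurableSet_free hB _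

theorem measurableSet_dyadicHit (hB : ∀ i, MeasurableSet (B i)) (a ε : ℝ) :
    MeasurableSet (dyadicHit B I a ε) :=
  MeasurableSet.iUnion fun _ => measurableSet_gridHit hB _ _ _

/-- The dyadic grids are nested, so the mesh-independent bound survives the increasing union. -/
theorem dataLaw_dyadicHit_le (hr : ∀ i, 0 < r i) (hB : ∀ i, MeasurableSet (B i))
    (hp : ∀ i ∈ I, volume.real (B i) < 1) {a ε : ℝ} (ha : 0 ≤ a) (hε : 0 < ε) :
    (dataLaw r).real (dyadicHit B I a ε) *
      (∫ s in (0 : ℝ)..ε, corrKernel r (fun i => volume.real (B i)) I s) ≤ 2 * ε := by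
  have := isProbabilityMeasure_dataLaw hr
  have hmono : Monotone fun j : ℕ =>
      {ζ | ∃ k : ℕ, k < 2 ^ j ∧ ζ ∈ free B I (a + k * (ε / (2 ^ j : ℕ)))} := by
    refine monotone_nat_of_le_succ fun j ζ => ?_
    rintro ⟨k, hk, h⟩
    refine ⟨2 * k, by rw [pow_succ]; omega, ?_⟩
    convert h using 2
    push_cast
    rw [pow_succ]
    field_simp
  have ht := tendsto_measure_iUnion_atTop (μ := dataLaw r) hmono
  have ht' := (ENNReal.tendsto_toReal (measure_ne_top _ _)).comp ht
  refine le_of_tendsto' (ht'.mul_const _) fun j => ?_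
  exact dataLaw_grid_hit_le hr hB hp ha hε (by positivity)

/-- Non-explosion of all rows. -/
def NonExplosive (ζ : ℕ → Row) : Prop := ∀ i, ∀ t : ℝ, ∃ j, t < renewal (ζ i) j

theorem ae_nonExplosive (hr : ∀ i, 0 < r i) : ∀ᵐ ζ ∂dataLaw r, NonExplosive ζ := by
  refine ae_all_iff.2 fun i => ?_
  have := ae_exists_renewal_gt (hr i)
  rw [← dataLaw_map_apply hr i] at this
  exact ae_of_ae_map (measurable_pi_apply i).aemeasurable this

/-- Centers are right-continuous step functions of time, so freedom persists until the next update
of one of the finitely many arcs. Hence dyadic times detect every free time. -/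
theorem free_right_open {ζ : ℕ → Row} (hζ : NonExplosive ζ) {t : ℝ} (ht : 0 ≤ t)
    (h : ζ ∈ free B I t) : ∃ η > 0, ∀ u, t ≤ u → u < t + η → ζ ∈ free B I u := by
  have key : ∀ i, ∃ η > 0, ζ i ∈ uncovered (B i) t → ∀ u, t ≤ u → u < t + η →
      ζ i ∈ uncovered (B i) u := by
    intro i
    obtain ⟨j, hj⟩ := exists_mem_renewalCount (hζ i) ht
    refine ⟨renewal (ζ i) (j + 1) - t, sub_pos.2 hj.2, fun h u hu hu' => ?_⟩
    exact (mem_uncovered_iff ⟨hj.1.trans hu, by linarith⟩).2 ((mem_uncovered_iff hj).1 h)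
  choose η hη hηu using key
  induction I using Finset.induction_on with
  | empty => exact ⟨1, one_pos, fun u _ _ => by simp [free]⟩
  | insert i I _ ih =>
    obtain ⟨η', hη', h'⟩ := ih (fun k hk => h k (by simp [hk]))
    refine ⟨min (η i) η', lt_min (hη i) hη', fun u hu hu' k hk => ?_⟩
    rcases Finset.mem_insert.1 hk with rfl | hk
    · exact hηu k (h k (by simp)) u hu (hu'.trans_le (by gcongr; exact min_le_left _ _))
    · exact h' u hu (hu'.trans_le (by gcongr; exact min_le_right _ _)) k hk

theorem mem_dyadicHit_of_free {ζ : ℕ → Row} (hζ : NonExplosive ζ) {a ε t : ℝ} (ha : 0 ≤ a)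
    (hε : 0 < ε) (hat : a ≤ t) (hta : t < a + ε) (h : ζ ∈ free B I t) :
    ζ ∈ dyadicHit B I a ε := by
  obtain ⟨η, hη, hfree⟩ := free_right_open hζ (ha.trans hat) h
  have hη' : 0 < min η (a + ε - t) := lt_min hη (by linarith)
  obtain ⟨j, hj⟩ : ∃ j : ℕ, ε / 2 ^ j < min η (a + ε - t) := by
    have := tendsto_const_nhds (x := ε).div_atTop
      (tendsto_pow_atTop_atTop_of_one_lt (one_lt_two (α := ℝ)))
    exact ((this.eventually_lt_const hη').exists)
  have h2 : (0 : ℝ) < 2 ^ j := by positivity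
  have hδ : 0 < ε / 2 ^ j := by positivity
  set δ := ε / 2 ^ j with hδdef
  set k := ⌈(t - a) / δ⌉₊ with hk
  have hk1 : (t - a) / δ ≤ k := Nat.le_ceil _
  have hk2 : (k : ℝ) < (t - a) / δ + 1 := Nat.ceil_lt_add_one (div_nonneg (by linarith) hδ.le)
  rw [div_le_iff₀ hδ] at hk1
  have hk3 : (k : ℝ) * δ < t - a + δ := by
    have := mul_lt_mul_of_pos_right hk2 hδ
    rwa [add_mul, div_mul_cancel₀ _ hδ.ne', one_mul] at this
  refine mem_iUnion.2 ⟨j, k, ?_, ?_⟩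
  · have h4 : (k : ℝ) * δ < ε := by linarith [hj.trans_le (min_le_right _ _)]
    rw [hδdef, mul_div_assoc', div_lt_iff₀ h2, mul_comm] at h4
    have : (k : ℝ) < 2 ^ j := lt_of_mul_lt_mul_left h4 hε.le
    exact_mod_cast this
  · push_cast
    refine hfree _ (by linarith) (by linarith [hj.trans_le (min_le_left _ _)])

end Finite

/-! ### Estimates for the correlation kernel -/

theorem exists_rpow_succ_sub_rpow {x b : ℝ} (hx : 0 ≤ x) (h : 0 < x ∨ 0 ≤ b) :
    ∃ c ∈ Ioo x (x + 1), (x + 1) ^ b - x ^ b = b * c ^ (b - 1) := by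
  obtain ⟨c, hc, h'⟩ := exists_hasDerivAt_eq_slope (fun y : ℝ => y ^ b)
    (fun y => b * y ^ (b - 1)) (lt_add_one x)
    (fun y hy => (Real.continuousAt_rpow_const y b
      (h.imp (fun h0 => (h0.trans_le hy.1).ne') id)).continuousWithinAt)
    (fun y hy => Real.hasDerivAt_rpow_const (Or.inl (hx.trans_lt hy.1).ne'))
  refine ⟨c, hc, ?_⟩
  simp only [add_sub_cancel_left, div_one] at h'
  exact h'.symm

/-- For α ≤ 1 this is the mean value theorem with a decreasing derivative; for α ≥ 1 it is x^α ≤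
(x+1)^{α-1} x. -/
theorem min_mul_rpow_le_sub {α x : ℝ} (hα : 0 < α) (hx : 0 ≤ x) :
    min α 1 * (x + 1) ^ (α - 1) ≤ (x + 1) ^ α - x ^ α := by
  have hx1 : 0 < x + 1 := by linarith
  rcases le_total α 1 with h | h
  · rw [min_eq_left h]
    obtain ⟨c, hc, e⟩ := exists_rpow_succ_sub_rpow hx (Or.inr hα.le)
    rw [e]
    have : (x + 1) ^ (α - 1) ≤ c ^ (α - 1) :=
      Real.rpow_le_rpow_of_nonpos (hx.trans_lt hc.1) hc.2.le (by linarith)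
    gcongr
  · rw [min_eq_right h, one_mul]
    have h1 : (x + 1) ^ α = (x + 1) ^ (α - 1) * (x + 1) := by
      rw [← Real.rpow_add_one hx1.ne', sub_add_cancel]
    have h2 : x ^ α ≤ (x + 1) ^ (α - 1) * x := by
      rcases hx.eq_or_lt with rfl | hx'
      · rw [Real.zero_rpow hα.ne']; simp
      · rw [show x ^ α = x ^ (α - 1) * x by rw [← Real.rpow_add_one hx'.ne', sub_add_cancel]]
        gcongr
        linarith
    linarith

theorem sum_rpow_le {α : ℝ} (hα : 0 < α) (m : ℕ) :
    ∑ i ∈ Finset.range m, ((i : ℝ) + 1) ^ (α - 1) ≤ (min α 1)⁻¹ * (m : ℝ) ^ α := by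
  have hpos : 0 < min α 1 := lt_min hα one_pos
  rw [le_inv_mul_iff₀ hpos, Finset.mul_sum]
  calc _ ≤ ∑ i ∈ Finset.range m, (((i + 1 : ℕ) : ℝ) ^ α - (i : ℝ) ^ α) := by
        refine Finset.sum_le_sum fun i _ => ?_
        push_cast
        exact min_mul_rpow_le_sub hα i.cast_nonneg
    _ = _ := by
        rw [Finset.sum_range_sub (fun i : ℕ => (i : ℝ) ^ α)]
        simp [Real.zero_rpow hα.ne']

theorem mul_rpow_le_sub_neg {α x : ℝ} (hα : 0 < α) (hx : 0 < x) :
    α * (x + 1) ^ (-α - 1) ≤ x ^ (-α) - (x + 1) ^ (-α) ∧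
      x ^ (-α) - (x + 1) ^ (-α) ≤ α * x ^ (-α - 1) := by
  obtain ⟨c, hc, e⟩ := exists_rpow_succ_sub_rpow (b := -α) hx.le (Or.inl hx)
  have e' : x ^ (-α) - (x + 1) ^ (-α) = α * c ^ (-α - 1) := by linarith
  rw [e']
  have hc0 : 0 < c := hx.trans hc.1
  constructor
  · have := Real.rpow_le_rpow_of_nonpos hc0 hc.2.le (show -α - 1 ≤ 0 by linarith)
    gcongr
  · have := Real.rpow_le_rpow_of_nonpos hx hc.1.le (show -α - 1 ≤ 0 by linarith)
    gcongr

theorem sum_Ico_rpow_neg_le {α : ℝ} (hα : 0 < α) {N : ℕ} (hN : 0 < N) (n : ℕ) :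
    ∑ i ∈ Finset.Ico N n, ((i : ℝ) + 1) ^ (-α - 1) ≤ α⁻¹ * (N : ℝ) ^ (-α) := by
  rcases le_total n N with h | h
  · rw [Finset.Ico_eq_empty_of_le h]; simp; positivity
  rw [le_inv_mul_iff₀ hα, Finset.mul_sum]
  calc _ ≤ ∑ i ∈ Finset.Ico N n, (-(((i + 1 : ℕ) : ℝ) ^ (-α)) - -((i : ℝ) ^ (-α))) := by
        refine Finset.sum_le_sum fun i hi => ?_
        have : 0 < i := hN.trans_le (Finset.mem_Ico.1 hi).1
        have := (mul_rpow_le_sub_neg hα (show (0 : ℝ) < i by exact_mod_cast this)).1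
        push_cast
        linarith
    _ = -((n : ℝ) ^ (-α)) - -((N : ℝ) ^ (-α)) :=
        Finset.sum_Ico_sub (fun i : ℕ => -((i : ℝ) ^ (-α))) h
    _ ≤ _ := by
        have : (0 : ℝ) ≤ (n : ℝ) ^ (-α) := by positivity
        linarith

/-- Combines x - x² ≤ x/(1+x) with 1 - y ≤ e^{-y} at y = x/(1+x). It bounds a product of factors 1 +
x_i below by e^{∑ x_i}, up to a quadratic error. -/
theorem exp_sub_sq_le_one_add {x : ℝ} (hx : 0 ≤ x) : Real.exp (x - x ^ 2) ≤ 1 + x := by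
  have h1 : 0 < 1 + x := by linarith
  have h2 : x - x ^ 2 ≤ x / (1 + x) := by
    rw [le_div_iff₀ h1]; nlinarith [mul_nonneg hx (sq_nonneg x)]
  have h3 : 1 - x / (1 + x) ≤ Real.exp (-(x / (1 + x))) := by
    linarith [Real.add_one_le_exp (-(x / (1 + x)))]
  have h4 : 1 - x / (1 + x) = (1 + x)⁻¹ := by field_simp; ring
  rw [h4, Real.exp_neg] at h3
  exact (Real.exp_le_exp.2 h2).trans ((inv_le_inv₀ h1 (Real.exp_pos _)).1 h3)

/-! ### Two-sided kernel bounds when ℓ_n = Θ(1/n) -/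

section Lengths

variable {ℓ : ℕ → ℝ} {α : ℝ}

/-- The partial sums `ℓ_1 + ⋯ + ℓ_{m+1}`. -/
noncomputable def lenSum (ℓ : ℕ → ℝ) (m : ℕ) : ℝ := ∑ k ∈ Finset.range (m + 1), ℓ k

theorem IsThetaInv.pos (hℓ : IsThetaInv ℓ) (i : ℕ) : 0 < ℓ i := by
  obtain ⟨M₀, M₁, h0, _, h⟩ := hℓ
  exact lt_of_lt_of_le (by positivity) (h i).1

theorem IsThetaInv.eventually_le (hℓ : IsThetaInv ℓ) : ∃ N₀ : ℕ, 0 < N₀ ∧ ∀ i ≥ N₀, ℓ i ≤ 1 / 2 := by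
  obtain ⟨M₀, M₁, h0, h01, h⟩ := hℓ
  obtain ⟨N, hN⟩ := exists_nat_ge (2 * M₁)
  refine ⟨N + 1, by omega, fun i hi => (h i).2.trans ?_⟩
  have : (N : ℝ) + 1 ≤ i := by exact_mod_cast hi
  rw [div_le_iff₀ (by positivity)]
  linarith

/-- Since ℓ_n = O(1/n), all quadratic errors in replacing 1 + x by e^x add up to a bounded constant.
-/
theorem IsThetaInv.sum_sq_le (hℓ : IsThetaInv ℓ) :
    ∃ D : ℝ, 0 ≤ D ∧ ∀ I : Finset ℕ, ∑ i ∈ I, ℓ i ^ 2 ≤ D := by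
  have hpos := hℓ.pos
  obtain ⟨M₀, M₁, h0, h01, h⟩ := hℓ
  have hs : Summable fun i : ℕ => ℓ i ^ 2 := by
    have h1 : Summable fun i : ℕ => M₁ ^ 2 * (1 / (((i + 1 : ℕ) : ℝ) ^ 2)) :=
      ((summable_nat_add_iff 1).2 (Real.summable_one_div_nat_pow.2 one_lt_two)).mul_left _
    refine Summable.of_nonneg_of_le (fun i => sq_nonneg _) (fun i => ?_) h1
    calc ℓ i ^ 2 ≤ (M₁ / (i + 1)) ^ 2 := pow_le_pow_left₀ (hpos i).le (h i).2 2
      _ = _ := by push_cast; rw [div_pow]; ring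
  exact ⟨∑' i, ℓ i ^ 2, tsum_nonneg fun i => sq_nonneg _,
    fun I => hs.sum_le_tsum I fun i _ => sq_nonneg _⟩

/-- Lower bound for the correlation kernel. -/
theorem corrKernel_ge (hℓ : IsThetaInv ℓ) (hα : 0 < α) {N : ℕ} (hN : ∀ i ≥ N, ℓ i ≤ 1 / 2) :
    ∃ c > 0, ∀ m n : ℕ, m + 1 ≤ n → ∀ u : ℝ, 0 ≤ u → u ≤ ((m : ℝ) + 1) ^ (-α) →
      c * Real.exp (lenSum ℓ m) ≤
        corrKernel (fun i => ℓ i ^ (-α)) ℓ (Finset.Ico N n) u := by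
  have hpos := hℓ.pos
  obtain ⟨D, hD0, hD⟩ := hℓ.sum_sq_le
  obtain ⟨M₀, M₁, h0, h01, h⟩ := hℓ
  -- K bounds ∑_{i ≤ m} ℓ_i^{1-α} u, the loss due to updates within lag u ≤ (m+1)^{-α}: the terms
  -- are at most a constant times (i+1)^{α-1} u, and the powers sum to order (m+1)^α.
  set K := M₁ * M₀ ^ (-α) * (min α 1)⁻¹ with hK
  -- The three losses are the omitted arcs below N, the updates (K) and the quadratic errors (D).
  refine ⟨Real.exp (-(∑ i ∈ Finset.range N, ℓ i) - K - D), Real.exp_pos _,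
    fun m n hmn u hu0 hu => ?_⟩
  have hfac : ∀ i ∈ Finset.Ico N n,
      1 ≤ 1 + ℓ i / (1 - ℓ i) * Real.exp (-(ℓ i ^ (-α) * u)) := by
    intro i hi
    have h1 := hN i (Finset.mem_Ico.1 hi).1
    have : 0 ≤ ℓ i / (1 - ℓ i) := div_nonneg (hpos i).le (by linarith)
    have := mul_nonneg this (Real.exp_pos (-(ℓ i ^ (-α) * u))).le
    linarith
  have hsub : Finset.Ico N (m + 1) ⊆ Finset.Ico N n := Finset.Ico_subset_Ico_right hmn
  have hstep : ∀ i ∈ Finset.Ico N (m + 1),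
      Real.exp (ℓ i - ℓ i * ℓ i ^ (-α) * u - ℓ i ^ 2) ≤
        1 + ℓ i / (1 - ℓ i) * Real.exp (-(ℓ i ^ (-α) * u)) := by
    intro i hi
    have h1 := hN i (Finset.mem_Ico.1 hi).1
    have hp := hpos i
    set y := ℓ i ^ (-α) * u
    have hy : 0 ≤ y := by positivity
    have e1 : 1 - y ≤ Real.exp (-y) := by linarith [Real.add_one_le_exp (-y)]
    have e2 : Real.exp (-y) ≤ 1 := Real.exp_le_one_iff.2 (by linarith)
    have e3 : ℓ i ≤ ℓ i / (1 - ℓ i) := by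
      rw [le_div_iff₀ (by linarith)]; nlinarith
    calc Real.exp (ℓ i - ℓ i * ℓ i ^ (-α) * u - ℓ i ^ 2)
        ≤ Real.exp (ℓ i * Real.exp (-y) - (ℓ i * Real.exp (-y)) ^ 2) := by
          refine Real.exp_le_exp.2 ?_
          have e4 : (ℓ i * Real.exp (-y)) ^ 2 ≤ ℓ i ^ 2 := by
            apply pow_le_pow_left₀ (by positivity)
            nlinarith
          have e5 : ℓ i * (1 - y) ≤ ℓ i * Real.exp (-y) := by gcongr
          have e6 : ℓ i * ℓ i ^ (-α) * u = ℓ i * y := by simp only [y]; ring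
          rw [e6]
          linarith
      _ ≤ 1 + ℓ i * Real.exp (-y) := exp_sub_sq_le_one_add (by positivity)
      _ ≤ _ := by gcongr
  have hsum2 : ∑ i ∈ Finset.Ico N (m + 1), ℓ i * ℓ i ^ (-α) * u ≤ K := by
    have hb : ∀ i, ℓ i * ℓ i ^ (-α) ≤ M₁ * M₀ ^ (-α) * ((i : ℝ) + 1) ^ (α - 1) := by
      intro i
      have hi : (0 : ℝ) < (i : ℝ) + 1 := by positivity
      have e1 : ℓ i ^ (-α) ≤ (M₀ / ((i : ℝ) + 1)) ^ (-α) :=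
        Real.rpow_le_rpow_of_nonpos (by positivity) (h i).1 (by linarith)
      have e2 : (M₀ / ((i : ℝ) + 1)) ^ (-α) = M₀ ^ (-α) * ((i : ℝ) + 1) ^ α := by
        rw [Real.div_rpow h0.le hi.le, Real.rpow_neg hi.le, div_inv_eq_mul]
      have hM1 : 0 < M₁ := h0.trans_le h01
      calc ℓ i * ℓ i ^ (-α) ≤ M₁ / ((i : ℝ) + 1) * (M₀ ^ (-α) * ((i : ℝ) + 1) ^ α) := by
            rw [← e2]
            have := hpos i
            gcongr
            exact (h i).2
        _ = _ := by rw [Real.rpow_sub_one hi.ne']; ring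
    calc ∑ i ∈ Finset.Ico N (m + 1), ℓ i * ℓ i ^ (-α) * u
        ≤ ∑ i ∈ Finset.range (m + 1), ℓ i * ℓ i ^ (-α) * u := by
          refine Finset.sum_le_sum_of_subset_of_nonneg ?_ fun i _ _ => ?_
          · intro i hi; simp only [Finset.mem_Ico, Finset.mem_range] at *; omega
          · have := hpos i; positivity
      _ ≤ ∑ i ∈ Finset.range (m + 1), M₁ * M₀ ^ (-α) * ((i : ℝ) + 1) ^ (α - 1) * u := by
          refine Finset.sum_le_sum fun i _ => ?_
          have := hb i
          gcongr
      _ = M₁ * M₀ ^ (-α) * (∑ i ∈ Finset.range (m + 1), ((i : ℝ) + 1) ^ (α - 1)) * u := by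
          rw [Finset.mul_sum, Finset.sum_mul]
      _ ≤ M₁ * M₀ ^ (-α) * ((min α 1)⁻¹ * ((m + 1 : ℕ) : ℝ) ^ α) * ((m : ℝ) + 1) ^ (-α) := by
          have := sum_rpow_le hα (m + 1)
          have hM1 : 0 < M₁ := h0.trans_le h01
          gcongr
      _ = K := by
          push_cast
          have hm : (0 : ℝ) < (m : ℝ) + 1 := by positivity
          have : ((m : ℝ) + 1) ^ α * ((m : ℝ) + 1) ^ (-α) = 1 := by
            rw [← Real.rpow_add hm]; simp
          rw [hK]
          linear_combination M₁ * M₀ ^ (-α) * (min α 1)⁻¹ * this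
  have hS : lenSum ℓ m ≤ ∑ i ∈ Finset.range N, ℓ i + ∑ i ∈ Finset.Ico N (m + 1), ℓ i := by
    rw [lenSum]
    have : Finset.range (m + 1) ⊆ Finset.range N ∪ Finset.Ico N (m + 1) := by
      intro i hi; simp only [Finset.mem_union, Finset.mem_Ico, Finset.mem_range] at *; omega
    rw [← Finset.sum_union]
    · exact Finset.sum_le_sum_of_subset_of_nonneg this fun i _ _ => (hpos i).le
    · exact Finset.disjoint_left.2 fun i hi hi' => by
        simp only [Finset.mem_Ico, Finset.mem_range] at *; omega
  calc _ = Real.exp (-(∑ i ∈ Finset.range N, ℓ i) - K - D + lenSum ℓ m) := by rw [Real.exp_add]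
    _ ≤ Real.exp (∑ i ∈ Finset.Ico N (m + 1), (ℓ i - ℓ i * ℓ i ^ (-α) * u - ℓ i ^ 2)) := by
        refine Real.exp_le_exp.2 ?_
        rw [Finset.sum_sub_distrib, Finset.sum_sub_distrib]
        linarith [hD (Finset.Ico N (m + 1))]
    _ = ∏ i ∈ Finset.Ico N (m + 1), Real.exp (ℓ i - ℓ i * ℓ i ^ (-α) * u - ℓ i ^ 2) :=
        Real.exp_sum _ _
    _ ≤ ∏ i ∈ Finset.Ico N (m + 1),
        (1 + ℓ i / (1 - ℓ i) * Real.exp (-(ℓ i ^ (-α) * u))) :=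
        Finset.prod_le_prod (fun _ _ => (Real.exp_pos _).le) hstep
    _ ≤ _ := by
        rw [corrKernel, ← Finset.prod_sdiff hsub]
        refine le_mul_of_one_le_left ?_ ?_
        · exact Finset.prod_nonneg fun i hi => zero_le_one.trans (hfac i (hsub hi))
        · refine (Finset.prod_const_one (s := Finset.Ico N n \ Finset.Ico N (m + 1))).symm.le.trans ?_
          exact Finset.prod_le_prod (fun _ _ => zero_le_one) fun i hi =>
            hfac i (Finset.mem_sdiff.1 hi).1

/-- Upper bound for the correlation kernel of small arcs. -/
theorem corrKernel_tail_le (hℓ : IsThetaInv ℓ) (hα : 0 < α) :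
    ∃ C > 0, ∀ N n : ℕ, 0 < N → (∀ i ≥ N, ℓ i ≤ 1 / 2) → ∀ u : ℝ, 0 < u →
      corrKernel (fun i => ℓ i ^ (-α)) ℓ (Finset.Ico N n) u ≤
        Real.exp (C * u⁻¹ * (N : ℝ) ^ (-α)) := by
  have hpos := hℓ.pos
  obtain ⟨M₀, M₁, h0, h01, h⟩ := hℓ
  have hM1 : 0 < M₁ := h0.trans_le h01
  -- For y = ℓ_i^{-α} u, use e^{-y} ≤ 1/y = ℓ_i^α/u and ℓ_i/(1 - ℓ_i) ≤ 2ℓ_i; summing (i+1)^{-α-1}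
  -- from N on gives N^{-α}/α.
  refine ⟨2 * (M₁ * M₁ ^ α) * α⁻¹, by positivity, fun N n hN hN' u hu => ?_⟩
  have hstep : ∀ i ∈ Finset.Ico N n,
      1 + ℓ i / (1 - ℓ i) * Real.exp (-(ℓ i ^ (-α) * u)) ≤
        Real.exp (2 * (M₁ * M₁ ^ α) * u⁻¹ * ((i : ℝ) + 1) ^ (-α - 1)) := by
    intro i hi
    have h1 := hN' i (Finset.mem_Ico.1 hi).1
    have hp := hpos i
    have hi : (0 : ℝ) < (i : ℝ) + 1 := by positivity
    set y := ℓ i ^ (-α) * u with hy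
    have hy0 : 0 < y := by positivity
    have e1 : Real.exp (-y) ≤ y⁻¹ := by
      rw [Real.exp_neg]
      exact inv_anti₀ hy0 (by linarith [Real.add_one_le_exp y])
    have e2 : ℓ i / (1 - ℓ i) ≤ 2 * ℓ i := by
      rw [div_le_iff₀ (by linarith)]; nlinarith
    have e3 : y⁻¹ = ℓ i ^ α * u⁻¹ := by
      rw [hy, mul_inv, Real.rpow_neg hp.le, inv_inv]
    have e4 : ℓ i ^ α ≤ (M₁ / ((i : ℝ) + 1)) ^ α :=
      Real.rpow_le_rpow hp.le (h i).2 hα.le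
    rw [Real.div_rpow hM1.le hi.le] at e4
    have e5 : ((i : ℝ) + 1) ^ (-α - 1) = (((i : ℝ) + 1) ^ α)⁻¹ * ((i : ℝ) + 1)⁻¹ := by
      rw [Real.rpow_sub_one hi.ne', Real.rpow_neg hi.le]; rfl
    calc 1 + ℓ i / (1 - ℓ i) * Real.exp (-y) ≤ 1 + 2 * ℓ i * (ℓ i ^ α * u⁻¹) := by
          rw [← e3]; gcongr
      _ ≤ 1 + 2 * (M₁ / ((i : ℝ) + 1)) * (M₁ ^ α / ((i : ℝ) + 1) ^ α * u⁻¹) := by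
          gcongr
          exact (h i).2
      _ = 2 * (M₁ * M₁ ^ α) * u⁻¹ * ((i : ℝ) + 1) ^ (-α - 1) + 1 := by
          rw [e5]; field_simp; ring
      _ ≤ _ := Real.add_one_le_exp _
  have hfac : ∀ i ∈ Finset.Ico N n,
      0 ≤ 1 + ℓ i / (1 - ℓ i) * Real.exp (-(ℓ i ^ (-α) * u)) := by
    intro i hi
    have h1 := hN' i (Finset.mem_Ico.1 hi).1
    have : 0 ≤ ℓ i / (1 - ℓ i) := div_nonneg (hpos i).le (by linarith)
    positivity
  refine (Finset.prod_le_prod hfac hstep).trans ?_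
  rw [← Real.exp_sum, ← Finset.mul_sum]
  refine Real.exp_le_exp.2 ?_
  calc _ ≤ 2 * (M₁ * M₁ ^ α) * u⁻¹ * (α⁻¹ * (N : ℝ) ^ (-α)) := by
        gcongr
        exact sum_Ico_rpow_neg_le hα hN n
    _ = _ := by ring

/-- Upper bound for the correlation kernel. -/
theorem corrKernel_le (hℓ : IsThetaInv ℓ) (hα : 0 < α) {N : ℕ} (hN : ∀ i ≥ N, ℓ i ≤ 1 / 2) :
    ∃ C > 0, ∀ m n : ℕ, ∀ u : ℝ, ((m : ℝ) + 2) ^ (-α) ≤ u →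
      corrKernel (fun i => ℓ i ^ (-α)) ℓ (Finset.Ico N n) u ≤ C * Real.exp (lenSum ℓ m) := by
  have hpos := hℓ.pos
  obtain ⟨D, hD0, hD⟩ := hℓ.sum_sq_le
  obtain ⟨C, hC, htail⟩ := corrKernel_tail_le hℓ hα
  refine ⟨Real.exp (2 * D + (∑ i ∈ Finset.range N, ℓ i)) * Real.exp (C * 2 ^ α), by positivity,
    fun m n u hu => ?_⟩
  have hm2 : (0 : ℝ) < (m : ℝ) + 2 := by positivity
  have hu0 : 0 < u := lt_of_lt_of_le (by positivity) hu
  set r : ℕ → ℝ := fun i => ℓ i ^ (-α)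
  have hfac : ∀ i ≥ N, 1 ≤ 1 + ℓ i / (1 - ℓ i) * Real.exp (-(ℓ i ^ (-α) * u)) := by
    intro i hi
    have h1 := hN i hi
    have : 0 ≤ ℓ i / (1 - ℓ i) := div_nonneg (hpos i).le (by linarith)
    have := mul_nonneg this (Real.exp_pos (-(ℓ i ^ (-α) * u))).le
    linarith
  have hstep : ∀ i ≥ N, 1 + ℓ i / (1 - ℓ i) * Real.exp (-(ℓ i ^ (-α) * u)) ≤
      Real.exp (ℓ i + 2 * ℓ i ^ 2) := by
    intro i hi
    have h1 := hN i hi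
    have hp := hpos i
    have e2 : Real.exp (-(ℓ i ^ (-α) * u)) ≤ 1 :=
      Real.exp_le_one_iff.2 (by have : 0 ≤ ℓ i ^ (-α) * u := by positivity
                                linarith)
    have e3 : ℓ i / (1 - ℓ i) ≤ ℓ i + 2 * ℓ i ^ 2 := by
      rw [div_le_iff₀ (by linarith)]
      nlinarith [mul_nonneg (sq_nonneg (ℓ i)) (show 0 ≤ 1 / 2 - ℓ i by linarith)]
    have : 0 ≤ ℓ i / (1 - ℓ i) := div_nonneg hp.le (by linarith)
    calc _ ≤ 1 + (ℓ i + 2 * ℓ i ^ 2) * 1 := by gcongr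
      _ ≤ _ := by linarith [Real.add_one_le_exp (ℓ i + 2 * ℓ i ^ 2)]
  have hA : corrKernel r ℓ (Finset.Ico N (m + 1)) u ≤
      Real.exp (2 * D + ∑ i ∈ Finset.range N, ℓ i) * Real.exp (lenSum ℓ m) := by
    refine (Finset.prod_le_prod (fun i hi => zero_le_one.trans (hfac i (Finset.mem_Ico.1 hi).1))
      (fun i hi => hstep i (Finset.mem_Ico.1 hi).1)).trans ?_
    rw [← Real.exp_sum, ← Real.exp_add]
    refine Real.exp_le_exp.2 ?_
    rw [Finset.sum_add_distrib, ← Finset.mul_sum]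
    have h1 : ∑ i ∈ Finset.Ico N (m + 1), ℓ i ≤ lenSum ℓ m := by
      refine Finset.sum_le_sum_of_subset_of_nonneg ?_ fun i _ _ => (hpos i).le
      intro i hi; simp only [Finset.mem_Ico, Finset.mem_range] at *; omega
    have h2 : 0 ≤ ∑ i ∈ Finset.range N, ℓ i := Finset.sum_nonneg fun i _ => (hpos i).le
    linarith [hD (Finset.Ico N (m + 1))]
  -- Arcs beyond m contribute a bounded factor at lag u ≥ (m+2)^{-α}, since then u^{-1} ≤ 2^α
  -- (m+1)^α cancels the tail decay (m+1)^{-α}.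
  have hB : corrKernel r ℓ (Finset.Ico (max N (m + 1)) n) u ≤ Real.exp (C * 2 ^ α) := by
    refine (htail (max N (m + 1)) n (by omega) (fun i hi => hN i ((le_max_left _ _).trans hi)) u
      hu0).trans (Real.exp_le_exp.2 ?_)
    have e1 : u⁻¹ ≤ ((m : ℝ) + 2) ^ α := by
      have := inv_anti₀ (by positivity) hu
      rwa [Real.rpow_neg hm2.le, inv_inv] at this
    have hm1 : (0 : ℝ) < (m : ℝ) + 1 := by positivity
    have e2 : ((max N (m + 1) : ℕ) : ℝ) ^ (-α) ≤ ((m : ℝ) + 1) ^ (-α) := by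
      refine Real.rpow_le_rpow_of_nonpos hm1 ?_ (by linarith)
      have : m + 1 ≤ max N (m + 1) := le_max_right _ _
      exact_mod_cast this
    have e3 : ((m : ℝ) + 2) ^ α ≤ 2 ^ α * ((m : ℝ) + 1) ^ α := by
      rw [← Real.mul_rpow (by norm_num) hm1.le]
      exact Real.rpow_le_rpow hm2.le (by linarith) hα.le
    have e4 : ((m : ℝ) + 1) ^ α * ((m : ℝ) + 1) ^ (-α) = 1 := by
      rw [← Real.rpow_add hm1]; simp
    calc C * u⁻¹ * ((max N (m + 1) : ℕ) : ℝ) ^ (-α)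
        ≤ C * (2 ^ α * ((m : ℝ) + 1) ^ α) * ((m : ℝ) + 1) ^ (-α) := by
          have := e1.trans e3
          gcongr
      _ = C * 2 ^ α * (((m : ℝ) + 1) ^ α * ((m : ℝ) + 1) ^ (-α)) := by ring
      _ = _ := by rw [e4, mul_one]
  have hsplit : corrKernel r ℓ (Finset.Ico N n) u ≤ corrKernel r ℓ (Finset.Ico N (m + 1)) u *
      corrKernel r ℓ (Finset.Ico (max N (m + 1)) n) u := by
    have hdis : Disjoint (Finset.Ico N (m + 1)) (Finset.Ico (max N (m + 1)) n) :=
      Finset.disjoint_left.2 fun i hi hi' => by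
        simp only [Finset.mem_Ico, max_le_iff] at *; omega
    have hsub : Finset.Ico N n ⊆ Finset.Ico N (m + 1) ∪ Finset.Ico (max N (m + 1)) n := by
      intro i hi; simp only [Finset.mem_union, Finset.mem_Ico, max_le_iff] at *; omega
    have hge : ∀ i ∈ Finset.Ico N (m + 1) ∪ Finset.Ico (max N (m + 1)) n, N ≤ i := by
      intro i hi; simp only [Finset.mem_union, Finset.mem_Ico, max_le_iff] at *; omega
    rw [corrKernel, corrKernel, corrKernel, ← Finset.prod_union hdis, ← Finset.prod_sdiff hsub]
    refine le_mul_of_one_le_left ?_ ?_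
    · exact Finset.prod_nonneg fun i hi => zero_le_one.trans (hfac i (hge i (hsub hi)))
    · refine (Finset.prod_const_one (s := (Finset.Ico N (m + 1) ∪
        Finset.Ico (max N (m + 1)) n) \ Finset.Ico N n)).symm.le.trans ?_
      exact Finset.prod_le_prod (fun _ _ => zero_le_one) fun i hi =>
        hfac i (hge i (Finset.mem_sdiff.1 hi).1)
  have hK0 : 0 ≤ corrKernel r ℓ (Finset.Ico (max N (m + 1)) n) u :=
    Finset.prod_nonneg fun i hi => zero_le_one.trans (hfac i
      ((le_max_left _ _).trans (Finset.mem_Ico.1 hi).1))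
  calc _ ≤ _ := hsplit
    _ ≤ (Real.exp (2 * D + ∑ i ∈ Finset.range N, ℓ i) * Real.exp (lenSum ℓ m)) *
        Real.exp (C * 2 ^ α) := by gcongr
    _ = _ := by ring

/-! ### Comparison of integrals and series -/

theorem sheppTerm_pos (ℓ : ℕ → ℝ) (β : ℝ) (n : ℕ) : 0 < sheppTerm ℓ β n := by
  unfold sheppTerm; positivity

theorem sheppTerm_eq (ℓ : ℕ → ℝ) (β : ℝ) (m : ℕ) :
    sheppTerm ℓ β m = Real.exp (lenSum ℓ m) * ((m : ℝ) + 1) ^ (-β - 1) := by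
  have hm : (0 : ℝ) < (m : ℝ) + 1 := by positivity
  rw [sheppTerm, lenSum, show -β - 1 = -(1 + β) by ring, Real.rpow_neg hm.le]; rfl

/-- If the series diverges, the integrals of the correlation kernels are unbounded. -/
theorem integral_corrKernel_unbounded (hℓ : IsThetaInv ℓ) (hα : 0 < α) {N : ℕ}
    (hN : ∀ i ≥ N, ℓ i ≤ 1 / 2) (hdiv : ¬ Summable (sheppTerm ℓ α)) (L : ℝ) :
    ∃ n, L ≤ ∫ s in (0 : ℝ)..1, corrKernel (fun i => ℓ i ^ (-α)) ℓ (Finset.Ico N n) s := by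
  have hpos := hℓ.pos
  obtain ⟨c, hc, hlow⟩ := corrKernel_ge hℓ hα hN
  -- The slice between (m+2)^{-α} and (m+1)^{-α} has length at least α (m+2)^{-α-1} ≥ α 2^{-α-1}
  -- (m+1)^{-α-1}.
  set c' := c * (α * (1 / 2) ^ (α + 1)) with hc'
  have hc'0 : 0 < c' := by positivity
  have htend := (not_summable_iff_tendsto_nat_atTop_of_nonneg
    (fun n => (sheppTerm_pos ℓ α n).le)).1 hdiv
  obtain ⟨n, hn⟩ := (htend.eventually_ge_atTop (L / c')).exists
  refine ⟨n, ?_⟩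
  set K := corrKernel (fun i => ℓ i ^ (-α)) ℓ (Finset.Ico N n) with hK
  have hKc : Continuous K := continuous_corrKernel _
  have hK0 : ∀ s, 0 ≤ K s := fun s => Finset.prod_nonneg fun i hi => by
    have h1 := hN i (Finset.mem_Ico.1 hi).1
    have : 0 ≤ ℓ i / (1 - ℓ i) := div_nonneg (hpos i).le (by linarith)
    positivity
  set a : ℕ → ℝ := fun m => ((m : ℝ) + 1) ^ (-α) with ha
  have ha0 : a 0 = 1 := by simp [ha]
  have hsum := intervalIntegral.sum_integral_adjacent_intervals (f := K) (μ := volume) (a := a)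
    (n := n) (fun k _ => hKc.intervalIntegrable _ _)
  have hle : (∫ s in (a n)..1, K s) ≤ ∫ s in (0 : ℝ)..1, K s := by
    refine intervalIntegral.integral_mono_interval (by positivity) ?_ le_rfl
      (ae_of_all _ hK0) (hKc.intervalIntegrable _ _)
    exact Real.rpow_le_one_of_one_le_of_nonpos (by linarith [n.cast_nonneg (α := ℝ)])
      (by linarith)
  have heq : (∫ s in (a n)..1, K s) = ∑ m ∈ Finset.range n, ∫ s in (a (m + 1))..(a m), K s := by
    rw [intervalIntegral.integral_symm, ← ha0, ← hsum, ← Finset.sum_neg_distrib]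
    exact Finset.sum_congr rfl fun m _ => (intervalIntegral.integral_symm _ _).symm
  have hterm : ∀ m ∈ Finset.range n, c' * sheppTerm ℓ α m ≤ ∫ s in (a (m + 1))..(a m), K s := by
    intro m hm
    have hm1 : (0 : ℝ) < (m : ℝ) + 1 := by positivity
    have hd := (mul_rpow_le_sub_neg hα hm1).1
    have ham : a (m + 1) = ((m : ℝ) + 1 + 1) ^ (-α) := by simp [ha]
    have hd' : α * ((m : ℝ) + 1 + 1) ^ (-α - 1) ≤ a m - a (m + 1) := by rw [ham]; exact hd
    have hab : a (m + 1) ≤ a m := by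
      have : 0 ≤ α * ((m : ℝ) + 1 + 1) ^ (-α - 1) := by positivity
      linarith
    have h1 : (∫ _ in (a (m + 1))..(a m), c * Real.exp (lenSum ℓ m)) ≤
        ∫ s in (a (m + 1))..(a m), K s := by
      refine intervalIntegral.integral_mono_on hab (by simp) (hKc.intervalIntegrable _ _) ?_
      intro s hs
      refine hlow m n (by have := Finset.mem_range.1 hm; omega) s ?_ hs.2
      exact le_trans (by rw [ham]; positivity) hs.1
    rw [intervalIntegral.integral_const, smul_eq_mul] at h1
    refine le_trans ?_ h1
    rw [sheppTerm_eq]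
    have h2 : (1 / 2) ^ (α + 1) * ((m : ℝ) + 1) ^ (-α - 1) ≤ ((m : ℝ) + 1 + 1) ^ (-α - 1) := by
      have e1 : ((1 : ℝ) / 2) ^ (α + 1) = 2 ^ (-α - 1) := by
        rw [show -α - 1 = -(α + 1) by ring, Real.rpow_neg (by norm_num), one_div,
          Real.inv_rpow (by norm_num)]
      rw [e1, ← Real.mul_rpow (by norm_num) hm1.le]
      exact Real.rpow_le_rpow_of_nonpos (by positivity) (by linarith) (by linarith)
    calc c' * (Real.exp (lenSum ℓ m) * ((m : ℝ) + 1) ^ (-α - 1))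
        = α * ((1 / 2) ^ (α + 1) * ((m : ℝ) + 1) ^ (-α - 1)) * (c * Real.exp (lenSum ℓ m)) := by
          rw [hc']; ring
      _ ≤ α * ((m : ℝ) + 1 + 1) ^ (-α - 1) * (c * Real.exp (lenSum ℓ m)) := by gcongr
      _ ≤ (a m - a (m + 1)) * (c * Real.exp (lenSum ℓ m)) := by gcongr
  calc L = c' * (L / c') := by field_simp
    _ ≤ c' * ∑ i ∈ Finset.range n, sheppTerm ℓ α i := by gcongr
    _ = ∑ i ∈ Finset.range n, c' * sheppTerm ℓ α i := Finset.mul_sum _ _ _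
    _ ≤ ∑ m ∈ Finset.range n, ∫ s in (a (m + 1))..(a m), K s := Finset.sum_le_sum hterm
    _ ≤ _ := by rw [← heq]; exact hle

/-- The limiting correlation kernel of all arcs from index `N` on. -/
noncomputable def corrLimit (ℓ : ℕ → ℝ) (α : ℝ) (N : ℕ) (u : ℝ) : ℝ≥0∞ :=
  ⨆ n, ENNReal.ofReal (corrKernel (fun i => ℓ i ^ (-α)) ℓ (Finset.Ico N n) u)

theorem measurable_corrLimit (N : ℕ) : Measurable (corrLimit ℓ α N) :=
  Measurable.iSup fun _ => (continuous_corrKernel _).measurable.ennreal_ofReal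

/-- On the slice ((m+2)^{-α}, (m+1)^{-α}] the kernel is O(e^{ℓ_1+⋯+ℓ_{m+1}}), the weight u^{-γ} is
O(m^{αγ}) and the length is O(m^{-α-1}). Each slice is thus bounded by a term of the series with
exponent α(1 - γ). -/
theorem lintegral_corrLimit_lt_top (hℓ : IsThetaInv ℓ) (hα : 0 < α) {N : ℕ}
    (hN : ∀ i ≥ N, ℓ i ≤ 1 / 2) {γ : ℝ} (hγ : 0 ≤ γ)
    (hsum : Summable (sheppTerm ℓ (α * (1 - γ)))) :
    ∫⁻ u in Ioc (0 : ℝ) 1, corrLimit ℓ α N u * ENNReal.ofReal (u ^ (-γ)) < ∞ := by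
  obtain ⟨C, hC, hup⟩ := corrKernel_le hℓ hα hN
  set a : ℕ → ℝ := fun m => ((m : ℝ) + 1) ^ (-α) with ha
  have ham : ∀ m : ℕ, a (m + 1) = ((m : ℝ) + 2) ^ (-α) := fun m => by
    simp only [ha]; push_cast; ring_nf
  have hcover : Ioc (0 : ℝ) 1 ⊆ ⋃ m : ℕ, Ioc (a (m + 1)) (a m) := by
    intro u hu
    have htend : Tendsto a atTop (𝓝 0) :=
      (tendsto_rpow_neg_atTop hα).comp
        (tendsto_atTop_add_const_right _ 1 tendsto_natCast_atTop_atTop)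
    have hex : ∃ m, a m < u := (htend.eventually_lt_const hu.1).exists
    classical
    have h0 : Nat.find hex ≠ 0 := by
      intro h
      have := Nat.find_spec hex
      rw [h] at this
      simp only [ha, Nat.cast_zero, zero_add, Real.one_rpow] at this
      linarith [hu.2]
    obtain ⟨m, hm⟩ := Nat.exists_eq_succ_of_ne_zero h0
    refine mem_iUnion.2 ⟨m, ?_, not_lt.1 (Nat.find_min hex (by omega))⟩
    have := Nat.find_spec hex
    rwa [hm] at this
  refine (lintegral_mono_set hcover).trans_lt ((lintegral_iUnion_le _ _).trans_lt ?_)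
  set c' := C * (2 ^ (α * γ) * α) with hc'
  have hterm : ∀ m : ℕ, ∫⁻ u in Ioc (a (m + 1)) (a m),
      corrLimit ℓ α N u * ENNReal.ofReal (u ^ (-γ)) ≤
      ENNReal.ofReal (c' * sheppTerm ℓ (α * (1 - γ)) m) := by
    intro m
    have hm1 : (0 : ℝ) < (m : ℝ) + 1 := by positivity
    have hm2 : (0 : ℝ) < (m : ℝ) + 2 := by positivity
    have hpt : ∀ u ∈ Ioc (a (m + 1)) (a m), corrLimit ℓ α N u * ENNReal.ofReal (u ^ (-γ)) ≤
        ENNReal.ofReal (C * Real.exp (lenSum ℓ m) * ((m : ℝ) + 2) ^ (α * γ)) := by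
      intro u hu
      rw [ENNReal.ofReal_mul (by positivity)]
      gcongr
      · refine iSup_le fun n => ENNReal.ofReal_le_ofReal (hup m n u ?_)
        rw [← ham]; exact hu.1.le
      · have h1 : ((m : ℝ) + 2) ^ (-α) ≤ u := by rw [← ham]; exact hu.1.le
        have := Real.rpow_le_rpow_of_nonpos (by positivity) h1 (show -γ ≤ 0 by linarith)
        rwa [← Real.rpow_mul hm2.le, show -α * -γ = α * γ by ring] at this
    calc _ ≤ ∫⁻ u in Ioc (a (m + 1)) (a m),
          ENNReal.ofReal (C * Real.exp (lenSum ℓ m) * ((m : ℝ) + 2) ^ (α * γ)) :=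
          setLIntegral_mono measurable_const hpt
      _ = ENNReal.ofReal (C * Real.exp (lenSum ℓ m) * ((m : ℝ) + 2) ^ (α * γ) *
          (a m - a (m + 1))) := by
          rw [setLIntegral_const, Real.volume_Ioc,
            ENNReal.ofReal_mul (q := a m - a (m + 1)) (by positivity)]
      _ ≤ _ := by
          refine ENNReal.ofReal_le_ofReal ?_
          have h1 : a m - a (m + 1) ≤ α * ((m : ℝ) + 1) ^ (-α - 1) := by
            have := (mul_rpow_le_sub_neg hα hm1).2
            rw [ham, show (m : ℝ) + 2 = (m : ℝ) + 1 + 1 by ring]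
            exact this
          have h3 : 0 ≤ a m - a (m + 1) := by
            rw [ham, sub_nonneg]
            exact Real.rpow_le_rpow_of_nonpos hm1 (by linarith) (by linarith)
          have h2 : ((m : ℝ) + 2) ^ (α * γ) ≤ 2 ^ (α * γ) * ((m : ℝ) + 1) ^ (α * γ) := by
            rw [← Real.mul_rpow (by norm_num) hm1.le]
            exact Real.rpow_le_rpow hm2.le (by linarith) (by positivity)
          calc _ ≤ C * Real.exp (lenSum ℓ m) * (2 ^ (α * γ) * ((m : ℝ) + 1) ^ (α * γ)) *
                (α * ((m : ℝ) + 1) ^ (-α - 1)) := by gcongr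
            _ = c' * (Real.exp (lenSum ℓ m) *
                (((m : ℝ) + 1) ^ (α * γ) * ((m : ℝ) + 1) ^ (-α - 1))) := by rw [hc']; ring
            _ = _ := by
                rw [← Real.rpow_add hm1, sheppTerm_eq]
                ring_nf
  refine (ENNReal.tsum_le_tsum hterm).trans_lt ?_
  rw [← ENNReal.ofReal_tsum_of_nonneg _ (hsum.mul_left c')]
  · exact ENNReal.ofReal_lt_top
  · intro m
    have := (sheppTerm_pos ℓ (α * (1 - γ)) m).le
    positivity

theorem corrLimit_anti (hℓ : IsThetaInv ℓ) {N N' : ℕ}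
    (hN : ∀ i ≥ N, ℓ i ≤ 1 / 2) (h : N ≤ N') (u : ℝ) :
    corrLimit ℓ α N' u ≤ corrLimit ℓ α N u := by
  have hpos := hℓ.pos
  refine iSup_mono fun n => ENNReal.ofReal_le_ofReal ?_
  have hsub : Finset.Ico N' n ⊆ Finset.Ico N n := Finset.Ico_subset_Ico_left h
  have hfac : ∀ i ≥ N, 1 ≤ 1 + ℓ i / (1 - ℓ i) * Real.exp (-(ℓ i ^ (-α) * u)) := by
    intro i hi
    have h1 := hN i hi
    have : 0 ≤ ℓ i / (1 - ℓ i) := div_nonneg (hpos i).le (by linarith)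
    have := mul_nonneg this (Real.exp_pos (-(ℓ i ^ (-α) * u))).le
    linarith
  rw [corrKernel, corrKernel, ← Finset.prod_sdiff hsub]
  refine le_mul_of_one_le_left ?_ ?_
  · exact Finset.prod_nonneg fun i hi => zero_le_one.trans
      (hfac i (h.trans (Finset.mem_Ico.1 hi).1))
  · refine (Finset.prod_const_one (s := Finset.Ico N n \ Finset.Ico N' n)).symm.le.trans ?_
    exact Finset.prod_le_prod (fun _ _ => zero_le_one) fun i hi =>
      hfac i (Finset.mem_Ico.1 (Finset.mem_sdiff.1 hi).1).1

theorem one_le_corrLimit (N : ℕ) (u : ℝ) : 1 ≤ corrLimit ℓ α N u := by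
  refine le_iSup_of_le 0 ?_
  simp [corrKernel]

/-- The supremum lies between 1 and exp(C u^{-1} N^{-α}): at a fixed positive lag, very small arcs
have decorrelated. -/
theorem tendsto_corrLimit (hℓ : IsThetaInv ℓ) (hα : 0 < α) {u : ℝ} (hu : 0 < u) :
    Tendsto (fun N => corrLimit ℓ α N u) atTop (𝓝 1) := by
  obtain ⟨C, hC, htail⟩ := corrKernel_tail_le hℓ hα
  obtain ⟨N₀, hN₀, hhalf⟩ := hℓ.eventually_le
  have hup : Tendsto (fun N : ℕ => ENNReal.ofReal (Real.exp (C * u⁻¹ * (N : ℝ) ^ (-α)))) atTop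
      (𝓝 1) := by
    have h1 : Tendsto (fun N : ℕ => (N : ℝ) ^ (-α)) atTop (𝓝 0) :=
      (tendsto_rpow_neg_atTop hα).comp tendsto_natCast_atTop_atTop
    have h2 := (h1.const_mul (C * u⁻¹)).rexp
    rw [mul_zero, Real.exp_zero] at h2
    have h3 := ENNReal.tendsto_ofReal h2
    rwa [ENNReal.ofReal_one] at h3
  refine tendsto_of_tendsto_of_tendsto_of_le_of_le' tendsto_const_nhds hup
    (Eventually.of_forall fun N => one_le_corrLimit N u) ?_
  filter_upwards [eventually_ge_atTop N₀] with N hN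
  exact iSup_le fun n => ENNReal.ofReal_le_ofReal
    (htail N n (by omega) (fun i hi => hhalf i (hN.trans hi)) u hu)

end Lengths

/-! ### A lower bound for Hausdorff measures of limits of random sets -/

/-- The Riesz kernel on the line. -/
noncomputable def riesz (γ : ℝ) (s t : ℝ) : ℝ≥0∞ := ENNReal.ofReal (|s - t| ^ (-γ))

theorem measurable_riesz (γ : ℝ) : Measurable fun q : ℝ × ℝ => riesz γ q.1 q.2 := by
  unfold riesz; fun_prop

theorem le_riesz {γ : ℝ} (hγ : 0 ≤ γ) {s t : ℝ} (hst : t ≠ s) {d : ℝ≥0∞} (hd : edist s t ≤ d) :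
    d ^ (-γ) ≤ riesz γ s t := by
  have h0 : 0 < |s - t| := abs_pos.2 (sub_ne_zero.2 hst.symm)
  rw [edist_dist, Real.dist_eq] at hd
  rw [riesz, ← ENNReal.ofReal_rpow_of_pos h0, ENNReal.rpow_neg, ENNReal.rpow_neg]
  exact ENNReal.inv_le_inv.2 (ENNReal.rpow_le_rpow hd hγ)

/-- One point s of U with potential at most L suffices: over U the kernel is at least d^{-γ}, so
d^{-γ} μ(U) ≤ L. -/
theorem measure_inter_potential_le {γ : ℝ} (hγ : 0 ≤ γ) {μ : Measure ℝ} (hμ : μ ≪ volume)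
    {L d : ℝ≥0∞} (hd0 : d ≠ 0) (hd : d ≠ ∞) {U : Set ℝ} (hU : MeasurableSet U)
    (hUd : Metric.ediam U ≤ d) :
    μ (U ∩ {s | ∫⁻ t, riesz γ s t ∂μ ≤ L}) ≤ L * d ^ γ := by
  rcases (U ∩ {s | ∫⁻ t, riesz γ s t ∂μ ≤ L}).eq_empty_or_nonempty with h | ⟨s, hsU, hs⟩
  · rw [h]; simp
  refine (measure_mono inter_subset_left).trans ?_
  have hpos : d ^ γ ≠ 0 := (ENNReal.rpow_pos (pos_iff_ne_zero.2 hd0) hd).ne'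
  have hfin : d ^ γ ≠ ∞ := ENNReal.rpow_ne_top_of_nonneg hγ hd
  rw [← ENNReal.div_le_iff hpos hfin, div_eq_mul_inv, ← ENNReal.rpow_neg, mul_comm,
    ← setLIntegral_const]
  refine le_trans ?_ hs
  refine le_trans ?_ (setLIntegral_le_lintegral U _)
  -- For γ > 0 the convention 0^{-γ} = 0 breaks the lower bound on the diagonal t = s, which is null
  -- because μ ≪ volume.
  have hne : ∀ᵐ t ∂(μ.restrict U), t ≠ s :=
    ae_restrict_of_ae (hμ.ae_le (Measure.ae_ne volume s))
  refine lintegral_mono_ae ?_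
  filter_upwards [hne, ae_restrict_mem hU] with t ht htU
  exact le_riesz hγ ht ((Metric.edist_le_ediam_of_mem hsU htU).trans hUd)

/-- Compactness needs open covers with a small sum. Thickening each set t_k by its own diameter plus
a slack costs only a constant factor and a summable error, since r ↦ r^γ is subadditive for γ ≤ 1.
-/
theorem exists_open_cover_of_hausdorffMeasure_eq_zero {γ : ℝ} (hγ : 0 < γ) (hγ1 : γ ≤ 1)
    {A : Set ℝ} (hA : Measure.hausdorffMeasure γ A = 0) {ε : ℝ≥0} (hε : 0 < ε) :
    ∃ (U : ℕ → Set ℝ) (d : ℕ → ℝ≥0∞), (∀ k, IsOpen (U k)) ∧ (∀ k, d k ≠ 0) ∧ (∀ k, d k ≠ ∞) ∧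
      (∀ k, Metric.ediam (U k) ≤ d k) ∧ A ⊆ ⋃ k, U k ∧ ∑' k, d k ^ γ ≤ ε := by
  obtain ⟨x, hx0, hx⟩ := ENNReal.exists_pos_sum_of_countable (ε := (ε / 2 : ℝ≥0))
    (by simpa using hε.ne') ℕ
  rw [Measure.hausdorffMeasure_apply] at hA
  have h1 := le_iSup₂ (f := fun (r : ℝ≥0∞) (_ : 0 < r) =>
        ⨅ (t : ℕ → Set ℝ) (_ : A ⊆ ⋃ n, t n) (_ : ∀ n, Metric.ediam (t n) ≤ r),
          ∑' n, ⨆ _ : (t n).Nonempty, Metric.ediam (t n) ^ γ) 1 one_pos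
  rw [hA] at h1
  have h2 := lt_of_le_of_lt h1 (show (0 : ℝ≥0∞) < (ε / 6 : ℝ≥0) by
    exact ENNReal.coe_pos.2 (by positivity))
  simp only [iInf_lt_iff] at h2
  obtain ⟨t, htA, ht1, hsum⟩ := h2
  set e : ℕ → ℝ≥0∞ := fun k => ⨆ _ : (t k).Nonempty, Metric.ediam (t k) ^ γ with he
  -- Chosen so that (2δ_k)^γ = x_k, a summable error. Positivity of δ_k keeps d_k ≠ 0 even for
  -- singletons.
  set δ : ℕ → ℝ≥0 := fun k => x k ^ (1 / γ) / 2 with hδ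
  have hδ0 : ∀ k, 0 < δ k := fun k => by
    have := NNReal.rpow_pos (p := 1 / γ) (hx0 k)
    exact half_pos this
  have hfin : ∀ k, Metric.ediam (t k) ≠ ∞ := fun k => ne_top_of_le_ne_top ENNReal.one_ne_top (ht1 k)
  set ρ : ℕ → ℝ≥0 := fun k => (Metric.ediam (t k)).toNNReal + δ k with hρ
  refine ⟨fun k => Metric.thickening (ρ k) (t k), fun k => 3 * Metric.ediam (t k) + 2 * δ k,
    fun k => Metric.isOpen_thickening, fun k => ?_, fun k => ?_, fun k => ?_, ?_, ?_⟩
  · have := hδ0 k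
    simp [this.ne']
  · have := hfin k
    finiteness
  · refine (Metric.ediam_thickening_le (ρ k)).trans (le_of_eq ?_)
    simp only [hρ, ENNReal.coe_add, ENNReal.coe_toNNReal (hfin k)]
    ring
  · refine htA.trans (iUnion_mono fun k => Metric.self_subset_thickening ?_ _)
    have := hδ0 k
    simp only [hρ, NNReal.coe_pos]; positivity
  · have hstep : ∀ k, (3 * Metric.ediam (t k) + 2 * (δ k : ℝ≥0∞)) ^ γ ≤ 3 * e k + x k := by
      intro k
      refine (ENNReal.rpow_add_le_add_rpow _ _ hγ.le hγ1).trans ?_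
      have e1 : 2 * (δ k : ℝ≥0∞) = ((x k ^ (1 / γ) : ℝ≥0) : ℝ≥0∞) := by
        rw [show (2 : ℝ≥0∞) = ((2 : ℝ≥0) : ℝ≥0∞) by simp, ← ENNReal.coe_mul]
        congr 1
        simp only [hδ]
        field_simp
      have e2 : (2 * (δ k : ℝ≥0∞)) ^ γ = x k := by
        rw [e1, ← ENNReal.coe_rpow_of_nonneg _ hγ.le, ← NNReal.rpow_mul,
          one_div_mul_cancel hγ.ne', NNReal.rpow_one]
      have e3 : Metric.ediam (t k) ^ γ = e k := by
        rcases (t k).eq_empty_or_nonempty with h | h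
        · simp [he, h, hγ]
        · simp [he, h]
      have e4 : (3 : ℝ≥0∞) ^ γ ≤ 3 := by
        conv_rhs => rw [← ENNReal.rpow_one 3]
        exact ENNReal.rpow_le_rpow_of_exponent_le (by norm_num) hγ1
      rw [e2, ENNReal.mul_rpow_of_nonneg _ _ hγ.le, e3]
      gcongr
    calc _ ≤ ∑' k, (3 * e k + (x k : ℝ≥0∞)) := ENNReal.tsum_le_tsum hstep
      _ = 3 * ∑' k, e k + ∑' k, (x k : ℝ≥0∞) := by rw [ENNReal.tsum_add, ENNReal.tsum_mul_left]
      _ ≤ 3 * (ε / 6 : ℝ≥0) + (ε / 2 : ℝ≥0) := by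
          have := hsum.le
          gcongr
      _ = ε := by
          rw [show (3 : ℝ≥0∞) = ((3 : ℝ≥0) : ℝ≥0∞) by simp, ← ENNReal.coe_mul, ← ENNReal.coe_add]
          congr 1
          field_simp
          norm_num

/-- The energy method without a weak limit of measures. If the Hausdorff measure vanished, an
efficient open cover of the intersection would, by compactness, already cover R n for all large n.
At a good such n, Markov's inequality gives at most half of c to the points of large potential, and
the cover bounds the rest by a quarter of c, contradicting total mass at least c. -/
theorem hausdorffMeasure_iInter_closure_ne_zero {γ : ℝ} (hγ : 0 < γ) (hγ1 : γ ≤ 1)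
    {R : ℕ → Set ℝ} (hR : Antitone R) (hRm : ∀ n, MeasurableSet (R n)) (hR1 : ∀ n, R n ⊆ Icc 0 1)
    {w : ℕ → ℝ≥0∞} {c L : ℝ≥0} (hc : 0 < c)
    (h : ∃ᶠ n in atTop, (c : ℝ≥0∞) ≤ w n * volume (R n) ∧
      w n * (w n * ∫⁻ s in R n, ∫⁻ t in R n, riesz γ s t) ≤ L) :
    Measure.hausdorffMeasure γ (⋂ n, closure (R n)) ≠ 0 := by
  intro h0
  -- Then L/L' ≤ c/2, and the summand 1 keeps L' positive when L = 0. The cover is taken of total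
  -- size c/(4L'), so sets of low potential receive mass at most c/4.
  set L' : ℝ≥0 := 2 * L / c + 1 with hL'
  have hL'0 : 0 < L' := by positivity
  obtain ⟨U, d, hUo, hd0, hdt, hUd, hAU, hsum⟩ :=
    exists_open_cover_of_hausdorffMeasure_eq_zero hγ hγ1 h0 (ε := c / (4 * L')) (by positivity)
  have hcpt : ∀ n, IsCompact (closure (R n)) := fun n =>
    isCompact_Icc.of_isClosed_subset isClosed_closure (closure_minimal (hR1 n) isClosed_Icc)
  have hanti : Antitone fun n => closure (R n) := fun m n hmn => closure_mono (hR hmn)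
  obtain ⟨n₀, hn₀⟩ : ∃ n₀, closure (R n₀) ⊆ ⋃ k, U k := by
    refine exists_subset_nhds_of_isCompact hanti.directed_ge hcpt fun x hx => ?_
    exact (isOpen_iUnion hUo).mem_nhds (hAU hx)
  obtain ⟨n, ⟨hmass, hen⟩, hn⟩ := (h.and_eventually (eventually_ge_atTop n₀)).exists
  set μ : Measure ℝ := w n • volume.restrict (R n) with hμ
  have hμac : μ ≪ volume :=
    (Measure.smul_absolutelyContinuous).trans Measure.restrict_le_self.absolutelyContinuous
  set G : Set ℝ := {s | ∫⁻ t, riesz γ s t ∂μ ≤ L'} with hG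
  have hpot : Measurable fun s => ∫⁻ t, riesz γ s t ∂(volume.restrict (R n)) :=
    (measurable_riesz γ).lintegral_prod_right'
  have hpotμ : ∀ s, ∫⁻ t, riesz γ s t ∂μ = w n * ∫⁻ t in R n, riesz γ s t := fun s => by
    rw [hμ, lintegral_smul_measure, smul_eq_mul]
  have hmeas : Measurable fun s => ∫⁻ t, riesz γ s t ∂μ := by
    simp_rw [hpotμ]; exact hpot.const_mul _
  have henergy : ∫⁻ s, ∫⁻ t, riesz γ s t ∂μ ∂μ ≤ L := by
    simp_rw [hpotμ]
    rw [hμ, lintegral_smul_measure, smul_eq_mul, lintegral_const_mul _ hpot]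
    exact hen
  have hbad : μ Gᶜ ≤ (c / 2 : ℝ≥0) := by
    have h1 : Gᶜ ⊆ {s | (L' : ℝ≥0∞) ≤ ∫⁻ t, riesz γ s t ∂μ} := by
      intro s hs
      simp only [hG, mem_compl_iff, mem_ofPred_eq, not_le] at hs ⊢
      exact hs.le
    refine (measure_mono h1).trans ?_
    refine (meas_ge_le_lintegral_div hmeas.aemeasurable (by simpa using hL'0.ne')
      ENNReal.coe_ne_top).trans ?_
    refine (ENNReal.div_le_div_right henergy _).trans ?_
    rw [← ENNReal.coe_div hL'0.ne']
    refine ENNReal.coe_le_coe.2 ?_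
    rw [div_le_iff₀ hL'0, hL']
    have : c / 2 * (2 * L / c + 1) = L + c / 2 := by field_simp
    rw [this]
    exact le_self_add
  have hgood : μ G ≤ (c / 4 : ℝ≥0) := by
    have h1 : μ G ≤ ∑' k, μ (U k ∩ G) := by
      have h2 : μ G = μ (G ∩ R n) := by
        rw [hμ, Measure.smul_apply, Measure.smul_apply, Measure.restrict_apply' (hRm n),
          Measure.restrict_apply' (hRm n), inter_assoc, inter_self]
      rw [h2]
      refine (measure_mono ?_).trans (measure_iUnion_le _)
      intro s hs
      obtain ⟨k, hk⟩ := mem_iUnion.1 (hn₀ (hanti hn (subset_closure hs.2)))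
      exact mem_iUnion.2 ⟨k, hk, hs.1⟩
    calc μ G ≤ ∑' k, μ (U k ∩ G) := h1
      _ ≤ ∑' k, L' * d k ^ γ := ENNReal.tsum_le_tsum fun k =>
          measure_inter_potential_le hγ.le hμac (hd0 k) (hdt k) (hUo k).measurableSet (hUd k)
      _ = L' * ∑' k, d k ^ γ := ENNReal.tsum_mul_left
      _ ≤ L' * (c / (4 * L') : ℝ≥0) := by gcongr
      _ = (c / 4 : ℝ≥0) := by
          rw [← ENNReal.coe_mul]; congr 1; field_simp
  have htot : (c : ℝ≥0∞) ≤ μ univ := by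
    rw [hμ, Measure.smul_apply, Measure.restrict_apply_univ]; exact hmass
  have : (c : ℝ≥0∞) ≤ (c / 4 + c / 2 : ℝ≥0) := by
    calc (c : ℝ≥0∞) ≤ μ univ := htot
      _ ≤ μ G + μ Gᶜ := by rw [← union_compl_self G]; exact measure_union_le _ _
      _ ≤ _ := by rw [ENNReal.coe_add]; gcongr
  have h3 : c ≤ c / 4 + c / 2 := ENNReal.coe_le_coe.1 this
  have h4 : (c : ℝ) ≤ c / 4 + c / 2 := by exact_mod_cast h3
  have h5 : (0 : ℝ) < c := hc
  linarith

theorem nonempty_iInter_closure {R : ℕ → Set ℝ} (hR : Antitone R) (hR1 : ∀ n, R n ⊆ Icc 0 1)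
    (h : ∃ᶠ n in atTop, (R n).Nonempty) : (⋂ n, closure (R n)).Nonempty := by
  have hcpt : ∀ n, IsCompact (closure (R n)) := fun n =>
    isCompact_Icc.of_isClosed_subset isClosed_closure (closure_minimal (hR1 n) isClosed_Icc)
  have hanti : Antitone fun n => closure (R n) := fun m n hmn => closure_mono (hR hmn)
  refine IsCompact.nonempty_iInter_of_directed_nonempty_isCompact_isClosed _ hanti.directed_ge
    (fun n => ?_) hcpt fun n => isClosed_closure
  obtain ⟨m, hm, hnm⟩ := (h.and_eventually (eventually_ge_atTop n)).exists
  exact (hm.mono (hR hnm)).closure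

/-! ### Closures of free times -/

/-- No two arcs are updated at the same time. -/
def DistinctUpdates (ζ : ℕ → Row) : Prop :=
  ∀ i i' j j' : ℕ, i ≠ i' → renewal (ζ i) (j + 1) ≠ renewal (ζ i') (j' + 1)

theorem expMeasure_absolutelyContinuous (r : ℝ) : expMeasure r ≪ volume := by
  unfold expMeasure gammaMeasure
  exact withDensity_absolutelyContinuous _ _

theorem nullSingletonClass_expMeasure (r : ℝ) : NullSingletonClass (expMeasure r) :=
  ⟨fun x => expMeasure_absolutelyContinuous r (measure_singleton x)⟩

/-- The last waiting time has no atoms and is independent of the earlier ones. The absolute value in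
`renewal` splits the event into two equations. -/
theorem nullSingletonClass_map_renewal {r : ℝ} (hr : 0 < r) (j : ℕ) :
    NullSingletonClass ((rowLaw r).map fun z => renewal z (j + 1)) := by
  have := isProbabilityMeasure_rowLaw hr
  have hind := (indepFun_truncate_fst_snd hr j)
  have := nullSingletonClass_expMeasure r
  have hna : NullSingletonClass ((rowLaw r).map fun z : Row => (z j).2) := by
    rw [rowLaw_map_snd hr]; infer_instance
  refine ⟨fun a => ?_⟩
  rw [Measure.map_apply (by fun_prop) (measurableSet_singleton a)]
  have hX : Measurable fun z : Row => (truncate j z, (z j).1) :=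
    (measurable_truncate j).prodMk (by fun_prop)
  have h1 := measure_eq_of_indepFun_noAtoms hX (by fun_prop) hind
    (g := fun q => a - renewal q.1 j) (by fun_prop)
  have h2 := measure_eq_of_indepFun_noAtoms hX (by fun_prop) hind
    (g := fun q => -(a - renewal q.1 j)) (by fun_prop)
  refine measure_mono_null ?_ (measure_union_null h1 h2)
  intro z hz
  have hz : renewal z (j + 1) = a := hz
  have ht : renewal (truncate j z) j = renewal z j :=
    renewal_congr fun i hi => by simp [truncate, hi]
  rw [renewal_succ] at hz
  have : |(z j).2| = a - renewal z j := by linarith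
  rcases abs_eq (by rw [← this]; exact abs_nonneg _) |>.1 this with h | h
  · left; simpa [ht] using h
  · right; simpa [ht] using h

theorem ae_distinctUpdates {r : ℕ → ℝ} (hr : ∀ i, 0 < r i) :
    ∀ᵐ ζ ∂dataLaw r, DistinctUpdates ζ := by
  have := isProbabilityMeasure_dataLaw hr
  simp only [DistinctUpdates, ae_all_iff]
  intro i i' j j' hii'
  have hind := ((iIndepFun_dataLaw hr).indepFun hii'.symm).comp (measurable_renewal (j' + 1))
    (measurable_renewal (j + 1))
  have hna : NullSingletonClass ((dataLaw r).map
      ((fun z => renewal z (j + 1)) ∘ fun ζ : ℕ → Row => ζ i)) := by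
    rw [← Measure.map_map (by fun_prop) (by fun_prop), dataLaw_map_apply hr]
    exact nullSingletonClass_map_renewal (hr i) j
  have h := measure_eq_of_indepFun_noAtoms (by fun_prop) (by fun_prop) hind measurable_id
  exact measure_eq_zero_iff_ae_notMem.1 h

/-- An arc that is not updated at t keeps its center throughout a neighbourhood of t in [0, ∞), so
it inherits freedom at t from nearby free times. By `DistinctUpdates` at most one arc is updated at
t, and a single arc does not matter for an eventual statement. -/
theorem iInter_closure_free_subset {B : ℕ → Set UnitAddCircle} {ζ : ℕ → Row}
    (hζ : NonExplosive ζ) (hζ' : DistinctUpdates ζ) (N : ℕ) :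
    ⋂ n, closure ({t | ζ ∈ free B (Finset.Ico N n) t} ∩ Icc 0 1) ⊆
      {t | t ∈ Icc (0 : ℝ) 1 ∧ ∀ᶠ i in atTop, ζ i ∈ uncovered (B i) t} := by
  intro t ht
  have htI : t ∈ Icc (0 : ℝ) 1 :=
    closure_minimal inter_subset_right isClosed_Icc (mem_iInter.1 ht 0)
  refine ⟨htI, ?_⟩
  have key : ∀ i ≥ N, (∀ j, renewal (ζ i) (j + 1) ≠ t) → ζ i ∈ uncovered (B i) t := by
    intro i hi hne
    obtain ⟨j, hj⟩ := exists_mem_renewalCount (hζ i) htI.1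
    -- The guard 0 ≤ u is needed when j = 0: at t = 0 every neighbourhood contains negative times,
    -- which belong to no interval of the row.
    have hnb : ∀ᶠ u in 𝓝 t, 0 ≤ u → ζ i ∈ renewalCount u j := by
      rcases j with _ | j
      · filter_upwards [eventually_lt_nhds hj.2] with u hu hu0
        exact ⟨by rwa [renewal_zero], hu⟩
      · have hlt := lt_of_le_of_ne hj.1 (hne j)
        filter_upwards [eventually_lt_nhds hj.2, eventually_gt_nhds hlt] with u hu hu' _
        exact ⟨hu'.le, hu⟩
    obtain ⟨u, hu, huf, huI⟩ := mem_closure_iff_nhds.1 (mem_iInter.1 ht (i + 1)) _ hnb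
    have hu := hu huI.1
    have : ζ i ∈ uncovered (B i) u := huf i (by simp [hi])
    exact (mem_uncovered_iff hj).2 ((mem_uncovered_iff hu).1 this)
  by_cases hbad : ∃ i₀ j₀, renewal (ζ i₀) (j₀ + 1) = t
  · obtain ⟨i₀, j₀, h₀⟩ := hbad
    filter_upwards [eventually_ge_atTop N, eventually_gt_atTop i₀] with i hi hi'
    exact key i hi fun j hj => hζ' i i₀ j j₀ hi'.ne' (hj.trans h₀.symm)
  · push Not at hbad
    filter_upwards [eventually_ge_atTop N] with i hi
    exact key i hi (hbad i)

/-! ### Second moments of the set of free times -/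

/-- The free times in `[0, 1]`. -/
def freeTimes (B : ℕ → Set UnitAddCircle) (I : Finset ℕ) (ζ : ℕ → Row) : Set ℝ :=
  {t | ζ ∈ free B I t} ∩ Icc 0 1

/-- The Riesz energy of Lebesgue measure on the free times. -/
noncomputable def freeEnergy (B : ℕ → Set UnitAddCircle) (I : Finset ℕ) (γ : ℝ) (ζ : ℕ → Row) :
    ℝ≥0∞ := ∫⁻ s in freeTimes B I ζ, ∫⁻ t in freeTimes B I ζ, riesz γ s t

theorem measurable_riesz_right (γ s : ℝ) : Measurable (riesz γ s) := by
  unfold riesz; fun_prop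

section Moments

variable {r : ℕ → ℝ} {B : ℕ → Set UnitAddCircle} {I : Finset ℕ}

theorem measurableSet_freeTimes (hB : ∀ i, MeasurableSet (B i)) (ζ : ℕ → Row) :
    MeasurableSet (freeTimes B I ζ) :=
  MeasurableSet.inter ((show Measurable fun t : ℝ => (t, ζ) by fun_prop)
    (measurableSet_free_prod (I := I) hB)) measurableSet_Icc

theorem measurableSet_freeTimes_prod (hB : ∀ i, MeasurableSet (B i)) :
    MeasurableSet {q : (ℕ → Row) × ℝ | q.2 ∈ freeTimes B I q.1} :=
  MeasurableSet.inter (measurable_swap (measurableSet_free_prod (I := I) hB))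
    (measurable_snd measurableSet_Icc)

theorem measurable_volume_freeTimes (hB : ∀ i, MeasurableSet (B i)) :
    Measurable fun ζ => volume (freeTimes B I ζ) :=
  measurable_measure_prodMk_left (measurableSet_freeTimes_prod hB)

theorem lintegral_volume_freeTimes (hr : ∀ i, 0 < r i) (hB : ∀ i, MeasurableSet (B i)) :
    ∫⁻ ζ, volume (freeTimes B I ζ) ∂dataLaw r =
      ENNReal.ofReal (∏ i ∈ I, (1 - volume.real (B i))) := by
  have := isProbabilityMeasure_dataLaw hr
  have hm := measurableSet_freeTimes_prod (I := I) hB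
  have h1 := Measure.prod_apply (μ := dataLaw r) (ν := (volume : Measure ℝ)) hm
  have h2 := Measure.prod_apply_symm (μ := dataLaw r) (ν := (volume : Measure ℝ)) hm
  have h3 : ∀ t : ℝ, dataLaw r ((fun ζ => (ζ, t)) ⁻¹' {q : (ℕ → Row) × ℝ | q.2 ∈ freeTimes B I q.1}) =
      (Icc (0 : ℝ) 1).indicator
        (fun _ => ENNReal.ofReal (∏ i ∈ I, (1 - volume.real (B i)))) t := by
    intro t
    by_cases ht : t ∈ Icc (0 : ℝ) 1
    · rw [indicator_of_mem ht, ← dataLaw_free hr hB ht.1, ofReal_measureReal]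
      congr 1
      ext ζ
      simp [freeTimes, ht.1, ht.2]
    · rw [indicator_of_notMem ht]
      convert measure_empty (μ := dataLaw r)
      ext ζ
      simp only [freeTimes, mem_preimage, mem_inter_iff, mem_ofPred_eq, ht, and_false,
        mem_empty_iff_false]
  rw [h1] at h2
  refine h2.trans ?_
  rw [lintegral_congr h3, lintegral_indicator measurableSet_Icc, setLIntegral_const]
  simp

theorem measurable_freeEnergy_integrand (hB : ∀ i, MeasurableSet (B i)) (γ : ℝ) :
    Measurable fun q : ((ℕ → Row) × ℝ) × ℝ =>
      ({q : ((ℕ → Row) × ℝ) × ℝ | q.1.2 ∈ freeTimes B I q.1.1 ∧ q.2 ∈ freeTimes B I q.1.1}.indicator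
        (fun q => riesz γ q.1.2 q.2) q) := by
  have hm := measurableSet_freeTimes_prod (I := I) hB
  have h1 : Measurable fun q : ((ℕ → Row) × ℝ) × ℝ => (q.1.1, q.2) := by fun_prop
  refine Measurable.indicator ?_ (MeasurableSet.inter (measurable_fst hm) (h1 hm))
  exact (measurable_riesz γ).comp (by fun_prop :
    Measurable fun q : ((ℕ → Row) × ℝ) × ℝ => (q.1.2, q.2))

theorem freeEnergy_eq (hB : ∀ i, MeasurableSet (B i)) (γ : ℝ) (ζ : ℕ → Row) :
    freeEnergy B I γ ζ = ∫⁻ s, ∫⁻ t,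
      ({q : ((ℕ → Row) × ℝ) × ℝ | q.1.2 ∈ freeTimes B I q.1.1 ∧ q.2 ∈ freeTimes B I q.1.1}.indicator
        (fun q => riesz γ q.1.2 q.2) ((ζ, s), t)) := by
  have hm := measurableSet_freeTimes (I := I) hB ζ
  rw [freeEnergy, ← lintegral_indicator hm]
  refine lintegral_congr fun s => ?_
  by_cases hs : s ∈ freeTimes B I ζ
  · rw [indicator_of_mem hs, ← lintegral_indicator hm]
    refine lintegral_congr fun t => ?_
    by_cases ht : t ∈ freeTimes B I ζ
    · rw [indicator_of_mem ht, indicator_of_mem]; exact ⟨hs, ht⟩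
    · rw [indicator_of_notMem ht, indicator_of_notMem]; exact fun h => ht h.2
  · rw [indicator_of_notMem hs, ← lintegral_zero (μ := (volume : Measure ℝ))]
    refine lintegral_congr fun t => ?_
    rw [indicator_of_notMem]; exact fun h => hs h.1

theorem measurable_freeEnergy (hB : ∀ i, MeasurableSet (B i)) (γ : ℝ) :
    Measurable (freeEnergy B I γ) := by
  have : freeEnergy B I γ = fun ζ => _ := funext (freeEnergy_eq hB γ)
  rw [this]
  exact ((measurable_freeEnergy_integrand hB γ).lintegral_prod_right').lintegral_prod_right'

/-- Tonelli's theorem turns the mean energy into an integral of the two-point function π² K(|s -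
t|). -/
theorem lintegral_freeEnergy (hr : ∀ i, 0 < r i) (hB : ∀ i, MeasurableSet (B i))
    (hp : ∀ i ∈ I, volume.real (B i) < 1) (γ : ℝ) :
    ∫⁻ ζ, freeEnergy B I γ ζ ∂dataLaw r =
      ENNReal.ofReal (∏ i ∈ I, (1 - volume.real (B i))) ^ 2 *
        ∫⁻ s in Icc (0 : ℝ) 1, ∫⁻ t in Icc (0 : ℝ) 1,
          ENNReal.ofReal (corrKernel r (fun i => volume.real (B i)) I |s - t|) * riesz γ s t := by
  have := isProbabilityMeasure_dataLaw hr
  set π := ∏ i ∈ I, (1 - volume.real (B i)) with hπ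
  have hπ0 : 0 ≤ π := Finset.prod_nonneg fun i hi => by linarith [hp i hi]
  set K := corrKernel r (fun i => volume.real (B i)) I with hK
  have hKm : Measurable K := (continuous_corrKernel _).measurable
  set F : ((ℕ → Row) × ℝ) × ℝ → ℝ≥0∞ :=
    {q : ((ℕ → Row) × ℝ) × ℝ | q.1.2 ∈ freeTimes B I q.1.1 ∧ q.2 ∈ freeTimes B I q.1.1}.indicator
      (fun q => riesz γ q.1.2 q.2) with hF
  have hFm : Measurable F := measurable_freeEnergy_integrand hB γ
  have hEF : ∀ ζ, freeEnergy B I γ ζ = ∫⁻ s, ∫⁻ t, F ((ζ, s), t) := freeEnergy_eq hB γ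
  have hFs : Measurable fun q : (ℕ → Row) × ℝ => ∫⁻ t, F (q, t) := hFm.lintegral_prod_right'
  have hswap : ∫⁻ ζ, (∫⁻ s, ∫⁻ t, F ((ζ, s), t)) ∂dataLaw r =
      ∫⁻ s, ∫⁻ ζ, (∫⁻ t, F ((ζ, s), t)) ∂dataLaw r :=
    lintegral_lintegral_swap (f := fun ζ s => ∫⁻ t, F ((ζ, s), t)) hFs.aemeasurable
  simp_rw [hEF]
  rw [hswap]
  have hin : ∀ s, ∫⁻ ζ, (∫⁻ t, F ((ζ, s), t)) ∂dataLaw r = ∫⁻ t, ∫⁻ ζ, F ((ζ, s), t) ∂dataLaw r := by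
    intro s
    refine lintegral_lintegral_swap (f := fun ζ t => F ((ζ, s), t)) ?_
    exact (hFm.comp (by fun_prop : Measurable fun q : (ℕ → Row) × ℝ => ((q.1, s), q.2))).aemeasurable
  simp_rw [hin]
  have hpt : ∀ s t : ℝ, ∫⁻ ζ, F ((ζ, s), t) ∂dataLaw r = (Icc (0 : ℝ) 1).indicator (fun s =>
      (Icc (0 : ℝ) 1).indicator (fun t => ENNReal.ofReal π ^ 2 *
        (ENNReal.ofReal (K |s - t|) * riesz γ s t)) t) s := by
    intro s t
    have hz : ∀ s t : ℝ, ¬ (s ∈ Icc (0 : ℝ) 1 ∧ t ∈ Icc (0 : ℝ) 1) → ∀ ζ, F ((ζ, s), t) = 0 := by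
      intro s t h ζ
      exact indicator_of_notMem (fun h' => h ⟨h'.1.2, h'.2.2⟩) _
    by_cases hs : s ∈ Icc (0 : ℝ) 1
    · by_cases ht : t ∈ Icc (0 : ℝ) 1
      · rw [indicator_of_mem hs, indicator_of_mem ht]
        have e : ∀ ζ, F ((ζ, s), t) =
            (free B I s ∩ free B I t).indicator (fun _ => riesz γ s t) ζ := by
          intro ζ
          have hiff : ((ζ, s), t) ∈ {q : ((ℕ → Row) × ℝ) × ℝ |
              q.1.2 ∈ freeTimes B I q.1.1 ∧ q.2 ∈ freeTimes B I q.1.1} ↔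
              ζ ∈ free B I s ∩ free B I t := by
            simp only [freeTimes, mem_ofPred_eq, mem_inter_iff, hs, ht, and_true]
          by_cases h : ζ ∈ free B I s ∩ free B I t
          · rw [indicator_of_mem h, hF, indicator_of_mem (hiff.2 h)]
          · rw [indicator_of_notMem h, hF, indicator_of_notMem (fun h' => h (hiff.1 h'))]
        rw [lintegral_congr e, lintegral_indicator
          ((measurableSet_free hB s).inter (measurableSet_free hB t)), setLIntegral_const,
          ← ofReal_measureReal, dataLaw_free_inter_free hr hB hp hs.1 ht.1,
          ENNReal.ofReal_mul (by positivity), ENNReal.ofReal_pow hπ0]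
        ring
      · rw [indicator_of_mem hs, indicator_of_notMem ht,
          lintegral_congr (hz s t (fun h => ht h.2)), lintegral_zero]
    · rw [indicator_of_notMem hs, lintegral_congr (hz s t (fun h => hs h.1)), lintegral_zero]
  simp_rw [hpt]
  have hG : Measurable (Function.uncurry fun s t : ℝ =>
      ENNReal.ofReal (K |s - t|) * riesz γ s t) := by
    rw [Function.uncurry_def]
    exact ((hKm.comp (by fun_prop : Measurable fun q : ℝ × ℝ => |q.1 - q.2|)).ennreal_ofReal).mul
      (measurable_riesz γ)
  have hG' : ∀ s : ℝ, Measurable fun t => ENNReal.ofReal (K |s - t|) * riesz γ s t := fun s =>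
    ((hKm.comp (by fun_prop : Measurable fun t : ℝ => |s - t|)).ennreal_ofReal).mul
      (measurable_riesz_right γ s)
  rw [← lintegral_const_mul]
  · rw [← lintegral_indicator measurableSet_Icc]
    refine lintegral_congr fun s => ?_
    by_cases hs : s ∈ Icc (0 : ℝ) 1
    · simp only [indicator_of_mem hs]
      rw [lintegral_indicator measurableSet_Icc, lintegral_const_mul]
      exact hG' s
    · simp only [indicator_of_notMem hs, lintegral_zero]
  · exact hG.lintegral_prod_right

theorem riesz_zero (s t : ℝ) : riesz 0 s t = 1 := by simp [riesz]

theorem freeEnergy_zero (ζ : ℕ → Row) :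
    freeEnergy B I 0 ζ = volume (freeTimes B I ζ) ^ 2 := by
  simp [freeEnergy, riesz_zero, sq]

/-- Chebyshev's inequality for a variable of mean one. -/
theorem measure_lt_half_le {Ω : Type*} [MeasurableSpace Ω] {P : Measure Ω} [IsProbabilityMeasure P]
    {Z : Ω → ℝ≥0∞} (hZ : Measurable Z) (hmean : ∫⁻ ω, Z ω ∂P = 1) :
    P {ω | Z ω < ((1 / 2 : ℝ≥0) : ℝ≥0∞)} ≤ 4 * (∫⁻ ω, Z ω ^ 2 ∂P) - 4 := by
  -- This is 1_{z < 1/2} ≤ 4 (z - 1)², rearranged to avoid subtraction in `ℝ≥0∞`.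
  have hpt : ∀ ω, {ω | Z ω < ((1 / 2 : ℝ≥0) : ℝ≥0∞)}.indicator 1 ω + 8 * Z ω ≤
      4 * Z ω ^ 2 + 4 := by
    intro ω
    rcases eq_or_ne (Z ω) ∞ with h | h
    · simp [h]
    lift Z ω to ℝ≥0 using h with z hz
    by_cases hlt : (z : ℝ≥0∞) < ((1 / 2 : ℝ≥0) : ℝ≥0∞)
    · rw [indicator_of_mem (by simpa [← hz] using hlt), Pi.one_apply]
      have h' : z < 1 / 2 := ENNReal.coe_lt_coe.1 hlt
      have : 1 + 8 * z ≤ 4 * z ^ 2 + 4 := by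
        have h'' : (z : ℝ) < 1 / 2 := by exact_mod_cast h'
        have : (1 : ℝ) + 8 * z ≤ 4 * z ^ 2 + 4 := by nlinarith
        exact_mod_cast this
      exact_mod_cast this
    · rw [indicator_of_notMem (by simpa [← hz] using hlt), zero_add]
      have : 8 * z ≤ 4 * z ^ 2 + 4 := by
        have : (8 : ℝ) * z ≤ 4 * z ^ 2 + 4 := by nlinarith [sq_nonneg ((z : ℝ) - 1)]
        exact_mod_cast this
      exact_mod_cast this
  have hint := lintegral_mono (μ := P) hpt
  have hms : MeasurableSet {ω | Z ω < ((1 / 2 : ℝ≥0) : ℝ≥0∞)} :=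
    measurableSet_lt hZ measurable_const
  rw [lintegral_add_right _ (hZ.const_mul 8), lintegral_indicator_one hms,
    lintegral_const_mul _ hZ, hmean, lintegral_add_right _ measurable_const,
    lintegral_const_mul _ (hZ.pow_const 2)] at hint
  simp only [mul_one, lintegral_const, measure_univ] at hint
  refine ENNReal.le_sub_of_add_le_right (by simp) ?_
  have h8 : (8 : ℝ≥0∞) = 4 + 4 := by norm_num
  rw [h8, ← add_assoc] at hint
  exact (ENNReal.add_le_add_iff_right (by simp)).1 hint

end Moments

/-! ### Integrals of the limiting kernel over the unit square -/

section Square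

theorem lintegral_abs_sub_le {g : ℝ → ℝ≥0∞} {s : ℝ} (hs : s ∈ Icc (0 : ℝ) 1) :
    ∫⁻ t in Icc (0 : ℝ) 1, g |s - t| ≤ 2 * ∫⁻ u in Ioc (0 : ℝ) 1, g u := by
  have h1 : ∫⁻ t in Icc (0 : ℝ) 1, g |s - t| ≤ ∫⁻ v in Icc (-1 : ℝ) 1, g |v| := by
    rw [← lintegral_indicator measurableSet_Icc, ← lintegral_indicator measurableSet_Icc,
      ← lintegral_sub_left_eq_self ((Icc (-1 : ℝ) 1).indicator fun v => g |v|) s]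
    refine lintegral_mono fun t => ?_
    by_cases ht : t ∈ Icc (0 : ℝ) 1
    · rw [indicator_of_mem ht, indicator_of_mem]
      exact ⟨by linarith [hs.1, ht.2], by linarith [hs.2, ht.1]⟩
    · rw [indicator_of_notMem ht]; exact zero_le
  refine h1.trans ?_
  have h2 : Icc (-1 : ℝ) 1 ⊆ Icc (-1) 0 ∪ Icc 0 1 := by
    intro v hv
    rcases le_total v 0 with h | h
    · exact Or.inl ⟨hv.1, h⟩
    · exact Or.inr ⟨h, hv.2⟩
  refine (lintegral_mono_set h2).trans ((lintegral_union_le _ _ _).trans ?_)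
  have h3 : ∫⁻ v in Icc (0 : ℝ) 1, g |v| = ∫⁻ u in Ioc (0 : ℝ) 1, g u := by
    rw [setLIntegral_congr (Ioc_ae_eq_Icc (μ := volume)).symm]
    refine setLIntegral_congr_fun measurableSet_Ioc fun u hu => ?_
    simp only [abs_of_pos hu.1]
  have h4 : ∫⁻ v in Icc (-1 : ℝ) 0, g |v| = ∫⁻ v in Icc (0 : ℝ) 1, g |v| := by
    rw [← lintegral_indicator measurableSet_Icc, ← lintegral_indicator measurableSet_Icc,
      ← lintegral_neg_eq_self]
    refine lintegral_congr fun v => ?_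
    by_cases hv : v ∈ Icc (0 : ℝ) 1
    · rw [indicator_of_mem hv, indicator_of_mem, abs_neg]
      exact ⟨by linarith [hv.2], by linarith [hv.1]⟩
    · rw [indicator_of_notMem hv, indicator_of_notMem]
      exact fun h => hv ⟨by linarith [h.2], by linarith [h.1]⟩
  rw [h4, h3, two_mul]

variable {ℓ : ℕ → ℝ} {α : ℝ}

/-- The expected normalized energy of the times that are free of all arcs from `N` on. -/
noncomputable def squareEnergy (ℓ : ℕ → ℝ) (α : ℝ) (N : ℕ) (γ : ℝ) : ℝ≥0∞ :=
  ∫⁻ s in Icc (0 : ℝ) 1, ∫⁻ t in Icc (0 : ℝ) 1, corrLimit ℓ α N |s - t| * riesz γ s t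

theorem inner_squareEnergy_le (N : ℕ) (γ : ℝ) {s : ℝ} (hs : s ∈ Icc (0 : ℝ) 1) :
    ∫⁻ t in Icc (0 : ℝ) 1, corrLimit ℓ α N |s - t| * riesz γ s t ≤
      2 * ∫⁻ u in Ioc (0 : ℝ) 1, corrLimit ℓ α N u * ENNReal.ofReal (u ^ (-γ)) :=
  lintegral_abs_sub_le (g := fun u => corrLimit ℓ α N u * ENNReal.ofReal (u ^ (-γ))) hs

theorem squareEnergy_lt_top (hℓ : IsThetaInv ℓ) (hα : 0 < α) {N : ℕ}
    (hN : ∀ i ≥ N, ℓ i ≤ 1 / 2) {γ : ℝ} (hγ : 0 ≤ γ)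
    (hsum : Summable (sheppTerm ℓ (α * (1 - γ)))) : squareEnergy ℓ α N γ < ∞ := by
  refine lt_of_le_of_lt (setLIntegral_mono measurable_const fun s hs =>
    inner_squareEnergy_le N γ hs) ?_
  rw [setLIntegral_const]
  have := lintegral_corrLimit_lt_top hℓ hα hN hγ hsum
  simp only [Real.volume_Icc, sub_zero, ENNReal.ofReal_one, mul_one]
  exact ENNReal.mul_lt_top (by simp) this

theorem squareEnergy_anti (hℓ : IsThetaInv ℓ) {N N' : ℕ}
    (hN : ∀ i ≥ N, ℓ i ≤ 1 / 2) (h : N ≤ N') (γ : ℝ) :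
    squareEnergy ℓ α N' γ ≤ squareEnergy ℓ α N γ := by
  refine lintegral_mono fun s => lintegral_mono fun t => ?_
  dsimp only
  gcongr
  exact corrLimit_anti hℓ hN h _

/-- Dominated convergence in t and then in s: off the diagonal the kernel tends to 1, and the kernel
at N₀ is an integrable majorant by summability. Consequently the variance of the normalized length
vanishes as N → ∞. -/
theorem tendsto_squareEnergy_zero (hℓ : IsThetaInv ℓ) (hα : 0 < α)
    (hsum : Summable (sheppTerm ℓ α)) :
    Tendsto (fun N => squareEnergy ℓ α N 0) atTop (𝓝 1) := by
  obtain ⟨N₀, -, hhalf⟩ := hℓ.eventually_le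
  have hM := lintegral_corrLimit_lt_top hℓ hα hhalf le_rfl (by simpa using hsum)
  set M := 2 * ∫⁻ u in Ioc (0 : ℝ) 1, corrLimit ℓ α N₀ u * ENNReal.ofReal (u ^ (-(0 : ℝ))) with hMdef
  have hMtop : M ≠ ∞ := (ENNReal.mul_lt_top (by simp) hM).ne
  have hmeas' : ∀ N s, Measurable fun t : ℝ => corrLimit ℓ α N |s - t| * riesz 0 s t :=
    fun N s => ((measurable_corrLimit N).comp (by fun_prop : Measurable fun t : ℝ => |s - t|)).mul
      (measurable_riesz_right 0 s)
  have hmeas : ∀ N, Measurable (Function.uncurry fun s t : ℝ =>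
      corrLimit ℓ α N |s - t| * riesz 0 s t) := by
    intro N
    rw [Function.uncurry_def]
    exact ((measurable_corrLimit N).comp
      (by fun_prop : Measurable fun q : ℝ × ℝ => |q.1 - q.2|)).mul (measurable_riesz 0)
  have hmeas'' : ∀ N, Measurable fun s : ℝ =>
      ∫⁻ t in Icc (0 : ℝ) 1, corrLimit ℓ α N |s - t| * riesz 0 s t :=
    fun N => (hmeas N).lintegral_prod_right
  have hanti : ∀ N, N₀ ≤ N → ∀ s t, corrLimit ℓ α N |s - t| * riesz 0 s t ≤
      corrLimit ℓ α N₀ |s - t| * riesz 0 s t := by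
    intro N hN s t
    gcongr
    exact corrLimit_anti hℓ hhalf hN _
  have hinner : ∀ s ∈ Icc (0 : ℝ) 1, Tendsto (fun N => ∫⁻ t in Icc (0 : ℝ) 1,
      corrLimit ℓ α N |s - t| * riesz 0 s t) atTop (𝓝 1) := by
    intro s hs
    have h1 : ∫⁻ _ in Icc (0 : ℝ) 1, (1 : ℝ≥0∞) = 1 := by simp
    suffices h2 : Tendsto (fun N => ∫⁻ t in Icc (0 : ℝ) 1, corrLimit ℓ α N |s - t| * riesz 0 s t) atTop
      (𝓝 (∫⁻ _ in Icc (0 : ℝ) 1, (1 : ℝ≥0∞))) by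
      rwa [h1] at h2
    refine tendsto_lintegral_filter_of_dominated_convergence
      (fun t => corrLimit ℓ α N₀ |s - t| * riesz 0 s t)
      (Eventually.of_forall fun N => hmeas' N s) ?_ ?_ ?_
    · filter_upwards [eventually_ge_atTop N₀] with N hN
      exact ae_of_all _ fun t => hanti N hN s t
    · exact ((inner_squareEnergy_le N₀ 0 hs).trans_lt hMtop.lt_top).ne
    · refine ae_restrict_of_ae ?_
      filter_upwards [Measure.ae_ne volume s] with t ht
      simp only [riesz_zero, mul_one]
      exact tendsto_corrLimit hℓ hα (abs_pos.2 (sub_ne_zero.2 ht.symm))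
  have h1 : ∫⁻ _ in Icc (0 : ℝ) 1, (1 : ℝ≥0∞) = 1 := by simp
  suffices h2 : Tendsto (fun N => squareEnergy ℓ α N 0) atTop
      (𝓝 (∫⁻ _ in Icc (0 : ℝ) 1, (1 : ℝ≥0∞))) by
    rwa [h1] at h2
  refine tendsto_lintegral_filter_of_dominated_convergence (fun _ => M)
    (Eventually.of_forall fun N => hmeas'' N) ?_ ?_ ?_
  · filter_upwards [eventually_ge_atTop N₀] with N hN
    filter_upwards [ae_restrict_mem measurableSet_Icc] with s hs
    exact (lintegral_mono fun t => hanti N hN s t).trans (inner_squareEnergy_le N₀ 0 hs)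
  · simpa using hMtop
  · filter_upwards [ae_restrict_mem measurableSet_Icc] with s hs
    exact hinner s hs

end Square

/-! ### Existence of exceptional times -/

/-- The times in `[0, 1]` at which only finitely many arcs cover. -/
def exceptional (B : ℕ → Set UnitAddCircle) (ζ : ℕ → Row) : Set ℝ :=
  {t | t ∈ Icc (0 : ℝ) 1 ∧ ∀ᶠ i in atTop, ζ i ∈ uncovered (B i) t}

section Existence

variable {ℓ : ℕ → ℝ} {α : ℝ} {B : ℕ → Set UnitAddCircle}

/-- The weight that normalizes the length of the free times to mean one. -/
noncomputable def freeWeight (ℓ : ℕ → ℝ) (N n : ℕ) : ℝ≥0 :=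
  (∏ i ∈ Finset.Ico N n, (1 - ℓ i)).toNNReal⁻¹

/-- Large mass and bounded energy. -/
def goodEvent (ℓ : ℕ → ℝ) (B : ℕ → Set UnitAddCircle) (N : ℕ) (γ : ℝ) (L : ℝ≥0) (n : ℕ) :
    Set (ℕ → Row) :=
  {ζ | ((1 / 2 : ℝ≥0) : ℝ≥0∞) ≤ freeWeight ℓ N n * volume (freeTimes B (Finset.Ico N n) ζ) ∧
    freeWeight ℓ N n * (freeWeight ℓ N n * freeEnergy B (Finset.Ico N n) γ ζ) ≤ L}

theorem rpow_neg_pos_of_isThetaInv (hℓ : IsThetaInv ℓ) (α : ℝ) (i : ℕ) : 0 < ℓ i ^ (-α) :=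
  Real.rpow_pos_of_pos (hℓ.pos i) _

/-- Chebyshev's inequality controls small mass and Markov's inequality large energy. The weight
cancels π, so the bound is uniform in n. -/
theorem dataLaw_goodEvent_compl_le (hℓ : IsThetaInv ℓ)
    (hB : ∀ i, MeasurableSet (B i)) {N : ℕ} (hN : ∀ i ≥ N, ℓ i ≤ 1 / 2)
    (hvol : ∀ i ≥ N, volume.real (B i) = ℓ i) (γ : ℝ) {L : ℝ≥0} (hL : 0 < L) (n : ℕ) :
    dataLaw (fun i => ℓ i ^ (-α)) (goodEvent ℓ B N γ L n)ᶜ ≤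
      (4 * squareEnergy ℓ α N 0 - 4) + squareEnergy ℓ α N γ / L := by
  have hr := rpow_neg_pos_of_isThetaInv hℓ α
  have := isProbabilityMeasure_dataLaw hr
  set r : ℕ → ℝ := fun i => ℓ i ^ (-α) with hrdef
  set I := Finset.Ico N n with hI
  have hIN : ∀ i ∈ I, N ≤ i := fun i hi => (Finset.mem_Ico.1 hi).1
  have hp : ∀ i ∈ I, volume.real (B i) < 1 := fun i hi => by
    rw [hvol i (hIN i hi)]; linarith [hN i (hIN i hi)]
  set π := ∏ i ∈ I, (1 - ℓ i) with hπ
  have hπ0 : 0 < π := Finset.prod_pos fun i hi => by linarith [hN i (hIN i hi)]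
  have hπ' : ∏ i ∈ I, (1 - volume.real (B i)) = π :=
    Finset.prod_congr rfl fun i hi => by rw [hvol i (hIN i hi)]
  have hK' : corrKernel r (fun i => volume.real (B i)) I = corrKernel r ℓ I := by
    funext s
    exact Finset.prod_congr rfl fun i hi => by simp only [hvol i (hIN i hi)]
  set w : ℝ≥0 := freeWeight ℓ N n with hw
  have hwπ : (w : ℝ≥0∞) * ENNReal.ofReal π = 1 := by
    rw [ENNReal.ofReal, ← ENNReal.coe_mul]
    have : π.toNNReal ≠ 0 := (Real.toNNReal_pos.2 hπ0).ne'
    rw [hw, freeWeight, ← hI, ← hπ, inv_mul_cancel₀ this, ENNReal.coe_one]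
  have hEn : ∀ γ, ∫⁻ ζ, (w : ℝ≥0∞) * (w * freeEnergy B I γ ζ) ∂dataLaw r ≤
      squareEnergy ℓ α N γ := by
    intro γ
    have hm := measurable_freeEnergy (I := I) hB γ
    rw [lintegral_const_mul _ (hm.const_mul _), lintegral_const_mul _ hm,
      lintegral_freeEnergy hr hB hp, hπ', hK']
    set J := ∫⁻ s in Icc (0 : ℝ) 1, ∫⁻ t in Icc (0 : ℝ) 1,
      ENNReal.ofReal (corrKernel r ℓ I |s - t|) * riesz γ s t with hJ
    calc (w : ℝ≥0∞) * (w * (ENNReal.ofReal π ^ 2 * J))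
        = (w * ENNReal.ofReal π) ^ 2 * J := by ring
      _ = J := by rw [hwπ, one_pow, one_mul]
      _ ≤ squareEnergy ℓ α N γ := by
          refine lintegral_mono fun s => lintegral_mono fun t => ?_
          dsimp only
          gcongr
          exact le_iSup (fun n => ENNReal.ofReal (corrKernel (fun i => ℓ i ^ (-α)) ℓ
            (Finset.Ico N n) |s - t|)) n
  have hvm := measurable_volume_freeTimes (I := I) hB
  have hmean : ∫⁻ ζ, (w : ℝ≥0∞) * volume (freeTimes B I ζ) ∂dataLaw r = 1 := by
    rw [lintegral_const_mul _ hvm, lintegral_volume_freeTimes hr hB, hπ', hwπ]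
  have h1 := measure_lt_half_le (hvm.const_mul (w : ℝ≥0∞)) hmean
  have h2 : ∫⁻ ζ, ((w : ℝ≥0∞) * volume (freeTimes B I ζ)) ^ 2 ∂dataLaw r ≤
      squareEnergy ℓ α N 0 := by
    refine le_trans (le_of_eq (lintegral_congr fun ζ => ?_)) (hEn 0)
    rw [freeEnergy_zero]; ring
  have h3 := meas_ge_le_lintegral_div (μ := dataLaw r)
    (((measurable_freeEnergy (I := I) hB γ).const_mul (w : ℝ≥0∞)).const_mul
      (w : ℝ≥0∞)).aemeasurable (ε := L) (by simpa using hL.ne') ENNReal.coe_ne_top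
  refine (measure_mono ?_).trans ((measure_union_le _ _).trans
    (add_le_add (h1.trans (tsub_le_tsub_right (mul_le_mul_right h2 4) 4))
      (h3.trans (ENNReal.div_le_div_right (hEn γ) _))))
  intro ζ hζ
  by_contra hcon
  simp only [mem_union, mem_ofPred_eq, not_or, not_lt, not_le] at hcon
  exact hζ ⟨hcon.1, hcon.2.le⟩

/-- Bounds uniform in n pass to the event that good events eventually stop. Letting N = L → ∞ makes
that bound vanish, which yields probability one directly. -/
theorem ae_frequently_goodEvent (hℓ : IsThetaInv ℓ) (hα : 0 < α)
    (hB : ∀ i, MeasurableSet (B i)) {N₀ : ℕ} (hN : ∀ i ≥ N₀, ℓ i ≤ 1 / 2)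
    (hvol : ∀ i ≥ N₀, volume.real (B i) = ℓ i) {γ : ℝ} (hγ : 0 ≤ γ)
    (hsum : Summable (sheppTerm ℓ (α * (1 - γ)))) (hsum0 : Summable (sheppTerm ℓ α)) :
    ∀ᵐ ζ ∂dataLaw (fun i => ℓ i ^ (-α)), ∃ (N : ℕ) (L : ℝ≥0), ∃ᶠ n in atTop,
      ζ ∈ goodEvent ℓ B N γ L n := by
  have hr := rpow_neg_pos_of_isThetaInv hℓ α
  have := isProbabilityMeasure_dataLaw hr
  set Q := dataLaw (fun i => ℓ i ^ (-α)) with hQ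
  have hbound : ∀ N, N₀ ≤ N → ∀ L : ℝ≥0, 0 < L →
      Q {ζ | ∀ᶠ n in atTop, ζ ∉ goodEvent ℓ B N γ L n} ≤
        (4 * squareEnergy ℓ α N 0 - 4) + squareEnergy ℓ α N₀ γ / L := by
    intro N hNN L hL
    have e : {ζ | ∀ᶠ n in atTop, ζ ∉ goodEvent ℓ B N γ L n} =
        ⋃ m : ℕ, {ζ | ∀ n ≥ m, ζ ∉ goodEvent ℓ B N γ L n} := by
      ext ζ; simp [eventually_atTop]
    have hmono : Monotone fun m : ℕ => {ζ | ∀ n ≥ m, ζ ∉ goodEvent ℓ B N γ L n} :=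
      fun m m' hmm ζ hζ n hn => hζ n (hmm.trans hn)
    rw [e, hmono.measure_iUnion]
    refine iSup_le fun m => (measure_mono
      (show {ζ | ∀ n ≥ m, ζ ∉ goodEvent ℓ B N γ L n} ⊆ (goodEvent ℓ B N γ L m)ᶜ from
        fun ζ hζ => hζ m le_rfl)).trans
      ((dataLaw_goodEvent_compl_le hℓ hB (fun i hi => hN i (hNN.trans hi))
        (fun i hi => hvol i (hNN.trans hi)) γ hL m).trans ?_)
    have := squareEnergy_anti (α := α) hℓ hN hNN γ
    gcongr
  have hM := squareEnergy_lt_top hℓ hα hN hγ hsum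
  set M := squareEnergy ℓ α N₀ γ with hMdef
  have hzero : Q {ζ | ¬ ∃ (N : ℕ) (L : ℝ≥0), ∃ᶠ n in atTop, ζ ∈ goodEvent ℓ B N γ L n} ≤ 0 := by
    have hb : ∀ k : ℕ, N₀ ≤ k → 0 < k →
        Q {ζ | ¬ ∃ (N : ℕ) (L : ℝ≥0), ∃ᶠ n in atTop, ζ ∈ goodEvent ℓ B N γ L n} ≤
        (4 * squareEnergy ℓ α k 0 - 4) + M / ((k : ℝ≥0) : ℝ≥0∞) := by
      intro k hk hk0
      refine (measure_mono ?_).trans (hbound k hk k (by exact_mod_cast hk0))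
      intro ζ hζ
      simp only [mem_ofPred_eq, not_exists, not_frequently] at hζ ⊢
      exact hζ k k
    have hlim : Tendsto (fun k : ℕ => (4 * squareEnergy ℓ α k 0 - 4) + M / ((k : ℝ≥0) : ℝ≥0∞))
        atTop (𝓝 0) := by
      have h1 := tendsto_squareEnergy_zero hℓ hα hsum0
      have h2 : Tendsto (fun k : ℕ => 4 * squareEnergy ℓ α k 0 - 4) atTop (𝓝 0) := by
        have := ENNReal.Tendsto.const_mul (a := 4) h1 (Or.inr (by simp))
        have := ENNReal.Tendsto.sub this (tendsto_const_nhds (x := (4 : ℝ≥0∞)))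
          (Or.inr (by simp))
        simpa using this
      have h3 : Tendsto (fun k : ℕ => M / ((k : ℝ≥0) : ℝ≥0∞)) atTop (𝓝 0) := by
        simp only [ENNReal.coe_natCast]
        have := ENNReal.Tendsto.const_div (a := M) ENNReal.tendsto_nat_nhds_top (Or.inr hM.ne)
        simpa using this
      simpa using h2.add h3
    refine ge_of_tendsto hlim ?_
    filter_upwards [eventually_ge_atTop N₀, eventually_gt_atTop 0] with k hk hk0
    exact hb k hk hk0
  exact ae_iff.2 (le_antisymm hzero zero_le)

/-- Existence of exceptional times and lower bound for their dimension. -/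
theorem ae_exceptional_lower (hℓ : IsThetaInv ℓ) (hα : 0 < α)
    (hB : ∀ i, MeasurableSet (B i)) {N₀ : ℕ} (hN : ∀ i ≥ N₀, ℓ i ≤ 1 / 2)
    (hvol : ∀ i ≥ N₀, volume.real (B i) = ℓ i) {γ : ℝ≥0} (hγ1 : γ ≤ 1)
    (hsum : Summable (sheppTerm ℓ (α * (1 - γ)))) (hsum0 : Summable (sheppTerm ℓ α)) :
    ∀ᵐ ζ ∂dataLaw (fun i => ℓ i ^ (-α)),
      (exceptional B ζ).Nonempty ∧ (γ : ℝ≥0∞) ≤ dimH (exceptional B ζ) := by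
  have hr := rpow_neg_pos_of_isThetaInv hℓ α
  filter_upwards [ae_frequently_goodEvent hℓ hα hB hN hvol γ.2 hsum hsum0, ae_nonExplosive hr,
    ae_distinctUpdates hr] with ζ hζ h1 h2
  obtain ⟨N, L, hfreq⟩ := hζ
  have hsub := iInter_closure_free_subset (B := B) h1 h2 N
  have hanti : Antitone fun n => freeTimes B (Finset.Ico N n) ζ := by
    intro m n hmn t ht
    exact ⟨fun i hi => ht.1 i (Finset.Ico_subset_Ico_right hmn hi), ht.2⟩
  have hR1 : ∀ n, freeTimes B (Finset.Ico N n) ζ ⊆ Icc 0 1 := fun n => inter_subset_right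
  constructor
  · refine (nonempty_iInter_closure hanti hR1 (hfreq.mono fun n hn => ?_)).mono hsub
    rw [nonempty_iff_ne_empty]
    intro h0
    have := hn.1
    rw [h0] at this
    simp at this
  · rcases eq_or_ne γ 0 with rfl | hγ0
    · simp
    have h := hausdorffMeasure_iInter_closure_ne_zero (γ := γ)
      (NNReal.coe_pos.2 (pos_iff_ne_zero.2 hγ0))
      (by exact_mod_cast hγ1) hanti (fun n => measurableSet_freeTimes hB ζ) hR1
      (w := fun n => freeWeight ℓ N n) (c := 1 / 2) (L := L) (by positivity) hfreq
    exact (le_dimH_of_hausdorffMeasure_ne_zero h).trans (dimH_mono hsub)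

end Existence

/-! ### Upper bounds -/

section Upper

variable {ℓ : ℕ → ℝ} {α : ℝ} {B : ℕ → Set UnitAddCircle}

/-- The times in `[0, 1]` that are free of all arcs from `N` on. -/
def tailFree (B : ℕ → Set UnitAddCircle) (N : ℕ) (ζ : ℕ → Row) : Set ℝ :=
  {t | t ∈ Icc (0 : ℝ) 1 ∧ ∀ i ≥ N, ζ i ∈ uncovered (B i) t}

theorem exceptional_eq_iUnion (ζ : ℕ → Row) (N₀ : ℕ) :
    exceptional B ζ = ⋃ k : ℕ, tailFree B (N₀ + k) ζ := by
  ext t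
  simp only [exceptional, tailFree, mem_iUnion, mem_ofPred_eq, eventually_atTop, exists_and_left,
    and_congr_right_iff]
  intro _
  constructor
  · rintro ⟨N, hN⟩
    exact ⟨N, fun i hi => hN i (by omega)⟩
  · rintro ⟨k, hk⟩
    exact ⟨_, hk⟩

theorem dataLaw_dyadicHit_mul_le (hℓ : IsThetaInv ℓ) (hB : ∀ i, MeasurableSet (B i)) {N : ℕ}
    (hN : ∀ i ≥ N, ℓ i ≤ 1 / 2) (hvol : ∀ i ≥ N, volume.real (B i) = ℓ i) (n : ℕ) {a ε : ℝ}
    (ha : 0 ≤ a) (hε : 0 < ε) :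
    (dataLaw fun i => ℓ i ^ (-α)).real (dyadicHit B (Finset.Ico N n) a ε) *
      (∫ s in (0 : ℝ)..ε, corrKernel (fun i => ℓ i ^ (-α)) ℓ (Finset.Ico N n) s) ≤ 2 * ε := by
  have hr := rpow_neg_pos_of_isThetaInv hℓ α
  have hIN : ∀ i ∈ Finset.Ico N n, N ≤ i := fun i hi => (Finset.mem_Ico.1 hi).1
  have hp : ∀ i ∈ Finset.Ico N n, volume.real (B i) < 1 := fun i hi => by
    rw [hvol i (hIN i hi)]; linarith [hN i (hIN i hi)]
  have hK' : corrKernel (fun i => ℓ i ^ (-α)) (fun i => volume.real (B i)) (Finset.Ico N n) =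
      corrKernel (fun i => ℓ i ^ (-α)) ℓ (Finset.Ico N n) := by
    funext s
    exact Finset.prod_congr rfl fun i hi => by simp only [hvol i (hIN i hi)]
  have := dataLaw_dyadicHit_le hr hB hp ha hε
  rwa [hK'] at this

theorem corrKernel_nonneg (hℓ : IsThetaInv ℓ) {N : ℕ} (hN : ∀ i ≥ N, ℓ i ≤ 1 / 2) (n : ℕ) (s : ℝ) :
    0 ≤ corrKernel (fun i => ℓ i ^ (-α)) ℓ (Finset.Ico N n) s :=
  Finset.prod_nonneg fun i hi => by
    have hpos := hℓ.pos i
    have h1 := hN i (Finset.mem_Ico.1 hi).1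
    have : 0 ≤ ℓ i / (1 - ℓ i) := div_nonneg hpos.le (by linarith)
    positivity

/-- If the series diverges, then there are no exceptional times. -/
theorem ae_exceptional_eq_empty (hℓ : IsThetaInv ℓ) (hα : 0 < α)
    (hB : ∀ i, MeasurableSet (B i)) {N₀ : ℕ} (hN : ∀ i ≥ N₀, ℓ i ≤ 1 / 2)
    (hvol : ∀ i ≥ N₀, volume.real (B i) = ℓ i) (hdiv : ¬ Summable (sheppTerm ℓ α)) :
    ∀ᵐ ζ ∂dataLaw (fun i => ℓ i ^ (-α)), exceptional B ζ = ∅ := by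
  have hr := rpow_neg_pos_of_isThetaInv hℓ α
  have := isProbabilityMeasure_dataLaw hr
  set Q := dataLaw (fun i => ℓ i ^ (-α)) with hQ
  -- The window [0, 2) is half-open and must contain t = 1. The first-hit bound reads X · ∫₀² K ≤ 4
  -- with integrals unbounded in n, forcing X = 0.
  have key : ∀ k : ℕ, Q (⋂ n, dyadicHit B (Finset.Ico (N₀ + k) n) 0 2) = 0 := by
    intro k
    have hN' : ∀ i ≥ N₀ + k, ℓ i ≤ 1 / 2 := fun i hi => hN i (by omega)
    have hvol' : ∀ i ≥ N₀ + k, volume.real (B i) = ℓ i := fun i hi => hvol i (by omega)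
    set X := Q.real (⋂ n, dyadicHit B (Finset.Ico (N₀ + k) n) 0 2) with hX
    have hX0 : 0 ≤ X := measureReal_nonneg
    have hb : ∀ L : ℝ, X * L ≤ 4 := by
      intro L
      obtain ⟨n, hn⟩ := integral_corrKernel_unbounded hℓ hα hN' hdiv L
      have h1 := dataLaw_dyadicHit_mul_le (α := α) hℓ hB hN' hvol' n (a := 0) (ε := 2) le_rfl
        two_pos
      have h2 : X ≤ Q.real (dyadicHit B (Finset.Ico (N₀ + k) n) 0 2) :=
        measureReal_mono (iInter_subset _ n)
      set K := corrKernel (fun i => ℓ i ^ (-α)) ℓ (Finset.Ico (N₀ + k) n) with hK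
      have hKc : Continuous K := continuous_corrKernel _
      have h3 : L ≤ ∫ s in (0 : ℝ)..2, K s := hn.trans
        (intervalIntegral.integral_mono_interval le_rfl zero_le_one one_le_two
          (ae_of_all _ fun s => corrKernel_nonneg hℓ hN' n s) (hKc.intervalIntegrable _ _))
      have h4 : 0 ≤ ∫ s in (0 : ℝ)..2, K s :=
        intervalIntegral.integral_nonneg two_pos.le fun s _ => corrKernel_nonneg hℓ hN' n s
      calc X * L ≤ X * ∫ s in (0 : ℝ)..2, K s := by gcongr
        _ ≤ Q.real (dyadicHit B (Finset.Ico (N₀ + k) n) 0 2) * ∫ s in (0 : ℝ)..2, K s := by gcongr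
        _ ≤ 4 := by linarith
    have hX1 : X = 0 := by
      by_contra h
      have hpos : 0 < X := lt_of_le_of_ne hX0 (Ne.symm h)
      have := hb (5 / X)
      rw [mul_div_cancel₀ _ h] at this
      linarith
    rwa [hX, measureReal_eq_zero_iff] at hX1
  have key' : ∀ᵐ ζ ∂Q, ∀ k : ℕ, ζ ∉ ⋂ n, dyadicHit B (Finset.Ico (N₀ + k) n) 0 2 :=
    ae_all_iff.2 fun k => measure_eq_zero_iff_ae_notMem.1 (key k)
  filter_upwards [key', ae_nonExplosive hr] with ζ hζ hne
  rw [exceptional_eq_iUnion ζ N₀, iUnion_eq_empty]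
  intro k
  rw [eq_empty_iff_forall_notMem]
  intro t ht
  refine hζ k (mem_iInter.2 fun n => ?_)
  refine mem_dyadicHit_of_free hne le_rfl two_pos ht.1.1 (by linarith [ht.1.2]) ?_
  exact fun i hi => ht.2 i (Finset.mem_Ico.1 hi).1

/-- Cut [0, 1] into about x^α intervals of length x^{-α}, where x = m + 1 and e^{ℓ_1+⋯+ℓ_{m+1}} ≥
x^β. Each contains a free time with probability O(x^{-β}), so the expected covering sum is
O(x^{α-β-αγ}) → 0 along such m. Fatou's lemma then gives an almost sure liminf of zero. -/
theorem ae_hausdorffMeasure_tailFree (hℓ : IsThetaInv ℓ) (hα : 0 < α)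
    (hB : ∀ i, MeasurableSet (B i)) {N : ℕ} (hN : ∀ i ≥ N, ℓ i ≤ 1 / 2)
    (hvol : ∀ i ≥ N, volume.real (B i) = ℓ i) {β γ : ℝ} (hγ : 0 < γ) (hβγ : α - β < α * γ)
    (hβ : ∃ᶠ m : ℕ in atTop, ((m : ℝ) + 1) ^ β ≤ Real.exp (lenSum ℓ m)) :
    ∀ᵐ ζ ∂dataLaw (fun i => ℓ i ^ (-α)), Measure.hausdorffMeasure γ (tailFree B N ζ) = 0 := by
  have hr := rpow_neg_pos_of_isThetaInv hℓ α
  have := isProbabilityMeasure_dataLaw hr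
  set Q := dataLaw (fun i => ℓ i ^ (-α)) with hQ
  obtain ⟨c, hc, hlow⟩ := corrKernel_ge hℓ hα hN
  obtain ⟨φ, hφ, hφβ⟩ := extraction_of_frequently_atTop hβ
  set x : ℕ → ℝ := fun m => (φ m : ℝ) + 1 with hx
  have hx0 : ∀ m, 0 < x m := fun m => by positivity
  have hx1 : ∀ m, 1 ≤ x m := fun m => by simp [hx]
  have hxtend : Tendsto x atTop atTop :=
    tendsto_atTop_add_const_right _ 1 (tendsto_natCast_atTop_atTop.comp hφ.tendsto_atTop)
  set ε : ℕ → ℝ := fun m => x m ^ (-α) with hε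
  have hε0 : ∀ m, 0 < ε m := fun m => Real.rpow_pos_of_pos (hx0 m) _
  -- One interval beyond the integer part, so that the endpoint t = 1 is covered.
  set M : ℕ → ℕ := fun m => ⌊x m ^ α⌋₊ + 1 with hM
  set H : ℕ → ℕ → Set (ℕ → Row) := fun m j =>
    dyadicHit B (Finset.Ico N (φ m + 1)) (j * ε m) (ε m) with hH
  have hHm : ∀ m j, MeasurableSet (H m j) := fun m j => measurableSet_dyadicHit hB _ _
  have hprob : ∀ m j, Q.real (H m j) ≤ 2 / c * x m ^ (-β) := by
    intro m j
    have h1 := dataLaw_dyadicHit_mul_le (α := α) hℓ hB hN hvol (φ m + 1) (a := j * ε m)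
      (mul_nonneg (by positivity) (hε0 m).le) (hε0 m)
    set K := corrKernel (fun i => ℓ i ^ (-α)) ℓ (Finset.Ico N (φ m + 1)) with hK
    have hKc : Continuous K := continuous_corrKernel _
    have h2 : (∫ _ in (0 : ℝ)..(ε m), c * x m ^ β) ≤ ∫ s in (0 : ℝ)..(ε m), K s := by
      refine intervalIntegral.integral_mono_on (hε0 m).le (by simp) (hKc.intervalIntegrable _ _) ?_
      intro s hs
      refine le_trans ?_ (hlow (φ m) (φ m + 1) le_rfl s hs.1 hs.2)
      gcongr
      exact hφβ m
    rw [intervalIntegral.integral_const, smul_eq_mul, sub_zero] at h2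
    have hxβ : 0 < x m ^ β := Real.rpow_pos_of_pos (hx0 m) _
    have h3 : Q.real (H m j) * (ε m * (c * x m ^ β)) ≤ 2 * ε m :=
      le_trans (mul_le_mul_of_nonneg_left h2 measureReal_nonneg) h1
    have h4 : Q.real (H m j) * (c * x m ^ β) ≤ 2 := by
      refine le_of_mul_le_mul_left ?_ (hε0 m)
      linarith
    rw [Real.rpow_neg (hx0 m).le]
    rw [← le_div_iff₀ (by positivity)] at h4
    refine h4.trans (le_of_eq ?_)
    field_simp
  set X : ℕ → (ℕ → Row) → ℝ≥0∞ := fun m ζ => ∑ j ∈ Finset.range (M m),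
    (H m j).indicator (fun _ => ENNReal.ofReal (ε m ^ γ)) ζ with hX
  have hXm : ∀ m, Measurable (X m) := fun m =>
    Finset.measurable_fun_sum _ fun j _ => measurable_const.indicator (hHm m j)
  have hEX : ∀ m, ∫⁻ ζ, X m ζ ∂Q ≤ ENNReal.ofReal (4 / c * x m ^ (α - β - α * γ)) := by
    intro m
    rw [lintegral_finsetSum _ fun j _ => measurable_const.indicator (hHm m j)]
    have h1 : ∀ j ∈ Finset.range (M m),
        ∫⁻ ζ, (H m j).indicator (fun _ => ENNReal.ofReal (ε m ^ γ)) ζ ∂Q ≤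
        ENNReal.ofReal (x m ^ (-(α * γ)) * (2 / c * x m ^ (-β))) := by
      intro j _
      have e1 : ε m ^ γ = x m ^ (-(α * γ)) := by
        rw [hε, ← Real.rpow_mul (hx0 m).le]; ring_nf
      rw [lintegral_indicator (hHm m j), setLIntegral_const, ← ofReal_measureReal, e1,
        ← ENNReal.ofReal_mul (Real.rpow_pos_of_pos (hx0 m) _).le]
      refine ENNReal.ofReal_le_ofReal ?_
      have := (Real.rpow_pos_of_pos (hx0 m) (-(α * γ))).le
      gcongr
      exact hprob m j
    refine (Finset.sum_le_sum h1).trans ?_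
    rw [Finset.sum_const, Finset.card_range, nsmul_eq_mul, ← ENNReal.ofReal_natCast,
      ← ENNReal.ofReal_mul (by positivity)]
    refine ENNReal.ofReal_le_ofReal ?_
    have hMle : (M m : ℝ) ≤ 2 * x m ^ α := by
      have h2 : 1 ≤ x m ^ α := Real.one_le_rpow (hx1 m) hα.le
      have h3 : (⌊x m ^ α⌋₊ : ℝ) ≤ x m ^ α := Nat.floor_le (by linarith)
      simp only [hM]; push_cast; linarith
    have h5 : 0 ≤ x m ^ (-(α * γ)) * (2 / c * x m ^ (-β)) := by
      have := hx0 m; positivity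
    calc (M m : ℝ) * (x m ^ (-(α * γ)) * (2 / c * x m ^ (-β)))
        ≤ 2 * x m ^ α * (x m ^ (-(α * γ)) * (2 / c * x m ^ (-β))) := by gcongr
      _ = 4 / c * (x m ^ α * x m ^ (-(α * γ)) * x m ^ (-β)) := by ring
      _ = _ := by
          rw [← Real.rpow_add (hx0 m), ← Real.rpow_add (hx0 m)]
          ring_nf
  have hlim : Tendsto (fun m => ENNReal.ofReal (4 / c * x m ^ (α - β - α * γ))) atTop (𝓝 0) := by
    have h1 : Tendsto (fun m => x m ^ (-(α * γ - (α - β)))) atTop (𝓝 0) :=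
      (tendsto_rpow_neg_atTop (by linarith)).comp hxtend
    have h2 := ENNReal.tendsto_ofReal (h1.const_mul (4 / c))
    rw [mul_zero, ENNReal.ofReal_zero] at h2
    convert h2 using 4
    ring_nf
  have hfatou : ∫⁻ ζ, liminf (fun m => X m ζ) atTop ∂Q = 0 := by
    refine le_antisymm ((lintegral_liminf_le hXm).trans ?_) zero_le
    refine le_trans (liminf_le_liminf (Eventually.of_forall hEX)) ?_
    exact hlim.liminf_eq.le
  have hae := (lintegral_eq_zero_iff (Measurable.liminf hXm)).1 hfatou
  filter_upwards [hae, ae_nonExplosive hr] with ζ hζ hne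
  refine le_antisymm ?_ zero_le
  have hζ : liminf (fun m => X m ζ) atTop = 0 := hζ
  rw [← hζ]
  classical
  -- Intervals that are not hit are replaced by the empty set, whose diameter contributes 0^γ = 0
  -- because γ > 0.
  set T : ∀ m : ℕ, Fin (M m) → Set ℝ := fun m j =>
    if ζ ∈ H m j then Ico ((j : ℕ) * ε m) ((j : ℕ) * ε m + ε m) else ∅ with hT
  have hdiam : ∀ m j, Metric.ediam (T m j) ≤ ENNReal.ofReal (ε m) := by
    intro m j
    simp only [hT]
    split_ifs
    · rw [Real.ediam_Ico]; simp
    · simp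
  have hεlim : Tendsto (fun m => ENNReal.ofReal (ε m)) atTop (𝓝 0) := by
    have h1 : Tendsto ε atTop (𝓝 0) := (tendsto_rpow_neg_atTop hα).comp hxtend
    have := ENNReal.tendsto_ofReal h1
    rwa [ENNReal.ofReal_zero] at this
  have hcover : ∀ m, tailFree B N ζ ⊆ ⋃ j, T m j := by
    intro m t ht
    have hxα : 0 < x m ^ α := Real.rpow_pos_of_pos (hx0 m) _
    have hεx : ε m = (x m ^ α)⁻¹ := Real.rpow_neg (hx0 m).le _
    set j := ⌊t * x m ^ α⌋₊ with hj
    have hj1 : (j : ℝ) ≤ t * x m ^ α := Nat.floor_le (mul_nonneg ht.1.1 hxα.le)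
    have hj2 : t * x m ^ α < j + 1 := Nat.lt_floor_add_one _
    have hjM : j < M m := by
      refine Nat.lt_succ_of_le (Nat.floor_le_floor ?_)
      nlinarith [ht.1.2]
    have h1 : (j : ℝ) * ε m ≤ t := by
      rw [hεx, ← div_eq_mul_inv, div_le_iff₀ hxα]; exact hj1
    have h2 : t < (j : ℝ) * ε m + ε m := by
      rw [← add_one_mul, hεx, ← div_eq_mul_inv, lt_div_iff₀ hxα]; exact hj2
    have hmem : ζ ∈ H m j := mem_dyadicHit_of_free hne
      (mul_nonneg (by positivity) (hε0 m).le) (hε0 m) h1 h2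
      fun i hi => ht.2 i (Finset.mem_Ico.1 hi).1
    refine mem_iUnion.2 ⟨⟨j, hjM⟩, ?_⟩
    simp only [hT, if_pos hmem]
    exact ⟨h1, h2⟩
  refine (Measure.hausdorffMeasure_le_liminf_sum γ (tailFree B N ζ) _ hεlim T
    (Eventually.of_forall hdiam) (Eventually.of_forall hcover)).trans ?_
  refine liminf_le_liminf (Eventually.of_forall fun m => ?_)
  simp only [hX]
  rw [Finset.sum_range]
  refine Finset.sum_le_sum fun j _ => ?_
  by_cases h : ζ ∈ H m j
  · rw [indicator_of_mem h, ← ENNReal.ofReal_rpow_of_pos (hε0 m)]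
    exact ENNReal.rpow_le_rpow (hdiam m j) hγ.le
  · rw [indicator_of_notMem h]
    simp [hT, h, hγ]

/-- Upper bound for the dimension of the exceptional times. -/
theorem ae_dimH_exceptional_le (hℓ : IsThetaInv ℓ) (hα : 0 < α)
    (hB : ∀ i, MeasurableSet (B i)) {N₀ : ℕ} (hN : ∀ i ≥ N₀, ℓ i ≤ 1 / 2)
    (hvol : ∀ i ≥ N₀, volume.real (B i) = ℓ i) {β : ℝ} {γ : ℝ≥0} (hγ : 0 < γ)
    (hβγ : α - β < α * γ)
    (hβ : ∃ᶠ m : ℕ in atTop, ((m : ℝ) + 1) ^ β ≤ Real.exp (lenSum ℓ m)) :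
    ∀ᵐ ζ ∂dataLaw (fun i => ℓ i ^ (-α)), dimH (exceptional B ζ) ≤ γ := by
  have h : ∀ᵐ ζ ∂dataLaw (fun i => ℓ i ^ (-α)), ∀ k : ℕ,
      Measure.hausdorffMeasure γ (tailFree B (N₀ + k) ζ) = 0 :=
    ae_all_iff.2 fun k => ae_hausdorffMeasure_tailFree hℓ hα hB (fun i hi => hN i (by omega))
      (fun i hi => hvol i (by omega)) (by exact_mod_cast hγ) hβγ hβ
  filter_upwards [h] with ζ hζ
  refine dimH_le_of_hausdorffMeasure_ne_top ?_
  rw [exceptional_eq_iUnion ζ N₀, measure_iUnion_null hζ]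
  exact ENNReal.zero_ne_top

end Upper

/-! ### The critical exponent -/

section Exponent

variable {ℓ : ℕ → ℝ} {α : ℝ}

theorem summable_rpow_iff {b : ℝ} :
    Summable (fun n : ℕ => ((n : ℝ) + 1) ^ b) ↔ b < -1 := by
  rw [← Real.summable_nat_rpow, ← summable_nat_add_iff (f := fun n : ℕ => (n : ℝ) ^ b) 1]
  push_cast
  rfl

theorem sheppTerm_anti {β β' : ℝ} (h : β ≤ β') (m : ℕ) : sheppTerm ℓ β' m ≤ sheppTerm ℓ β m := by
  rw [sheppTerm_eq, sheppTerm_eq]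
  gcongr
  linarith [m.cast_nonneg (α := ℝ)]

theorem summable_sheppTerm_mono {β β' : ℝ} (h : β ≤ β') (hs : Summable (sheppTerm ℓ β)) :
    Summable (sheppTerm ℓ β') :=
  hs.of_nonneg_of_le (fun m => (sheppTerm_pos ℓ β' m).le) (sheppTerm_anti h)

theorem lenSum_nonneg (hℓ : IsThetaInv ℓ) (m : ℕ) : 0 ≤ lenSum ℓ m :=
  Finset.sum_nonneg fun i _ => (hℓ.pos i).le

theorem pos_of_summable_sheppTerm (hℓ : IsThetaInv ℓ) {β : ℝ} (hs : Summable (sheppTerm ℓ β)) :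
    0 < β := by
  have : Summable fun n : ℕ => ((n : ℝ) + 1) ^ (-β - 1) := by
    refine hs.of_nonneg_of_le (fun n => by positivity) fun n => ?_
    rw [sheppTerm_eq]
    exact le_mul_of_one_le_left (by positivity) (Real.one_le_exp (lenSum_nonneg hℓ n))
  linarith [summable_rpow_iff.1 this]

theorem sum_inv_le_log (m : ℕ) :
    ∑ k ∈ Finset.range (m + 1), 1 / ((k : ℝ) + 1) ≤ 1 + Real.log ((m : ℝ) + 1) := by
  have h := harmonic_le_one_add_log (m + 1)
  simp only [harmonic, Rat.cast_sum] at h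
  push_cast at h
  simpa [one_div] using h

theorem log_le_sum_inv (m : ℕ) :
    Real.log ((m : ℝ) + 1) ≤ ∑ k ∈ Finset.range (m + 1), 1 / ((k : ℝ) + 1) := by
  have h := log_add_one_le_harmonic (m + 1)
  simp only [harmonic, Rat.cast_sum] at h
  push_cast at h
  have h2 : Real.log ((m : ℝ) + 1) ≤ Real.log ((m : ℝ) + 1 + 1) :=
    Real.log_le_log (by positivity) (by linarith)
  refine h2.trans ?_
  simpa [one_div] using h

theorem exp_lenSum_le {M₁ : ℝ} (hM : 0 ≤ M₁) (h : ∀ n : ℕ, ℓ n ≤ M₁ / ((n : ℝ) + 1)) (m : ℕ) :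
    Real.exp (lenSum ℓ m) ≤ Real.exp M₁ * ((m : ℝ) + 1) ^ M₁ := by
  have hm : (0 : ℝ) < (m : ℝ) + 1 := by positivity
  rw [Real.rpow_def_of_pos hm, ← Real.exp_add]
  refine Real.exp_le_exp.2 ?_
  calc lenSum ℓ m ≤ ∑ k ∈ Finset.range (m + 1), M₁ * (1 / ((k : ℝ) + 1)) :=
        Finset.sum_le_sum fun k _ => (h k).trans (le_of_eq (by ring))
    _ = M₁ * ∑ k ∈ Finset.range (m + 1), 1 / ((k : ℝ) + 1) := by rw [Finset.mul_sum]
    _ ≤ M₁ * (1 + Real.log ((m : ℝ) + 1)) := by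
        have := sum_inv_le_log m
        gcongr
    _ = _ := by ring

theorem rpow_le_exp_lenSum {M₀ : ℝ} (hM : 0 ≤ M₀) (h : ∀ n : ℕ, M₀ / ((n : ℝ) + 1) ≤ ℓ n) (m : ℕ) :
    ((m : ℝ) + 1) ^ M₀ ≤ Real.exp (lenSum ℓ m) := by
  have hm : (0 : ℝ) < (m : ℝ) + 1 := by positivity
  rw [Real.rpow_def_of_pos hm]
  refine Real.exp_le_exp.2 ?_
  calc Real.log ((m : ℝ) + 1) * M₀
      ≤ M₀ * ∑ k ∈ Finset.range (m + 1), 1 / ((k : ℝ) + 1) := by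
        rw [mul_comm]
        have := log_le_sum_inv m
        gcongr
    _ = ∑ k ∈ Finset.range (m + 1), M₀ * (1 / ((k : ℝ) + 1)) := by rw [Finset.mul_sum]
    _ ≤ lenSum ℓ m := Finset.sum_le_sum fun k _ => le_trans (le_of_eq (by ring)) (h k)

theorem summable_sheppTerm_of_le {M₁ β : ℝ} (hM : 0 ≤ M₁)
    (h : ∀ n : ℕ, ℓ n ≤ M₁ / ((n : ℝ) + 1)) (hβ : M₁ < β) : Summable (sheppTerm ℓ β) := by
  have h1 : Summable fun n : ℕ => Real.exp M₁ * ((n : ℝ) + 1) ^ (M₁ + (-β - 1)) :=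
    (summable_rpow_iff.2 (by linarith)).mul_left _
  refine h1.of_nonneg_of_le (fun m => (sheppTerm_pos ℓ β m).le) fun m => ?_
  have hm : (0 : ℝ) < (m : ℝ) + 1 := by positivity
  rw [sheppTerm_eq, Real.rpow_add hm, ← mul_assoc]
  have := exp_lenSum_le hM h m
  gcongr

theorem lt_of_summable_sheppTerm {M₀ β : ℝ} (hM : 0 ≤ M₀)
    (h : ∀ n : ℕ, M₀ / ((n : ℝ) + 1) ≤ ℓ n) (hs : Summable (sheppTerm ℓ β)) : M₀ < β := by
  have h1 : Summable fun n : ℕ => ((n : ℝ) + 1) ^ (M₀ + (-β - 1)) := by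
    refine hs.of_nonneg_of_le (fun m => by positivity) fun m => ?_
    have hm : (0 : ℝ) < (m : ℝ) + 1 := by positivity
    rw [sheppTerm_eq, Real.rpow_add hm]
    have := rpow_le_exp_lenSum hM h m
    gcongr
  linarith [summable_rpow_iff.1 h1]

theorem bddBelow_summable (hℓ : IsThetaInv ℓ) : BddBelow {β : ℝ | Summable (sheppTerm ℓ β)} :=
  ⟨0, fun _ hβ => (pos_of_summable_sheppTerm hℓ hβ).le⟩

theorem nonempty_summable (hℓ : IsThetaInv ℓ) : {β : ℝ | Summable (sheppTerm ℓ β)}.Nonempty := by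
  obtain ⟨M₀, M₁, h0, h01, h⟩ := hℓ
  exact ⟨M₁ + 1, summable_sheppTerm_of_le (h0.le.trans h01) (fun n => (h n).2) (lt_add_one _)⟩

theorem betaZero_nonneg (hℓ : IsThetaInv ℓ) : 0 ≤ betaZero ℓ :=
  le_csInf (nonempty_summable hℓ) fun _ hβ => (pos_of_summable_sheppTerm hℓ hβ).le

theorem summable_of_betaZero_lt (hℓ : IsThetaInv ℓ) {β : ℝ} (h : betaZero ℓ < β) :
    Summable (sheppTerm ℓ β) := by
  obtain ⟨β', hβ', hlt⟩ := exists_lt_of_csInf_lt (nonempty_summable hℓ) h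
  exact summable_sheppTerm_mono hlt.le hβ'

theorem not_summable_of_lt_betaZero (hℓ : IsThetaInv ℓ) {β : ℝ} (h : β < betaZero ℓ) :
    ¬ Summable (sheppTerm ℓ β) := fun hs =>
  absurd (csInf_le (bddBelow_summable hℓ) hs) (not_le.2 h)

theorem frequently_rpow_le_exp_lenSum (hℓ : IsThetaInv ℓ) {β : ℝ} (h : β < betaZero ℓ) :
    ∃ᶠ m : ℕ in atTop, ((m : ℝ) + 1) ^ β ≤ Real.exp (lenSum ℓ m) := by
  -- At the midpoint β' the series diverges. If e^{ℓ_1+⋯+ℓ_{m+1}} < (m+1)^β held eventually, its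
  -- terms would be at most (m+1)^{-1-(β'-β)}, which is summable.
  set β' := (β + betaZero ℓ) / 2 with hβ'
  have h1 := not_summable_of_lt_betaZero hℓ (β := β') (by linarith)
  by_contra hcon
  rw [not_frequently] at hcon
  refine h1 ?_
  have h2 : Summable fun n : ℕ => ((n : ℝ) + 1) ^ (β + (-β' - 1)) :=
    summable_rpow_iff.2 (by linarith)
  refine h2.of_norm_bounded_eventually_nat ?_
  filter_upwards [hcon] with m hm
  have hm0 : (0 : ℝ) < (m : ℝ) + 1 := by positivity
  rw [Real.norm_of_nonneg (sheppTerm_pos ℓ β' m).le, sheppTerm_eq, Real.rpow_add hm0]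
  have := (not_le.1 hm).le
  gcongr

theorem summable_sheppTerm_iff_of_eq_div {c : ℝ} (hℓ : IsThetaInv ℓ)
    (hc : ∀ n : ℕ, ℓ n = c / ((n : ℝ) + 1)) (β : ℝ) : Summable (sheppTerm ℓ β) ↔ c < β := by
  have hc0 : 0 ≤ c := by
    have := (hℓ.pos 0).le
    rw [hc 0] at this
    simpa using this
  exact ⟨lt_of_summable_sheppTerm hc0 fun n => (hc n).ge,
    summable_sheppTerm_of_le hc0 fun n => (hc n).le⟩

theorem betaZero_eq_of_eq_div {c : ℝ} (hℓ : IsThetaInv ℓ)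
    (hc : ∀ n : ℕ, ℓ n = c / ((n : ℝ) + 1)) : betaZero ℓ = c := by
  have : {β : ℝ | Summable (sheppTerm ℓ β)} = Ioi c := by
    ext β; exact summable_sheppTerm_iff_of_eq_div hℓ hc β
  rw [betaZero, this, csInf_Ioi]

end Exponent

/-- The almost sure dimension of the exceptional times of the canonical process. -/
theorem ae_dimH_exceptional {ℓ : ℕ → ℝ} {α : ℝ} {B : ℕ → Set UnitAddCircle} (hℓ : IsThetaInv ℓ)
    (hα : 0 < α) (hB : ∀ i, MeasurableSet (B i)) {N₀ : ℕ} (hN : ∀ i ≥ N₀, ℓ i ≤ 1 / 2)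
    (hvol : ∀ i ≥ N₀, volume.real (B i) = ℓ i) :
    ∀ᵐ ζ ∂dataLaw (fun i => ℓ i ^ (-α)),
      dimH (exceptional B ζ) = ENNReal.ofReal (max (1 - betaZero ℓ / α) 0) := by
  set d : ℝ≥0 := (1 - betaZero ℓ / α).toNNReal with hd
  have hdeq : ENNReal.ofReal (max (1 - betaZero ℓ / α) 0) = d := by
    rw [ENNReal.ofReal, hd, ENNReal.coe_inj]
    ext
    simp
  rw [hdeq]
  have hβ0 := betaZero_nonneg hℓ
  have hd1 : d ≤ 1 := by
    rw [hd, Real.toNNReal_le_one]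
    have : 0 ≤ betaZero ℓ / α := by positivity
    linarith
  have hup : ∀ᵐ ζ ∂dataLaw (fun i => ℓ i ^ (-α)), ∀ k : ℕ,
      dimH (exceptional B ζ) ≤ ((d + 1 / ((k : ℝ≥0) + 1) : ℝ≥0) : ℝ≥0∞) := by
    refine ae_all_iff.2 fun k => ?_
    set δ : ℝ := 1 / ((k : ℝ) + 1) with hδ
    have hδ0 : 0 < δ := by positivity
    -- Half of the room δ in the dimension is spent on moving β below the critical exponent; the
    -- other half gives the strict inequality α - β < α (d + δ).
    refine ae_dimH_exceptional_le hℓ hα hB hN hvol (β := betaZero ℓ - α * δ / 2) (by positivity) ?_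
      (frequently_rpow_le_exp_lenSum hℓ (by have : 0 < α * δ := by positivity
                                            linarith))
    have h1 : 1 - betaZero ℓ / α ≤ d := Real.le_coe_toNNReal _
    have h2 : α * (1 - betaZero ℓ / α) = α - betaZero ℓ := by field_simp
    have h3 : α * (1 - betaZero ℓ / α) ≤ α * d := by gcongr
    push_cast
    rw [← hδ, mul_add]
    have : 0 < α * δ := by positivity
    linarith
  have hlow : ∀ᵐ ζ ∂dataLaw (fun i => ℓ i ^ (-α)), ∀ k : ℕ,
      ((d - 1 / ((k : ℝ≥0) + 1) : ℝ≥0) : ℝ≥0∞) ≤ dimH (exceptional B ζ) := by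
    refine ae_all_iff.2 fun k => ?_
    set γ : ℝ≥0 := d - 1 / ((k : ℝ≥0) + 1) with hγ
    -- The subtraction is truncated: γ = 0 is trivial, and γ ≠ 0 forces d > 0, so d is the
    -- untruncated value 1 - β₀/α.
    rcases eq_or_ne γ 0 with h0 | h0
    · rw [h0]; exact ae_of_all _ fun ζ => by simp
    have hδ0 : (0 : ℝ≥0) < 1 / ((k : ℝ≥0) + 1) := by positivity
    have hle : 1 / ((k : ℝ≥0) + 1) ≤ d := by
      by_contra hcon
      exact h0 (tsub_eq_zero_of_le (not_le.1 hcon).le)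
    have hdpos : 0 < d := hδ0.trans_le hle
    have hdval : (d : ℝ) = 1 - betaZero ℓ / α := by
      rw [hd, Real.coe_toNNReal']
      exact max_eq_left (Real.toNNReal_pos.1 hdpos).le
    have hγd : (γ : ℝ) < d := by
      have : γ < d := tsub_lt_self hdpos hδ0
      exact_mod_cast this
    have hsum : Summable (sheppTerm ℓ (α * (1 - γ))) := by
      refine summable_of_betaZero_lt hℓ ?_
      have h1 : betaZero ℓ = α * (betaZero ℓ / α) := by field_simp
      rw [h1]
      have : betaZero ℓ / α < 1 - γ := by linarith
      gcongr
    have hγ0 : (0 : ℝ) ≤ γ := γ.2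
    have hsum0 : Summable (sheppTerm ℓ α) :=
      summable_sheppTerm_mono (by nlinarith) hsum
    filter_upwards [ae_exceptional_lower hℓ hα hB hN hvol (tsub_le_self.trans hd1) hsum hsum0]
      with ζ hζ using hζ.2
  have hlim : Tendsto (fun k : ℕ => (1 / ((k : ℝ≥0) + 1) : ℝ≥0)) atTop (𝓝 0) := by
    rw [← NNReal.tendsto_coe]
    push_cast
    exact tendsto_one_div_add_atTop_nhds_zero_nat
  have hadd : Tendsto (fun k : ℕ => d + 1 / ((k : ℝ≥0) + 1)) atTop (𝓝 d) := by
    simpa using hlim.const_add d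
  have hsub : Tendsto (fun k : ℕ => d - 1 / ((k : ℝ≥0) + 1)) atTop (𝓝 d) := by
    simpa using (tendsto_const_nhds (x := d)).sub hlim
  filter_upwards [hup, hlow] with ζ h1 h2
  exact le_antisymm (ge_of_tendsto' (ENNReal.tendsto_coe.2 hadd) h1)
    (le_of_tendsto' (ENNReal.tendsto_coe.2 hsub) h2)

/-! ### Transfer from the canonical product space to the given model -/

section Transfer

variable {Ω : Type*} {mΩ : MeasurableSpace Ω} {P : Measure Ω} {ℓ : ℕ → ℝ}
  {α : ℝ} {C : ℕ → ℕ → Ω → UnitAddCircle} {Y : ℕ → ℕ → Ω → ℝ}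

/-- The array of positions and waiting times. -/
def dataMap (C : ℕ → ℕ → Ω → UnitAddCircle) (Y : ℕ → ℕ → Ω → ℝ) (ω : Ω) : ℕ → Row :=
  fun i j => (C i j ω, Y i j ω)

theorem IsPoissonModel.measurable_dataMap (h : IsPoissonModel P ℓ α C Y) :
    Measurable (dataMap C Y) :=
  measurable_pi_lambda _ fun i => measurable_pi_lambda _ fun j =>
    (h.measurable_C i j).prodMk (h.measurable_Y i j)

/-- Independence of the pairs makes the joint law a product over ℕ × ℕ, and currying regroups it
into independent rows. -/
theorem IsPoissonModel.map_dataMap [IsProbabilityMeasure P] (h : IsPoissonModel P ℓ α C Y) (hℓ : ∀ i, 0 < ℓ i ^ (-α)) :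
    P.map (dataMap C Y) = dataLaw (fun i => ℓ i ^ (-α)) := by
  have := fun i => isProbabilityMeasure_expMeasure (hℓ i)
  have hm : ∀ p : ℕ × ℕ, Measurable fun ω => (C p.1 p.2 ω, Y p.1 p.2 ω) := fun p =>
    (h.measurable_C p.1 p.2).prodMk (h.measurable_Y p.1 p.2)
  have hpair : ∀ p : ℕ × ℕ, P.map (fun ω => (C p.1 p.2 ω, Y p.1 p.2 ω)) =
      (volume : Measure UnitAddCircle).prod (expMeasure (ℓ p.1 ^ (-α))) := fun p => by
    rw [(indepFun_iff_map_prod_eq_prod_map_map (h.measurable_C _ _).aemeasurable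
      (h.measurable_Y _ _).aemeasurable).1 (h.indep_pair p.1 p.2), h.law_C, h.law_Y]
  have hall := (iIndepFun_iff_map_fun_eq_infinitePi_map hm).1 h.iIndep_pairs
  simp_rw [hpair] at hall
  have hc : dataMap C Y = MeasurableEquiv.curry ℕ ℕ (UnitAddCircle × ℝ) ∘
      fun ω (p : ℕ × ℕ) => (C p.1 p.2 ω, Y p.1 p.2 ω) := rfl
  rw [hc, ← Measure.map_map (MeasurableEquiv.measurable _) (measurable_pi_lambda _ hm), hall]
  exact Measure.infinitePi_map_curry
    fun i (_ : ℕ) => (volume : Measure UnitAddCircle).prod (expMeasure (ℓ i ^ (-α)))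

theorem expMeasure_Iic_zero {r : ℝ} (hr : 0 < r) : expMeasure r (Iic 0) = 0 := by
  have := isProbabilityMeasure_expMeasure hr
  rw [← ofReal_cdf, cdf_expMeasure_eq hr, if_pos le_rfl]
  simp

theorem IsPoissonModel.ae_pos (h : IsPoissonModel P ℓ α C Y) (hℓ : ∀ i, 0 < ℓ i ^ (-α)) :
    ∀ᵐ ω ∂P, ∀ i j, 0 < Y i j ω := by
  refine ae_all_iff.2 fun i => ae_all_iff.2 fun j => ?_
  have : ∀ᵐ y ∂P.map (Y i j), 0 < y := by
    rw [h.law_Y, ae_iff]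
    simp only [not_lt]
    exact expMeasure_Iic_zero (hℓ i)
  exact ae_of_ae_map (h.measurable_Y i j).aemeasurable this

/-- With positive waiting times the absolute values in `renewal` disappear, and without explosion
exactly one term of the series for the center survives. Covering of x is then symmetric: x lies in
the arc about c exactly when c lies in the ball about x. -/
theorem exceptionalTimes_eq_exceptional {ω : Ω} (hY : ∀ i j, 0 < Y i j ω)
    (hω : NonExplosive (dataMap C Y ω)) (x : UnitAddCircle) :
    exceptionalTimes ℓ C Y x ω =
      exceptional (fun i => Metric.ball x (ℓ i / 2)) (dataMap C Y ω) := by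
  have hup : ∀ i j, updateTime Y i j ω = renewal (dataMap C Y ω i) j := fun i j =>
    Finset.sum_congr rfl fun k _ => (abs_of_pos (hY i k)).symm
  have hcenter : ∀ t : ℝ, 0 ≤ t → ∀ i, x ∈ openArc (center C Y i t ω) (ℓ i) ↔
      dataMap C Y ω i ∉ uncovered (Metric.ball x (ℓ i / 2)) t := by
    intro t ht i
    obtain ⟨j, hj⟩ := exists_mem_renewalCount (hω i) ht
    have hc : center C Y i t ω = C i j ω := by
      rw [center, tsum_eq_single j]
      · refine indicator_of_mem ?_ _
        rw [hup, hup]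
        exact hj
      · intro k hk
        refine indicator_of_notMem (fun hmem => hk ?_) _
        rw [hup, hup] at hmem
        exact renewalCount_unique hmem hj
    rw [mem_uncovered_iff hj, not_not, hc, openArc, Metric.mem_ball_comm]
    rfl
  ext t
  refine and_congr_right fun ht => ?_
  rw [mem_compl_iff, coveredIO, mem_limsup_iff_frequently_mem, not_frequently]
  refine eventually_congr (Eventually.of_forall fun i => ?_)
  rw [hcenter t ht.1 i, not_not]

/-- Only almost sure statements are pulled back, so p needs no measurability; this matters for
`dimH` and for nonemptiness. -/
theorem IsPoissonModel.ae_of_ae_dataLaw [IsProbabilityMeasure P] (h : IsPoissonModel P ℓ α C Y)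
    (hℓ : ∀ i, 0 < ℓ i ^ (-α)) (x : UnitAddCircle) {p : Set ℝ → Prop}
    (hp : ∀ᵐ ζ ∂dataLaw (fun i => ℓ i ^ (-α)),
      p (exceptional (fun i => Metric.ball x (ℓ i / 2)) ζ)) :
    ∀ᵐ ω ∂P, p (exceptionalTimes ℓ C Y x ω) := by
  rw [← h.map_dataMap hℓ] at hp
  have hne := ae_nonExplosive hℓ
  rw [← h.map_dataMap hℓ] at hne
  have hm := h.measurable_dataMap.aemeasurable (μ := P)
  filter_upwards [ae_of_ae_map hm hp, ae_of_ae_map hm hne, h.ae_pos hℓ] with ω h1 h2 h3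
  rwa [exceptionalTimes_eq_exceptional h3 h2]

end Transfer

theorem volume_real_ball {x : UnitAddCircle} {r : ℝ} (h0 : 0 ≤ r) (hr : r ≤ 1) :
    volume.real (Metric.ball x (r / 2)) = r := by
  rw [measureReal_congr AddCircle.closedBall_ae_eq_ball.symm, measureReal_def,
    AddCircle.volume_closedBall, mul_div_cancel₀ _ two_ne_zero, min_eq_right hr,
    ENNReal.toReal_ofReal h0]

end CircleCovering

/-! ### The theorem for the given model -/

theorem theorem1p3 {Ω : Type*} [MeasurableSpace Ω] (P : MeasureTheory.Measure Ω)
    [MeasureTheory.IsProbabilityMeasure P]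
    (ℓ : ℕ → ℝ) (hmono : Antitone ℓ) (hℓ : CircleCovering.IsThetaInv ℓ)
    (α : ℝ) (hα : 0 < α)
    (C : ℕ → ℕ → Ω → UnitAddCircle) (Y : ℕ → ℕ → Ω → ℝ)
    (hmodel : CircleCovering.IsPoissonModel P ℓ α C Y) (x : UnitAddCircle) :
    -- (i) existence of exceptional times, with the special case `ℓ_n = c / n`
    (MeasureTheory.NullMeasurableSet
        {ω | (CircleCovering.exceptionalTimes ℓ C Y x ω).Nonempty} P ∧
      (P {ω | (CircleCovering.exceptionalTimes ℓ C Y x ω).Nonempty} = 1 ↔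
        Summable (CircleCovering.sheppTerm ℓ α)) ∧
      (∀ c : ℝ, (∀ n : ℕ, ℓ n = c / ((n : ℝ) + 1)) →
        (P {ω | (CircleCovering.exceptionalTimes ℓ C Y x ω).Nonempty} = 1 ↔ c < α))) ∧
    -- (ii) Hausdorff dimension of the exceptional times, with the special case `ℓ_n = c / n`
    ((∀ᵐ ω ∂P, dimH (CircleCovering.exceptionalTimes ℓ C Y x ω) =
        ENNReal.ofReal (max (1 - CircleCovering.betaZero ℓ / α) 0)) ∧
      (∀ c : ℝ, (∀ n : ℕ, ℓ n = c / ((n : ℝ) + 1)) → c ≤ α →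
        ∀ᵐ ω ∂P, dimH (CircleCovering.exceptionalTimes ℓ C Y x ω) =
          ENNReal.ofReal (1 - c / α))) := by
  open CircleCovering in
  obtain ⟨N₀, -, hN⟩ := hℓ.eventually_le
  have hr := rpow_neg_pos_of_isThetaInv hℓ α
  have hB : ∀ i, MeasurableSet (Metric.ball x (ℓ i / 2)) := fun i => Metric.isOpen_ball.measurableSet
  have hvol : ∀ i ≥ N₀, volume.real (Metric.ball x (ℓ i / 2)) = ℓ i := fun i hi =>
    volume_real_ball (hℓ.pos i).le ((hN i hi).trans (by norm_num))
  have hdim : ∀ᵐ ω ∂P, dimH (exceptionalTimes ℓ C Y x ω) =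
      ENNReal.ofReal (max (1 - betaZero ℓ / α) 0) :=
    hmodel.ae_of_ae_dataLaw hr x
      (p := fun s => dimH s = ENNReal.ofReal (max (1 - betaZero ℓ / α) 0)) (ae_dimH_exceptional hℓ hα hB hN hvol)
  -- Existence of exceptional times is almost sure or almost surely false. This dichotomy gives the
  -- equivalence, and also measurability for the completion, since the event agrees with a trivial
  -- one up to a null set.
  have hdich : (Summable (sheppTerm ℓ α) ∧ ∀ᵐ ω ∂P, (exceptionalTimes ℓ C Y x ω).Nonempty) ∨
      (¬ Summable (sheppTerm ℓ α) ∧ ∀ᵐ ω ∂P, ¬ (exceptionalTimes ℓ C Y x ω).Nonempty) := by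
    by_cases hs : Summable (sheppTerm ℓ α)
    · refine .inl ⟨hs, hmodel.ae_of_ae_dataLaw hr x (p := fun s => s.Nonempty) ?_⟩
      filter_upwards [ae_exceptional_lower hℓ hα hB hN hvol (γ := 0) zero_le_one
        (by simpa using hs) hs] with ζ hζ using hζ.1
    · refine .inr ⟨hs, hmodel.ae_of_ae_dataLaw hr x (p := fun s => ¬ s.Nonempty) ?_⟩
      filter_upwards [ae_exceptional_eq_empty hℓ hα hB hN hvol hs] with ζ hζ
      simp [hζ]
  have hmain : NullMeasurableSet {ω | (exceptionalTimes ℓ C Y x ω).Nonempty} P ∧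
      (P {ω | (exceptionalTimes ℓ C Y x ω).Nonempty} = 1 ↔ Summable (sheppTerm ℓ α)) := by
    rcases hdich with ⟨hs, h⟩ | ⟨hs, h⟩
    · have he : {ω | (exceptionalTimes ℓ C Y x ω).Nonempty} =ᵐ[P] Set.univ :=
        Filter.eventuallyEq_univ.2 h
      refine ⟨nullMeasurableSet_univ.congr he.symm, ?_⟩
      rw [measure_congr he, measure_univ]
      simp [hs]
    · have h0 : P {ω | (exceptionalTimes ℓ C Y x ω).Nonempty} = 0 := by
        simpa [ae_iff] using h
      exact ⟨.of_null h0, by simp [h0, hs]⟩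
  refine ⟨⟨hmain.1, hmain.2, fun c hc => ?_⟩, hdim, fun c hc hcα => ?_⟩
  · rw [hmain.2, summable_sheppTerm_iff_of_eq_div hℓ hc]
  · filter_upwards [hdim] with ω hω
    rw [hω, betaZero_eq_of_eq_div hℓ hc, max_eq_left]
    rw [sub_nonneg, div_le_one hα]
    exact hcα
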